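/- Let $d\ge 1$ and let $\Phi$ be a probability measure on finite non-negative configurations on $\mathbb Z^d$, i.e. on finitely supported functions $\varphi:\mathbb Z^d\to\{0,1,2,\dots\}$, where $\varphi(\mathbf z)$ is the number of balls at $\mathbf z$. Let $\varphi$ denote a random configuration with law $\Phi$, and write $\|\varphi\|=\sum_{\mathbf z}\varphi(\mathbf z)$, $\lambda=\mathbb E\|\varphi\|$ and $|\!|\!|\varphi|\!|\!|_r=\sum_{\mathbf z}|\mathbf z|^r\varphi(\mathbf z)$, where $|\cdot|$ is the Euclidean norm. Assume that $\Phi$ is irreducible, i.e. not supported on a proper subgroup of $\mathbb Z^d$ (no proper subgroup almost surely contains all sites occupied by $\varphi$), and let $p\in(0,1]$. Consider the branching process on $\mathbb Z^d$ in which every ball carries an independent unit-rate Poisson clock, started at its birth; whenever the clock of a ball at $\mathbf z$ rings, the ball stays where it is and new balls are added according to an independent draw from $\Phi$ translated by $\mathbf z$. Let $X_{\mathbf z,\mathbf x}(t)$ be the number of balls at $\mathbf x$ at time $t$ when the process starts from a single ball at $\mathbf z$, and let $$p_{\mathbf z}(t)=\frac{\mathbb E[X_{\mathbf 0,-\mathbf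 z}(t)]}{\mathbb E\big[\sum_{\mathbf x}X_{\mathbf 0,\mathbf x}(t)\big]}.$$ Let $Y^p_{\mathbf x}(t)$ be the number of balls at $\mathbf x$ at time $t$ when, at time $0$, each site independently holds one ball with probability $p$ and none otherwise, and the balls and their descendants evolve independently as above (the monochromatic process). (i) If $\lambda<\infty$, then for every $t\ge0$ the number $Y^p_{\mathbf 0}(t)$ is almost surely finite and integrable, and $$\mathbb E\big[e^{-\lambda t}Y^p_{\mathbf 0}(t)\big]=p.$$ (ii) If $\mathbb E[\|\varphi\|^2]<\infty$, $\mathbb E[|\!|\!|\varphi|\!|\!|_1^2]<\infty$ and $\mathbb E[|\!|\!|\varphi|\!|\!|_2]<\infty$, then there is a constant $C=C(p,\Phi)>0$ such that, for all $t\ge1$, the variance is finite, $\sum_{\mathbf z}p_{\mathbf z}(t)^2<\infty$, and $$\operatorname{Var}\big[e^{-\lambda t}Y^p_{\mathbf 0}(t)\big]=C\sum_{\mathbf z\in\mathbb Z^d}p_{\mathbf z}(t)^2+O\big(t^{-(d+1)/2}\big)=\Theta\big(t^{-d/2}\big).$$ Here the implied constants in $O$ and $\Theta$ may depend on $d$,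 $p$ and $\Phi$ but not on $t\ge1$. -/

import Mathlib

open MeasureTheory ProbabilityTheory
open scoped ENNReal

namespace BranchingWalk

/-- The sites of the lattice `ℤ^d`. -/
abbrev Site (d : ℕ) : Type := Fin d → ℤ

/-- Finite non-negative configurations on `ℤ^d`: `φ z` is the number of balls at `z`. -/
abbrev Config (d : ℕ) : Type := Site d →₀ ℕ

/-- Configurations form a countable set; they carry the discrete σ-algebra. -/
instance instMeasurableSpaceConfig (d : ℕ) : MeasurableSpace (Config d) := ⊤

instance instDiscreteMeasurableSpaceConfig (d : ℕ) : DiscreteMeasurableSpace (Config d) :=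
  ⟨fun _ => MeasurableSpace.measurableSet_top⟩

/-- The Euclidean norm `|z|` of a site. -/
noncomputable def siteNorm {d : ℕ} (z : Site d) : ℝ := √(∑ i, (z i : ℝ) ^ 2)

/-- `‖φ‖ = ∑_z φ(z)`, the number of balls of `φ`. -/
noncomputable def size {d : ℕ} (φ : Config d) : ℝ := φ.sum fun _ n => (n : ℝ)

/-- `⦀φ⦀_r = ∑_z |z|^r φ(z)`. -/
noncomputable def displacement {d : ℕ} (r : ℕ) (φ : Config d) : ℝ :=
  φ.sum fun z n => siteNorm z ^ r * (n : ℝ)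

/-- `Φ` is irreducible: it is not supported on a proper subgroup of `ℤ^d`, i.e. a subgroup that
almost surely contains every site occupied by a random configuration of law `Φ` is `ℤ^d`. -/
def IsIrreducible {d : ℕ} (Φ : Measure (Config d)) : Prop :=
  ∀ H : AddSubgroup (Site d), (∀ᵐ φ ∂Φ, ∀ z, φ z ≠ 0 → z ∈ H) → H = ⊤

/-- `λ = E‖φ‖`, the mean number of offspring per nucleation. -/
noncomputable def meanOffspring {d : ℕ} (Φ : Measure (Config d)) : ℝ := ∫ φ, size φ ∂Φ

/-! ### The genealogical construction of the process

Every (potential) ball has a label `(z, v)`. Here `z` is the site of its ancestor at time `0`, and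
`v` is its line of descent, the most recent generation first: the label `(z, (k, y, j) :: v)` is
the child of the ball `(z, v)` that is the `j`-th of the balls sent to displacement `y` at the
`k`-th ring of the clock of `(z, v)` (`k` and `j` are counted from `0`). -/

/-- Labels of potential balls. -/
abbrev Ball (d : ℕ) : Type := Site d × List (ℕ × Site d × ℕ)

/-- The randomness that drives the branching: `(ω (b, k)).1` is the waiting time of the ball `b`
for its `k`-th ring since its previous ring (since its birth, if `k = 0`), and `(ω (b, k)).2` is
the offspring configuration drawn at that ring. -/
abbrev BranchNoise (d : ℕ) : Type := Ball d × ℕ → ℝ × Config d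

/-- The law of the driving randomness. Everything is independent; waiting times are exponential
with mean `1` (so that the clocks are unit-rate Poisson processes), offspring has law `Φ`. -/
noncomputable def branchLaw {d : ℕ} (Φ : Measure (Config d)) : Measure (BranchNoise d) :=
  Measure.infinitePi fun _ : Ball d × ℕ => (expMeasure 1).prod Φ

instance instIsProbabilityMeasureBranchLaw {d : ℕ} (Φ : Measure (Config d))
    [IsProbabilityMeasure Φ] : IsProbabilityMeasure (branchLaw Φ) := by
  have : IsProbabilityMeasure (expMeasure 1) := isProbabilityMeasure_expMeasure one_pos
  unfold branchLaw
  infer_instance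

/-- The position of a ball whose ancestor is at `z`. -/
def position {d : ℕ} (z : Site d) : List (ℕ × Site d × ℕ) → Site d
  | [] => z
  | (_, y, _) :: v => position z v + y

/-- The time at which the ball `(z, v)` is born. -/
noncomputable def birthTime {d : ℕ} (ω : BranchNoise d) (z : Site d) :
    List (ℕ × Site d × ℕ) → ℝ
  | [] => 0
  | (k, _, _) :: v => birthTime ω z v + ∑ i ∈ Finset.range (k + 1), (ω ((z, v), i)).1

/-- The label `(z, v)` is the label of an actual descendant of the ancestor at `z`. -/
def IsBorn {d : ℕ} (ω : BranchNoise d) (z : Site d) : List (ℕ × Site d × ℕ) → Prop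
  | [] => True
  | (k, y, j) :: v => IsBorn ω z v ∧ j < (ω ((z, v), k)).2 y

/-- The balls present at site `x` at time `t`, when there is one ancestor at every site.
(Balls neither move nor die.) -/
def ballsAt {d : ℕ} (ω : BranchNoise d) (x : Site d) (t : ℝ) : Set (Ball d) :=
  {b | IsBorn ω b.1 b.2 ∧ birthTime ω b.1 b.2 ≤ t ∧ position b.1 b.2 = x}

/-- `X_{z,x}(t)`: the number of balls at `x` at time `t` in the process that starts from a single
ball at `z`. -/
noncomputable def singleCount {d : ℕ} (z x : Site d) (t : ℝ) (ω : BranchNoise d) : ℕ∞ :=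
  {b ∈ ballsAt ω x t | b.1 = z}.encard

/-- `p_z(t) = E[X_{0,-z}(t)] / E‖X_0(t)‖`, the proportion of the expected number of balls at
time `t` that are expected to be at `-z`, starting from a single ball at the origin. -/
noncomputable def meanProportion {d : ℕ} (Φ : Measure (Config d)) (z : Site d) (t : ℝ) : ℝ :=
  ((∫⁻ ω, (singleCount 0 (-z) t ω : ℝ≥0∞) ∂branchLaw Φ) /
    ∫⁻ ω, ∑' x, (singleCount 0 x t ω : ℝ≥0∞) ∂branchLaw Φ).toReal

/-! ### The monochromatic process from a Bernoulli initial configuration -/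

/-- Initial occupation numbers, together with the randomness that drives the branching. -/
abbrev Sample (d : ℕ) : Type := (Site d → ℕ) × BranchNoise d

/-- The law of the whole system: the initial occupation numbers are i.i.d. Bernoulli with
parameter `p`, and independent of the branching. -/
noncomputable def monoLaw {d : ℕ} (Φ : Measure (Config d)) (p : unitInterval) :
    Measure (Sample d) :=
  (Measure.infinitePi fun _ : Site d => bernoulliMeasure (1 : ℕ) 0 p).prod (branchLaw Φ)

instance instIsProbabilityMeasureMonoLaw {d : ℕ} (Φ : Measure (Config d))
    [IsProbabilityMeasure Φ] (p : unitInterval) : IsProbabilityMeasure (monoLaw Φ p) := by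
  unfold monoLaw
  infer_instance

/-- `Y_x(t)`: the number of balls at `x` at time `t`, all descendants of the sites that are
initially occupied. -/
noncomputable def monoCount {d : ℕ} (x : Site d) (t : ℝ) (s : Sample d) : ℕ∞ :=
  {b ∈ ballsAt s.2 x t | s.1 b.1 = 1}.encard

/-- `e^{-λ t} Y_x(t)`, as a real random variable. -/
noncomputable def normalizedCount {d : ℕ} (Φ : Measure (Config d)) (x : Site d) (t : ℝ)
    (s : Sample d) : ℝ :=
  Real.exp (-meanOffspring Φ * t) * ((monoCount x t s).toNat : ℝ)

end BranchingWalk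

/-!
The process is analysed through its first two moments. Write `λ` for the mean offspring and consider
the random walk that follows a line of descent, i.e. jumps at rate `λ` by the normalized intensity.

*Moments.* The children of a ball are a Poisson process of configurations. Resampling the clock and
the offspring of one ball (`lintegral_infinitePi_piecewise`) together with the renewal identities
for the exponential clock (`lintegral_tsum_ring`, `lintegral_tsum_ring_mul_tsum_ring`) yields the
mean and the correlations of sums over the children of one ball. Iterating over the generations
gives the many-to-one and the many-to-two formulas `lintegral_tsum_contribution` and
`lintegral_tsum_contribution_sq`: the second moment is the square of the mean plus the mean of
`pairOp` over all balls, which accounts for the pairs of balls that separate at a common ring. All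
sums and integrals are taken in `ℝ≥0∞`, so that no integrability is needed up to this point.

*The mean.* Starting from one ball at each site, the mean number of balls at the origin is
`exp (λ t)` by translation invariance (`tsum_meanCount`), which proves the first part.

*The variance.* Let `R t` be the sum of `p_z(t) ^ 2` over `z`, the probability that two independent
copies of the random walk are at the same site at time `t` (`returnProb`). Then
(`variance_normalizedCount`) the variance is
`(p - p ^ 2) * R t + p * ∫ s in 0..t, exp (-λ s) * γ (t - s)`, where `γ` is the mean over the
offspring configuration of the sum of the meeting probabilities over all its ordered pairs of balls
(`meanPairReturn`). If all balls of a configuration `φ` were at the same site, `γ` would be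
`E ‖φ‖ ^ 2 * R`. Since the weight `exp (-λ s)` concentrates on bounded `s`, this suggests the
constant `C = p - p ^ 2 + p * E ‖φ‖ ^ 2 / λ`.

*The error.* By Parseval's identity, `R t` is the integral over the torus of `exp (-2 t ψ)`, with
`ψ` the real part of the exponent of the random walk (`symbol`). The function `ψ` is comparable to
the squared distance to the origin: from above by the second moment of the displacement, and from
below by irreducibility, since the sites `y` such that `|1 - exp (2 π i y θ)| ^ 2` is bounded by a
multiple of `ψ` form a subgroup (`controlledSites`) that contains all sites occupied with positive
probability. Comparison with Gaussian integrals gives that `R t` is of the order `t ^ (-d / 2)`.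
Shifting time or a ball of the configuration inserts into the integral a factor bounded by the
distance to the origin, which gains `t ^ (-1 / 2)` (`exists_smoothness_le`). The lower bound on the
variance for all `t ≥ 1` follows from `γ ≥ λ R`, as each ball of a configuration is paired with
itself.
-/

namespace BranchingWalk

/-! ### Resampling coordinates of an infinite product measure -/

/-- Replacing the coordinates in `S` by those of an independent copy does not change the law. This
is the form in which the independence of the driving randomness is used. -/
theorem lintegral_infinitePi_piecewise {ι : Type*} {X : ι → Type*} [∀ i, MeasurableSpace (X i)]
    (μ : ∀ i, Measure (X i)) [∀ i, IsProbabilityMeasure (μ i)] (S : Set ι)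
    [DecidablePred (· ∈ S)] {h : (∀ i, X i) → ℝ≥0∞} (hh : Measurable h) :
    ∫⁻ ω, h ω ∂Measure.infinitePi μ =
      ∫⁻ ω, ∫⁻ ω', h (S.piecewise ω' ω) ∂Measure.infinitePi μ ∂Measure.infinitePi μ := by
  classical
  have hm : Measurable fun q : (∀ i, X i) × (∀ i, X i) => S.piecewise q.2 q.1 := by
    refine measurable_pi_lambda _ fun i => ?_
    by_cases hi : i ∈ S
    · simp only [Set.piecewise, hi, if_true]; fun_prop
    · simp only [Set.piecewise, hi, if_false]; fun_prop
  have key : ((Measure.infinitePi μ).prod (Measure.infinitePi μ)).map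
      (fun q : (∀ i, X i) × (∀ i, X i) => S.piecewise q.2 q.1) = Measure.infinitePi μ := by
    refine Measure.eq_infinitePi μ fun s t ht => ?_
    rw [Measure.map_apply hm (MeasurableSet.pi s.countable_toSet fun i _ => ht i)]
    have hpre : (fun q : (∀ i, X i) × (∀ i, X i) => S.piecewise q.2 q.1) ⁻¹' (Set.pi s t)
        = (Set.pi (s.filter (· ∉ S) : Finset ι) t) ×ˢ (Set.pi (s.filter (· ∈ S) : Finset ι) t) := by
      ext q
      simp only [Set.mem_preimage, Set.mem_pi, Finset.mem_coe, Set.mem_prod, Finset.mem_filter]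
      constructor
      · refine fun H => ⟨fun i hi => ?_, fun i hi => ?_⟩
        · simpa [Set.piecewise, hi.2] using H i hi.1
        · simpa [Set.piecewise, hi.2] using H i hi.1
      · rintro ⟨H1, H2⟩ i hi
        by_cases his : i ∈ S
        · simpa [Set.piecewise, his] using H2 i ⟨hi, his⟩
        · simpa [Set.piecewise, his] using H1 i ⟨hi, his⟩
    rw [hpre, Measure.prod_prod, Measure.infinitePi_pi _ fun i _ => ht i,
      Measure.infinitePi_pi _ fun i _ => ht i, mul_comm, Finset.prod_filter_mul_prod_filter_not]
  conv_lhs => rw [← key]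
  rw [lintegral_map hh hm]
  exact lintegral_prod _ (hh.comp hm).aemeasurable

/-! ### Renewal identities for the exponential clock -/

theorem lintegral_Ioi_add_left (k : ℝ → ℝ≥0∞) (u : ℝ) :
    ∫⁻ r in Set.Ioi 0, k (u + r) = ∫⁻ s in Set.Ioi u, k s := by
  have := (measurePreserving_add_left (volume : Measure ℝ) u).setLIntegral_comp_preimage_emb
    (measurableEmbedding_addLeft u) k (Set.Ioi u)
  rw [← this]
  simp

/-- Tonelli on the region `0 < u < s`. -/
theorem lintegral_Ioi_Ioi_swap {k : ℝ → ℝ → ℝ≥0∞} (hk : Measurable (Function.uncurry k)) :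
    ∫⁻ u in Set.Ioi (0 : ℝ), ∫⁻ s in Set.Ioi u, k u s =
      ∫⁻ s in Set.Ioi (0 : ℝ), ∫⁻ u in Set.Ioo 0 s, k u s := by
  have h1 : ∀ u : ℝ, ∫⁻ s in Set.Ioi u, k u s = ∫⁻ s, (Set.Ioi u).indicator (k u) s := fun u =>
    (lintegral_indicator measurableSet_Ioi _).symm
  have h2 : ∀ s : ℝ, ∫⁻ u in Set.Ioo 0 s, k u s =
      ∫⁻ u in Set.Ioi 0, (Set.Ioi u).indicator (k u) s := fun s => by
    rw [← lintegral_indicator measurableSet_Ioo, ← lintegral_indicator measurableSet_Ioi]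
    refine lintegral_congr fun u => ?_
    simp only [Set.indicator, Set.mem_Ioo, Set.mem_Ioi]
    split_ifs <;> simp_all
  have hS : MeasurableSet {q : ℝ × ℝ | q.1 < q.2} := measurableSet_lt measurable_fst measurable_snd
  have hm : Measurable (Function.uncurry fun u s => (Set.Ioi u).indicator (k u) s) := by
    have : (Function.uncurry fun u s => (Set.Ioi u).indicator (k u) s) =
        {q : ℝ × ℝ | q.1 < q.2}.indicator (Function.uncurry k) := by
      ext ⟨u, s⟩; simp [Set.indicator, Function.uncurry]
    rw [this]; exact hk.indicator hS
  simp_rw [h1]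
  rw [lintegral_lintegral_swap hm.aemeasurable]
  have h3 : ∀ s : ℝ, s ∉ Set.Ioi (0:ℝ) →
      ∫⁻ u in Set.Ioi 0, (Set.Ioi u).indicator (k u) s = 0 := fun s hs => by
    rw [← h2, Set.Ioo_eq_empty (by simpa using hs)]; simp
  rw [← lintegral_indicator measurableSet_Ioi]
  refine lintegral_congr fun s => ?_
  by_cases hs : s ∈ Set.Ioi (0:ℝ)
  · rw [Set.indicator_of_mem hs, h2]
  · rw [Set.indicator_of_notMem hs, h3 s hs]

theorem lintegral_Ioo_pow_div_factorial (n : ℕ) {s : ℝ} (hs : 0 ≤ s) :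
    ∫⁻ u in Set.Ioo 0 s, ENNReal.ofReal (u ^ n / n.factorial) =
      ENNReal.ofReal (s ^ (n + 1) / (n + 1).factorial) := by
  have hc : Continuous fun u : ℝ => u ^ n / (n.factorial : ℝ) := by fun_prop
  rw [← ofReal_integral_eq_lintegral_ofReal]
  · rw [← integral_Ioc_eq_integral_Ioo, ← intervalIntegral.integral_of_le hs,
      intervalIntegral.integral_div, integral_pow]
    congr 1
    rw [Nat.factorial_succ]
    push_cast
    field_simp
    ring
  · exact (hc.integrableOn_Icc).mono_set Set.Ioo_subset_Icc_self
  · filter_upwards [ae_restrict_mem measurableSet_Ioo] with u hu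
    have := hu.1.le
    positivity

/-- Iterated integration in Cauchy's form: the weight of `k s` is the volume of a simplex. -/
theorem lintegral_pow_div_factorial_mul_shift (n : ℕ) {k : ℝ → ℝ≥0∞} (hk : Measurable k) :
    ∫⁻ u in Set.Ioi (0 : ℝ), ENNReal.ofReal (u ^ n / n.factorial) * ∫⁻ r in Set.Ioi 0, k (u + r) =
      ∫⁻ s in Set.Ioi (0 : ℝ), ENNReal.ofReal (s ^ (n + 1) / (n + 1).factorial) * k s := by
  simp_rw [lintegral_Ioi_add_left k]
  simp_rw [← lintegral_const_mul _ hk]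
  rw [lintegral_Ioi_Ioi_swap (k := fun u s => ENNReal.ofReal (u ^ n / n.factorial) * k s)
    (by unfold Function.uncurry; fun_prop)]
  refine setLIntegral_congr_fun measurableSet_Ioi fun s hs => ?_
  rw [lintegral_mul_const _ (by fun_prop), lintegral_Ioo_pow_div_factorial n (le_of_lt hs)]

theorem lintegral_expMeasure_one {g : ℝ → ℝ≥0∞} (hg : Measurable g) :
    ∫⁻ s, g s ∂expMeasure 1 = ∫⁻ s in Set.Ioi (0 : ℝ), ENNReal.ofReal (Real.exp (-s)) * g s := by
  rw [expMeasure, gammaMeasure, lintegral_withDensity_eq_lintegral_mul _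
    (show Measurable (gammaPDF 1 1) from (measurable_gammaPDFReal 1 1).ennreal_ofReal) hg,
    ← lintegral_indicator measurableSet_Ioi]
  have : ∀ᵐ s : ℝ, s ≠ 0 := by simp [ae_iff]
  refine lintegral_congr_ae (this.mono fun s hs => ?_)
  rcases lt_or_gt_of_ne hs with h | h
  · simp [gammaPDF_of_neg h, not_lt.2 h.le]
  · simp [gammaPDF_of_nonneg h.le, h]

theorem tsum_ofReal_pow_div_factorial {s : ℝ} (hs : 0 ≤ s) :
    ∑' n : ℕ, ENNReal.ofReal (s ^ n / n.factorial) = ENNReal.ofReal (Real.exp s) := by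
  rw [← ENNReal.ofReal_tsum_of_nonneg (fun n => by positivity) (Real.summable_pow_div_factorial s),
    Real.exp_eq_exp_ℝ, NormedSpace.exp_eq_tsum_div]

theorem tsum_add_succ_eq_tsum_ite (b : ℕ → ℝ≥0∞) (k : ℕ) :
    ∑' m, b (k + (m + 1)) = ∑' l, if k < l then b l else 0 := by
  have hinj : Function.Injective fun m : ℕ => k + (m + 1) := fun m m' h => by
    dsimp only at h; omega
  refine Eq.trans (tsum_congr fun m => ?_)
    (hinj.tsum_eq (f := fun l => if k < l then b l else 0) ?_)
  · simp
  · intro l hl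
    have : k < l := by
      by_contra h
      simp [h] at hl
    exact ⟨l - k - 1, by dsimp only; omega⟩

theorem tsum_double_split (a : ℕ → ℕ → ℝ≥0∞) :
    ∑' k, ∑' l, a k l =
      ∑' k, a k k + ∑' k, ∑' m, a k (k + (m + 1)) + ∑' l, ∑' m, a (l + (m + 1)) l := by
  rw [tsum_congr fun k => tsum_add_succ_eq_tsum_ite (a k) k,
    tsum_congr fun l => tsum_add_succ_eq_tsum_ite (fun k => a k l) l,
    ENNReal.tsum_comm (f := fun l k => if l < k then a k l else 0), ← ENNReal.tsum_add,
    ← ENNReal.tsum_add]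
  refine tsum_congr fun k => ?_
  have : a k k = ∑' l, if l = k then a k l else 0 := by
    rw [tsum_eq_single k] <;> simp +contextual
  rw [this, ← ENNReal.tsum_add, ← ENNReal.tsum_add]
  refine tsum_congr fun l => ?_
  rcases lt_trichotomy l k with h | h | h
  · simp [h, h.ne, h.not_gt]
  · simp [h]
  · simp [h, h.ne', h.not_gt]

section Clock

variable {d : ℕ} {ι : Type*} {Φ : Measure (Config d)} [IsProbabilityMeasure Φ]

instance isProbabilityMeasure_expMeasure_one : IsProbabilityMeasure (expMeasure 1) :=
  isProbabilityMeasure_expMeasure one_pos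

/-- The time of the `n`-th ring of a clock is Gamma distributed, and independent of the
offspring drawn at that ring. -/
theorem lintegral_ring {e : ℕ → ι} (he : e.Injective) (n : ℕ) {f : ℝ → Config d → ℝ≥0∞}
    (hf : Measurable (Function.uncurry f)) :
    ∫⁻ ω, f (∑ i ∈ Finset.range (n + 1), (ω (e i)).1) (ω (e n)).2
        ∂Measure.infinitePi (fun _ : ι => (expMeasure 1).prod Φ) =
      ∫⁻ s in Set.Ioi (0 : ℝ), ENNReal.ofReal (s ^ n / n.factorial) *
        (ENNReal.ofReal (Real.exp (-s)) * ∫⁻ φ, f s φ ∂Φ) := by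
  classical
  have hF : ∀ {f : ℝ → Config d → ℝ≥0∞}, Measurable (Function.uncurry f) →
      Measurable fun s => ∫⁻ φ, f s φ ∂Φ := fun hf => hf.lintegral_prod_right'
  have one : ∀ (f : ℝ → Config d → ℝ≥0∞), Measurable (Function.uncurry f) → ∀ n,
      ∫⁻ ω, f (ω (e n)).1 (ω (e n)).2
        ∂Measure.infinitePi (fun _ : ι => (expMeasure 1).prod Φ) =
      ∫⁻ s in Set.Ioi (0 : ℝ), (ENNReal.ofReal (Real.exp (-s)) * ∫⁻ φ, f s φ ∂Φ) := by
    intro f hf n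
    refine ((measurePreserving_eval_infinitePi (fun _ : ι => (expMeasure 1).prod Φ)
      (e n)).lintegral_comp (f := Function.uncurry f) hf).trans ?_
    rw [lintegral_prod _ hf.aemeasurable, ← lintegral_expMeasure_one (hF hf)]
    rfl
  induction n generalizing f with
  | zero => simpa using one f hf 0
  | succ n ih =>
    have hmeas : Measurable fun ω : ι → ℝ × Config d =>
        f (∑ i ∈ Finset.range (n + 1 + 1), (ω (e i)).1) (ω (e (n + 1))).2 :=
      hf.comp (by fun_prop :
        Measurable fun ω : ι → ℝ × Config d =>
          ((∑ i ∈ Finset.range (n + 1 + 1), (ω (e i)).1, (ω (e (n + 1))).2) : ℝ × Config d))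
    rw [lintegral_infinitePi_piecewise _ {e (n + 1)} hmeas]
    have hne : ∀ i ∈ Finset.range (n + 1), e i ≠ e (n + 1) := fun i hi h => by
      have := he h; simp at hi; omega
    have hpw : ∀ ω ω' : ι → ℝ × Config d,
        f (∑ i ∈ Finset.range (n + 1 + 1), ((({e (n + 1)} : Set ι).piecewise ω' ω) (e i)).1)
          ((({e (n + 1)} : Set ι).piecewise ω' ω) (e (n + 1))).2 =
        f (∑ i ∈ Finset.range (n + 1), (ω (e i)).1 + (ω' (e (n + 1))).1) (ω' (e (n + 1))).2 := by
      intro ω ω'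
      rw [Finset.sum_range_succ]
      congr 1
      · congr 1
        · refine Finset.sum_congr rfl fun i hi => ?_
          rw [Set.piecewise_eq_of_notMem _ _ _ (by simpa using hne i hi)]
        · simp [Set.piecewise]
      · simp [Set.piecewise]
    simp_rw [hpw]
    have hin : ∀ u : ℝ, ∫⁻ ω', f (u + (ω' (e (n + 1))).1) (ω' (e (n + 1))).2
        ∂Measure.infinitePi (fun _ : ι => (expMeasure 1).prod Φ) =
        ∫⁻ r in Set.Ioi (0 : ℝ), ENNReal.ofReal (Real.exp (-r)) * ∫⁻ φ, f (u + r) φ ∂Φ := by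
      intro u
      exact one (fun r φ => f (u + r) φ) (hf.comp (by fun_prop :
        Measurable fun q : ℝ × Config d => (u + q.1, q.2))) (n + 1)
    simp_rw [hin]
    have hK : Measurable fun u : ℝ =>
        ∫⁻ r in Set.Ioi (0 : ℝ), ENNReal.ofReal (Real.exp (-r)) * ∫⁻ φ, f (u + r) φ ∂Φ := by
      have : Measurable (Function.uncurry fun u r : ℝ =>
          ENNReal.ofReal (Real.exp (-r)) * ∫⁻ φ, f (u + r) φ ∂Φ) := by
        have := (hF hf).comp (measurable_fst.add measurable_snd : Measurable fun q : ℝ × ℝ => q.1 + q.2)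
        unfold Function.uncurry
        simp only [Function.comp_def] at this
        fun_prop
      exact this.lintegral_prod_right'
    rw [ih (f := fun u _ => ∫⁻ r in Set.Ioi (0 : ℝ), ENNReal.ofReal (Real.exp (-r)) *
      ∫⁻ φ, f (u + r) φ ∂Φ) (hK.comp measurable_fst)]
    rw [← lintegral_pow_div_factorial_mul_shift n
      (k := fun s => ENNReal.ofReal (Real.exp (-s)) * ∫⁻ φ, f s φ ∂Φ)
      (by have := hF hf; fun_prop)]
    refine lintegral_congr fun u => ?_
    congr 1
    rw [lintegral_const, measure_univ, mul_one, ← lintegral_const_mul']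
    · refine lintegral_congr fun r => ?_
      rw [← mul_assoc, ← ENNReal.ofReal_mul (Real.exp_pos _).le, ← Real.exp_add, neg_add]
    · exact ENNReal.ofReal_ne_top

theorem measurable_ring (e : ℕ → ι) {f : ℝ → Config d → ℝ≥0∞}
    (hf : Measurable (Function.uncurry f)) (n : ℕ) :
    Measurable fun ω : ι → ℝ × Config d =>
      f (∑ i ∈ Finset.range (n + 1), (ω (e i)).1) (ω (e n)).2 :=
  hf.comp (by fun_prop : Measurable fun ω : ι → ℝ × Config d =>
    ((∑ i ∈ Finset.range (n + 1), (ω (e i)).1, (ω (e n)).2) : ℝ × Config d))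

/-- The rings of a clock, marked by the offspring drawn, have intensity `ds ⊗ Φ`. -/
theorem lintegral_tsum_ring {e : ℕ → ι} (he : e.Injective) {f : ℝ → Config d → ℝ≥0∞}
    (hf : Measurable (Function.uncurry f)) :
    ∫⁻ ω, ∑' n, f (∑ i ∈ Finset.range (n + 1), (ω (e i)).1) (ω (e n)).2
        ∂Measure.infinitePi (fun _ : ι => (expMeasure 1).prod Φ) =
      ∫⁻ s in Set.Ioi (0 : ℝ), ∫⁻ φ, f s φ ∂Φ := by
  have hF : Measurable fun s => ∫⁻ φ, f s φ ∂Φ := hf.lintegral_prod_right'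
  rw [lintegral_tsum fun n => (measurable_ring e hf n).aemeasurable]
  simp_rw [lintegral_ring he _ hf]
  rw [← lintegral_tsum fun n => by fun_prop]
  refine setLIntegral_congr_fun measurableSet_Ioi fun s hs => ?_
  rw [ENNReal.tsum_mul_right, tsum_ofReal_pow_div_factorial (le_of_lt hs), ← mul_assoc,
    ← ENNReal.ofReal_mul (Real.exp_pos _).le, ← Real.exp_add]
  simp

/-- Pairs of a ring and a later ring: after a ring the clock starts afresh. -/
theorem lintegral_tsum_ring_mul_later {e : ℕ → ι} (he : e.Injective) {f g : ℝ → Config d → ℝ≥0∞}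
    (hf : Measurable (Function.uncurry f)) (hg : Measurable (Function.uncurry g)) :
    ∫⁻ ω, ∑' k, ∑' m, f (∑ i ∈ Finset.range (k + 1), (ω (e i)).1) (ω (e k)).2 *
        g (∑ i ∈ Finset.range (k + (m + 1) + 1), (ω (e i)).1) (ω (e (k + (m + 1)))).2
        ∂Measure.infinitePi (fun _ : ι => (expMeasure 1).prod Φ) =
      ∫⁻ s in Set.Ioi (0 : ℝ), (∫⁻ φ, f s φ ∂Φ) *
        ∫⁻ r in Set.Ioi s, ∫⁻ φ, g r φ ∂Φ := by
  classical
  have hG : Measurable fun s => ∫⁻ φ, g s φ ∂Φ := hg.lintegral_prod_right'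
  have hG' : Measurable fun u : ℝ => ∫⁻ r in Set.Ioi (0 : ℝ), ∫⁻ φ, g (u + r) φ ∂Φ := by
    have : Measurable (Function.uncurry fun u r : ℝ => ∫⁻ φ, g (u + r) φ ∂Φ) :=
      hG.comp (measurable_fst.add measurable_snd : Measurable fun q : ℝ × ℝ => q.1 + q.2)
    exact this.lintegral_prod_right'
  have hterm : ∀ k m : ℕ, Measurable fun ω : ι → ℝ × Config d =>
      f (∑ i ∈ Finset.range (k + 1), (ω (e i)).1) (ω (e k)).2 *
        g (∑ i ∈ Finset.range (k + (m + 1) + 1), (ω (e i)).1) (ω (e (k + (m + 1)))).2 :=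
    fun k m => (measurable_ring e hf k).mul (measurable_ring e hg _)
  have step : ∀ k : ℕ, ∫⁻ ω, ∑' m, f (∑ i ∈ Finset.range (k + 1), (ω (e i)).1) (ω (e k)).2 *
        g (∑ i ∈ Finset.range (k + (m + 1) + 1), (ω (e i)).1) (ω (e (k + (m + 1)))).2
        ∂Measure.infinitePi (fun _ : ι => (expMeasure 1).prod Φ) =
      ∫⁻ ω, f (∑ i ∈ Finset.range (k + 1), (ω (e i)).1) (ω (e k)).2 *
        (∫⁻ r in Set.Ioi (0 : ℝ), ∫⁻ φ, g ((∑ i ∈ Finset.range (k + 1), (ω (e i)).1) + r) φ ∂Φ)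
        ∂Measure.infinitePi (fun _ : ι => (expMeasure 1).prod Φ) := by
    intro k
    rw [lintegral_infinitePi_piecewise _ (e '' Set.Ioi k)
      (Measurable.tsum fun m => hterm k m)]
    refine lintegral_congr fun ω => ?_
    have hle : ∀ i ≤ k, e i ∉ e '' Set.Ioi k := by
      rintro i hi ⟨j, hj, hji⟩
      have := he hji
      simp only [Set.mem_Ioi] at hj
      omega
    have hgt : ∀ i, e (k + (i + 1)) ∈ e '' Set.Ioi k := fun i => ⟨_, by simp, rfl⟩
    have hpw : ∀ (ω' : ι → ℝ × Config d) (m : ℕ),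
        f (∑ i ∈ Finset.range (k + 1), (((e '' Set.Ioi k).piecewise ω' ω) (e i)).1)
            (((e '' Set.Ioi k).piecewise ω' ω) (e k)).2 *
          g (∑ i ∈ Finset.range (k + (m + 1) + 1), (((e '' Set.Ioi k).piecewise ω' ω) (e i)).1)
            (((e '' Set.Ioi k).piecewise ω' ω) (e (k + (m + 1)))).2 =
        f (∑ i ∈ Finset.range (k + 1), (ω (e i)).1) (ω (e k)).2 *
          g (∑ i ∈ Finset.range (k + 1), (ω (e i)).1 +
              ∑ i ∈ Finset.range (m + 1), (ω' (e (k + (i + 1)))).1)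
            (ω' (e (k + (m + 1)))).2 := by
      intro ω' m
      have h1 : ∑ i ∈ Finset.range (k + 1), (((e '' Set.Ioi k).piecewise ω' ω) (e i)).1 =
          ∑ i ∈ Finset.range (k + 1), (ω (e i)).1 :=
        Finset.sum_congr rfl fun i hi => by
          rw [Set.piecewise_eq_of_notMem _ _ _ (hle i (by simp at hi; omega))]
      have h2 : k + (m + 1) + 1 = (k + 1) + (m + 1) := by ring
      rw [h2, Finset.sum_range_add _ (k + 1) (m + 1), h1, Set.piecewise_eq_of_notMem _ _ _ (hle k le_rfl),
        Set.piecewise_eq_of_mem _ _ _ (hgt m)]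
      congr 3
      refine Finset.sum_congr rfl fun i _ => ?_
      rw [show k + 1 + i = k + (i + 1) by ring, Set.piecewise_eq_of_mem _ _ _ (hgt i)]
    simp_rw [hpw, ENNReal.tsum_mul_left]
    have hgu : ∀ u : ℝ, Measurable (Function.uncurry fun r φ => g (u + r) φ) := fun u =>
      hg.comp (by fun_prop : Measurable fun q : ℝ × Config d => (u + q.1, q.2))
    have he' : Function.Injective fun i => e (k + (i + 1)) := fun i j h => by
      have := he h; omega
    rw [lintegral_const_mul, lintegral_tsum_ring (e := fun i => e (k + (i + 1))) he' (hgu _)]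
    exact Measurable.tsum fun m =>
      measurable_ring (fun i => e (k + (i + 1))) (hgu _) m
  rw [lintegral_tsum fun k => (Measurable.tsum fun m => hterm k m).aemeasurable,
    tsum_congr step, ← lintegral_tsum]
  · have hfG : Measurable (Function.uncurry fun (s : ℝ) (φ : Config d) => f s φ *
        ∫⁻ r in Set.Ioi (0 : ℝ), ∫⁻ φ, g (s + r) φ ∂Φ) := hf.mul (hG'.comp measurable_fst)
    rw [lintegral_tsum_ring he hfG]
    refine lintegral_congr fun s => ?_
    rw [lintegral_mul_const, lintegral_Ioi_add_left fun r => ∫⁻ φ, g r φ ∂Φ]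
    exact hf.of_uncurry_left
  · intro k
    exact ((measurable_ring e hf k).mul (hG'.comp (by fun_prop))).aemeasurable

/-- Second moments of sums over the rings of a clock: on top of the product of the means there is
the contribution of each ring paired with itself, as for any Poisson process. -/
theorem lintegral_tsum_ring_mul_tsum_ring {e : ℕ → ι} (he : e.Injective)
    {f g : ℝ → Config d → ℝ≥0∞}
    (hf : Measurable (Function.uncurry f)) (hg : Measurable (Function.uncurry g)) :
    ∫⁻ ω, (∑' k, f (∑ i ∈ Finset.range (k + 1), (ω (e i)).1) (ω (e k)).2) *
        (∑' k, g (∑ i ∈ Finset.range (k + 1), (ω (e i)).1) (ω (e k)).2)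
        ∂Measure.infinitePi (fun _ : ι => (expMeasure 1).prod Φ) =
      (∫⁻ s in Set.Ioi (0 : ℝ), ∫⁻ φ, f s φ ∂Φ) * (∫⁻ s in Set.Ioi (0 : ℝ), ∫⁻ φ, g s φ ∂Φ) +
        ∫⁻ s in Set.Ioi (0 : ℝ), ∫⁻ φ, f s φ * g s φ ∂Φ := by
  have hF : Measurable fun s => ∫⁻ φ, f s φ ∂Φ := hf.lintegral_prod_right'
  have hG : Measurable fun s => ∫⁻ φ, g s φ ∂Φ := hg.lintegral_prod_right'
  have hsplit : ∀ a b : ℕ → ℝ≥0∞, (∑' k, a k) * (∑' k, b k) =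
      ∑' k, a k * b k + ∑' k, ∑' m, a k * b (k + (m + 1)) +
        ∑' k, ∑' m, b k * a (k + (m + 1)) := by
    intro a b
    simp_rw [← ENNReal.tsum_mul_right, ← ENNReal.tsum_mul_left]
    rw [tsum_double_split fun k l => a k * b l]
    simp_rw [mul_comm (a (_ + _))]
  have hdiag : ∀ k, Measurable fun ω : ι → ℝ × Config d =>
      f (∑ i ∈ Finset.range (k + 1), (ω (e i)).1) (ω (e k)).2 *
        g (∑ i ∈ Finset.range (k + 1), (ω (e i)).1) (ω (e k)).2 :=
    fun k => (measurable_ring e hf k).mul (measurable_ring e hg k)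
  have hcross : Measurable fun ω : ι → ℝ × Config d =>
      ∑' k, ∑' m, f (∑ i ∈ Finset.range (k + 1), (ω (e i)).1) (ω (e k)).2 *
        g (∑ i ∈ Finset.range (k + (m + 1) + 1), (ω (e i)).1) (ω (e (k + (m + 1)))).2 :=
    Measurable.tsum fun k => Measurable.tsum fun m =>
      (measurable_ring e hf k).mul (measurable_ring e hg _)
  simp_rw [hsplit]
  refine (lintegral_add_left ((Measurable.tsum hdiag).add hcross) _).trans ?_
  refine (congrArg (· + _) (lintegral_add_left (Measurable.tsum hdiag) _)).trans ?_
  rw [lintegral_tsum_ring_mul_later he hf hg,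
    lintegral_tsum_ring_mul_later he hg hf,
    lintegral_tsum_ring he (f := fun s φ => f s φ * g s φ) (hf.mul hg), add_assoc, add_comm]
  congr 1
  have h3 : ∫⁻ s in Set.Ioi (0 : ℝ), (∫⁻ φ, g s φ ∂Φ) * ∫⁻ r in Set.Ioi s, ∫⁻ φ, f r φ ∂Φ =
      ∫⁻ s in Set.Ioi (0 : ℝ), (∫⁻ φ, f s φ ∂Φ) * ∫⁻ r in Set.Ioo 0 s, ∫⁻ φ, g r φ ∂Φ := by
    simp_rw [← lintegral_const_mul _ hF]
    rw [lintegral_Ioi_Ioi_swap (k := fun u s => (∫⁻ φ, g u φ ∂Φ) * ∫⁻ φ, f s φ ∂Φ)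
      ((hG.comp measurable_fst).mul (hF.comp measurable_snd))]
    refine lintegral_congr fun s => ?_
    rw [lintegral_mul_const _ hG, mul_comm]
  have hm1 : Measurable fun s : ℝ => ∫⁻ r in Set.Ioi s, ∫⁻ φ, g r φ ∂Φ :=
    Antitone.measurable fun a b hab => lintegral_mono_set (Set.Ioi_subset_Ioi hab)
  rw [h3]
  refine (lintegral_add_left (hF.mul hm1) _).symm.trans ?_
  rw [← lintegral_mul_const _ hF]
  refine setLIntegral_congr_fun measurableSet_Ioi fun s hs => ?_
  rw [Pi.mul_apply, ← mul_add]
  congr 1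
  rw [← setLIntegral_congr (Ioi_ae_eq_Ici (a := s)).symm, add_comm,
    ← lintegral_union measurableSet_Ici]
  · rw [Set.Ioo_union_Ici_eq_Ioi hs]
  · rw [Set.disjoint_left]
    rintro x hx hx'
    exact absurd hx.2 (not_lt.2 hx')

end Clock

/-! ### Children of one ball -/

section Generations

variable {d : ℕ}

/-- `f` evaluated at the birth time and the position of the ball `b`, or `0` if `b` is never
born. -/
noncomputable def contribution (ω : BranchNoise d) (f : ℝ → Site d → ℝ≥0∞) (b : Ball d) : ℝ≥0∞ :=
  {b : Ball d | IsBorn ω b.1 b.2}.indicator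
    (fun b => f (birthTime ω b.1 b.2) (position b.1 b.2)) b

/-- The total contribution of the children of the ball `b`. -/
noncomputable def childSum (ω : BranchNoise d) (f : ℝ → Site d → ℝ≥0∞) (b : Ball d) : ℝ≥0∞ :=
  ∑' c : ℕ × Site d × ℕ, contribution ω f (b.1, c :: b.2)

/-- The sum of `f t` over the balls of the configuration `φ` translated by `x`. -/
noncomputable def offspringSum (f : ℝ → Site d → ℝ≥0∞) (x : Site d) (t : ℝ) (φ : Config d) :
    ℝ≥0∞ :=
  ∑' y, (φ y : ℝ≥0∞) * f t (x + y)

/-- The mean of the sum of `f` over the children of a ball born at time `t` at site `x`. -/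
noncomputable def meanOp (Φ : Measure (Config d)) (f : ℝ → Site d → ℝ≥0∞) (t : ℝ) (x : Site d) :
    ℝ≥0∞ :=
  ∫⁻ s in Set.Ioi (0 : ℝ), ∫⁻ φ, offspringSum f x (t + s) φ ∂Φ

/-- The covariance of the sums of `f` and of `g` over the children of a ball born at time `t` at
site `x`. -/
noncomputable def pairOp (Φ : Measure (Config d)) (f g : ℝ → Site d → ℝ≥0∞) (t : ℝ)
    (x : Site d) : ℝ≥0∞ :=
  ∫⁻ s in Set.Ioi (0 : ℝ), ∫⁻ φ, offspringSum f x (t + s) φ * offspringSum g x (t + s) φ ∂Φ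

/-- The children of a ball, grouped by the rings of its clock. -/
theorem childSum_eq (ω : BranchNoise d) (f : ℝ → Site d → ℝ≥0∞) (b : Ball d) :
    childSum ω f b = {b : Ball d | IsBorn ω b.1 b.2}.indicator (fun b => ∑' k,
      offspringSum f (position b.1 b.2)
        (birthTime ω b.1 b.2 + ∑ i ∈ Finset.range (k + 1), (ω (b, i)).1) (ω (b, k)).2) b := by
  obtain ⟨z, v⟩ := b
  by_cases hb : IsBorn ω z v
  · rw [Set.indicator_of_mem (by exact hb), childSum, ENNReal.tsum_prod']
    refine tsum_congr fun k => ?_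
    rw [ENNReal.tsum_prod', offspringSum]
    refine tsum_congr fun y => ?_
    have : ∀ j : ℕ, contribution ω f (z, (k, y, j) :: v) =
        if j < (ω ((z, v), k)).2 y then f (birthTime ω z v +
          ∑ i ∈ Finset.range (k + 1), (ω ((z, v), i)).1) (position z v + y) else 0 := by
      intro j
      by_cases hj : j < (ω ((z, v), k)).2 y
      · rw [contribution, Set.indicator_of_mem (by exact ⟨hb, hj⟩), if_pos hj]; rfl
      · rw [contribution, Set.indicator_of_notMem (fun h => hj h.2), if_neg hj]
    dsimp only
    simp_rw [this]
    rw [tsum_eq_sum (s := Finset.range ((ω ((z, v), k)).2 y)) (fun j hj => by simp_all),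
      Finset.sum_congr rfl (g := fun _ => f (birthTime ω z v +
          ∑ i ∈ Finset.range (k + 1), (ω ((z, v), i)).1) (position z v + y))
        (fun j hj => by simp_all)]
    simp
  · rw [Set.indicator_of_notMem (by exact hb), childSum, ENNReal.tsum_eq_zero]
    intro c
    rw [contribution, Set.indicator_of_notMem (fun h => hb h.1)]

/-- Whether and when a ball is born depends only on the randomness attached to shorter labels. -/
theorem isBorn_birthTime_congr {ω ω' : BranchNoise d} {z : Site d}
    {v : List (ℕ × Site d × ℕ)} (h : ∀ w i, w.length < v.length → ω ((z, w), i) = ω' ((z, w), i)) :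
    (IsBorn ω z v ↔ IsBorn ω' z v) ∧ birthTime ω z v = birthTime ω' z v := by
  induction v with
  | nil => simp [IsBorn, birthTime]
  | cons c v ih =>
    obtain ⟨k, y, j⟩ := c
    obtain ⟨h1, h2⟩ := ih fun w i hw => h w i (by simp; omega)
    have h3 : ∀ i, ω ((z, v), i) = ω' ((z, v), i) := fun i => h v i (by simp)
    simp [IsBorn, birthTime, h1, h2, h3]

/-- The clock and the offspring of `b`, as coordinates of the driving randomness. -/
def ownNoise (b : Ball d) : Set (Ball d × ℕ) := {i | i.1 = b}

instance (b : Ball d) : DecidablePred (· ∈ ownNoise b) := fun i => decEq i.1 b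

theorem isBorn_birthTime_piecewise (ω ω' : BranchNoise d) {b b' : Ball d}
    (h : b'.2.length ≤ b.2.length) :
    (IsBorn ((ownNoise b).piecewise ω' ω) b'.1 b'.2 ↔ IsBorn ω b'.1 b'.2) ∧
      birthTime ((ownNoise b).piecewise ω' ω) b'.1 b'.2 = birthTime ω b'.1 b'.2 := by
  refine isBorn_birthTime_congr fun w i hw => ?_
  refine Set.piecewise_eq_of_notMem _ _ _ fun hm => ?_
  have : (b'.1, w) = b := hm
  rw [← this] at h
  exact absurd h (not_le.2 hw)

theorem indicator_apply_congr_of_iff {α : Type*} {s t : Set α} {f g : α → ℝ≥0∞} {b : α}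
    (h : b ∈ s ↔ b ∈ t) (hfg : f b = g b) : s.indicator f b = t.indicator g b := by
  by_cases hb : b ∈ t
  · rw [Set.indicator_of_mem hb, Set.indicator_of_mem (h.2 hb), hfg]
  · rw [Set.indicator_of_notMem hb, Set.indicator_of_notMem (mt h.1 hb)]

theorem contribution_piecewise (ω ω' : BranchNoise d) (f : ℝ → Site d → ℝ≥0∞) {b b' : Ball d}
    (h : b'.2.length ≤ b.2.length) :
    contribution ((ownNoise b).piecewise ω' ω) f b' = contribution ω f b' := by
  obtain ⟨h1, h2⟩ := isBorn_birthTime_piecewise ω ω' h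
  exact indicator_apply_congr_of_iff h1 (by rw [h2])

theorem childSum_piecewise_of_ne (ω ω' : BranchNoise d) (f : ℝ → Site d → ℝ≥0∞) {b b' : Ball d}
    (h : b'.2.length ≤ b.2.length) (hne : b' ≠ b) :
    childSum ((ownNoise b).piecewise ω' ω) f b' = childSum ω f b' := by
  obtain ⟨h1, h2⟩ := isBorn_birthTime_piecewise ω ω' h
  have h3 : ∀ i, (ownNoise b).piecewise ω' ω (b', i) = ω (b', i) := fun i =>
    Set.piecewise_eq_of_notMem _ _ _ hne
  rw [childSum_eq, childSum_eq ω f b']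
  refine indicator_apply_congr_of_iff h1 ?_
  simp_rw [h2, h3]

theorem childSum_piecewise_self (ω ω' : BranchNoise d) (f : ℝ → Site d → ℝ≥0∞) (b : Ball d) :
    childSum ((ownNoise b).piecewise ω' ω) f b =
      {b : Ball d | IsBorn ω b.1 b.2}.indicator (fun b => ∑' k,
        offspringSum f (position b.1 b.2)
          (birthTime ω b.1 b.2 + ∑ i ∈ Finset.range (k + 1), (ω' (b, i)).1) (ω' (b, k)).2) b := by
  obtain ⟨h1, h2⟩ := isBorn_birthTime_piecewise ω ω' (le_refl b.2.length)
  have h3 : ∀ i, (ownNoise b).piecewise ω' ω (b, i) = ω' (b, i) := fun i =>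
    Set.piecewise_eq_of_mem _ _ _ rfl
  rw [childSum_eq]
  refine indicator_apply_congr_of_iff h1 ?_
  simp_rw [h2, h3]

/-! ### Measurability of sums over children -/

theorem measurable_birthTime (z : Site d) (v : List (ℕ × Site d × ℕ)) :
    Measurable fun ω : BranchNoise d => birthTime ω z v := by
  induction v with
  | nil => exact measurable_const
  | cons c v ih => unfold birthTime; fun_prop

theorem measurableSet_isBorn (z : Site d) (v : List (ℕ × Site d × ℕ)) :
    MeasurableSet {ω : BranchNoise d | IsBorn ω z v} := by
  induction v with
  | nil => exact MeasurableSet.univ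
  | cons c v ih =>
    obtain ⟨k, y, j⟩ := c
    refine ih.inter ?_
    have : Measurable fun ω : BranchNoise d => (ω ((z, v), k)).2 y :=
      (Measurable.of_discrete (f := fun φ : Config d => φ y)).comp (by fun_prop)
    exact measurableSet_lt measurable_const this

theorem measurable_contribution {f : ℝ → Site d → ℝ≥0∞} (hf : Measurable f) (b : Ball d) :
    Measurable fun ω => contribution ω f b := by
  have h : Measurable fun ω : BranchNoise d => f (birthTime ω b.1 b.2) (position b.1 b.2) :=
    (measurable_pi_iff.1 hf (position b.1 b.2)).comp (measurable_birthTime b.1 b.2)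
  exact h.indicator (measurableSet_isBorn b.1 b.2)

theorem measurable_childSum {f : ℝ → Site d → ℝ≥0∞} (hf : Measurable f) (b : Ball d) :
    Measurable fun ω => childSum ω f b :=
  Measurable.tsum fun _ => measurable_contribution hf _

theorem measurable_offspringSum {f : ℝ → Site d → ℝ≥0∞} (hf : Measurable f) (x : Site d) :
    Measurable (Function.uncurry (offspringSum f x)) := by
  refine Measurable.tsum fun y => Measurable.mul ?_ ?_
  · exact (Measurable.of_discrete (f := fun φ : Config d => (φ y : ℝ≥0∞))).comp measurable_snd
  · exact (measurable_pi_iff.1 hf (x + y)).comp measurable_fst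

theorem measurable_offspringSum_add {f : ℝ → Site d → ℝ≥0∞} (hf : Measurable f) (x : Site d)
    (t : ℝ) : Measurable (Function.uncurry fun s φ => offspringSum f x (t + s) φ) :=
  (measurable_offspringSum hf x).comp
    (by fun_prop : Measurable fun q : ℝ × Config d => (t + q.1, q.2))

theorem measurable_lintegral_Ioi_add {k : ℝ → ℝ≥0∞} (hk : Measurable k) :
    Measurable fun t : ℝ => ∫⁻ s in Set.Ioi (0 : ℝ), k (t + s) :=
  Measurable.lintegral_prod_right' (f := fun q : ℝ × ℝ => k (q.1 + q.2)) (by fun_prop)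

theorem measurable_meanOp (Φ : Measure (Config d)) [IsProbabilityMeasure Φ]
    {f : ℝ → Site d → ℝ≥0∞} (hf : Measurable f) :
    Measurable (meanOp Φ f) :=
  measurable_pi_iff.2 fun x => measurable_lintegral_Ioi_add
    (measurable_offspringSum hf x).lintegral_prod_right'

theorem measurable_pairOp (Φ : Measure (Config d)) [IsProbabilityMeasure Φ]
    {f g : ℝ → Site d → ℝ≥0∞} (hf : Measurable f)
    (hg : Measurable g) : Measurable (pairOp Φ f g) :=
  measurable_pi_iff.2 fun x => measurable_lintegral_Ioi_add
    ((measurable_offspringSum hf x).mul (measurable_offspringSum hg x)).lintegral_prod_right'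

/-! ### Averaging over the children of one ball -/

variable (Φ : Measure (Config d)) [IsProbabilityMeasure Φ]

/-- The children of `b` may be averaged out against any functional `K` that does not depend on the
clock and the offspring of `b`. -/
theorem lintegral_mul_childSum {f : ℝ → Site d → ℝ≥0∞} (hf : Measurable f) (b : Ball d)
    {K : BranchNoise d → ℝ≥0∞} (hK : Measurable K)
    (hKb : ∀ ω ω', K ((ownNoise b).piecewise ω' ω) = K ω) :
    ∫⁻ ω, K ω * childSum ω f b ∂branchLaw Φ =
      ∫⁻ ω, K ω * contribution ω (meanOp Φ f) b ∂branchLaw Φ := by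
  unfold branchLaw
  refine (lintegral_infinitePi_piecewise _ (ownNoise b)
    (hK.mul (measurable_childSum hf b))).trans ?_
  refine lintegral_congr fun ω => ?_
  simp_rw [Pi.mul_apply, hKb, childSum_piecewise_self]
  by_cases hb : IsBorn ω b.1 b.2
  · simp_rw [Set.indicator_of_mem (show b ∈ {b : Ball d | IsBorn ω b.1 b.2} from hb), contribution,
      Set.indicator_of_mem (show b ∈ {b : Ball d | IsBorn ω b.1 b.2} from hb)]
    rw [lintegral_const_mul, lintegral_tsum_ring (e := fun i => (b, i))
      (fun i j h => by simpa using h) (measurable_offspringSum_add hf _ _), meanOp]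
    exact Measurable.tsum fun k => measurable_ring (fun i => (b, i))
      (measurable_offspringSum_add hf _ _) k
  · simp_rw [Set.indicator_of_notMem (show b ∉ {b : Ball d | IsBorn ω b.1 b.2} from hb),
      contribution,
      Set.indicator_of_notMem (show b ∉ {b : Ball d | IsBorn ω b.1 b.2} from hb)]
    simp

/-- The children of a single ball are correlated only through the configurations drawn at a common
ring, which produce the term with `pairOp`. -/
theorem lintegral_childSum_mul_childSum {f g : ℝ → Site d → ℝ≥0∞} (hf : Measurable f)
    (hg : Measurable g) (b : Ball d) :
    ∫⁻ ω, childSum ω f b * childSum ω g b ∂branchLaw Φ =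
      ∫⁻ ω, contribution ω (meanOp Φ f) b * contribution ω (meanOp Φ g) b ∂branchLaw Φ +
        ∫⁻ ω, contribution ω (pairOp Φ f g) b ∂branchLaw Φ := by
  rw [← lintegral_add_right _ (measurable_contribution (measurable_pairOp Φ hf hg) b)]
  unfold branchLaw
  refine (lintegral_infinitePi_piecewise _ (ownNoise b)
    ((measurable_childSum hf b).mul (measurable_childSum hg b))).trans ?_
  refine lintegral_congr fun ω => ?_
  simp_rw [Pi.mul_apply, childSum_piecewise_self]
  by_cases hb : IsBorn ω b.1 b.2
  · simp_rw [Set.indicator_of_mem (show b ∈ {b : Ball d | IsBorn ω b.1 b.2} from hb), contribution,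
      Set.indicator_of_mem (show b ∈ {b : Ball d | IsBorn ω b.1 b.2} from hb)]
    rw [lintegral_tsum_ring_mul_tsum_ring (e := fun i => (b, i))
      (fun i j h => by simpa using h) (measurable_offspringSum_add hf _ _)
      (measurable_offspringSum_add hg _ _), meanOp, meanOp, pairOp]
  · simp_rw [Set.indicator_of_notMem (show b ∉ {b : Ball d | IsBorn ω b.1 b.2} from hb),
      contribution,
      Set.indicator_of_notMem (show b ∉ {b : Ball d | IsBorn ω b.1 b.2} from hb)]
    simp

/-! ### Sums over one generation -/

/-- The weight of the ball `b` in sums over the generation `n`, if balls descending from the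
ancestor at `z` have weight `a z`. -/
noncomputable def genWeight (a : Site d → ℝ≥0∞) (n : ℕ) (b : Ball d) : ℝ≥0∞ :=
  if b.2.length = n then a b.1 else 0

/-- The weighted sum of `f` over the balls of the generation `n`. -/
noncomputable def genSum (a : Site d → ℝ≥0∞) (n : ℕ) (ω : BranchNoise d)
    (f : ℝ → Site d → ℝ≥0∞) : ℝ≥0∞ :=
  ∑' b, genWeight a n b * contribution ω f b

theorem measurable_genSum (a : Site d → ℝ≥0∞) (n : ℕ) {f : ℝ → Site d → ℝ≥0∞}
    (hf : Measurable f) : Measurable fun ω => genSum a n ω f :=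
  Measurable.tsum fun b => (measurable_contribution hf b).const_mul _

/-- Every ball of the generation `n + 1` is the child of exactly one ball of the generation `n`. -/
theorem genSum_succ (a : Site d → ℝ≥0∞) (n : ℕ) (ω : BranchNoise d)
    (f : ℝ → Site d → ℝ≥0∞) :
    genSum a (n + 1) ω f = ∑' b, genWeight a n b * childSum ω f b := by
  simp_rw [childSum, ← ENNReal.tsum_mul_left]
  rw [← ENNReal.tsum_prod (f := fun (b : Ball d) c => genWeight a n b * contribution ω f (b.1, c :: b.2)),
    genSum]
  have hinj : Function.Injective fun q : Ball d × (ℕ × Site d × ℕ) =>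
      ((q.1.1, q.2 :: q.1.2) : Ball d) := by
    rintro ⟨⟨z, v⟩, c⟩ ⟨⟨z', v'⟩, c'⟩ h
    simp only [Prod.mk.injEq, List.cons.injEq] at h
    obtain ⟨rfl, rfl, rfl⟩ := h
    rfl
  rw [← hinj.tsum_eq (f := fun b => genWeight a (n + 1) b * contribution ω f b)]
  · exact tsum_congr fun q => by simp [genWeight]
  · rintro ⟨z, v⟩ hb
    cases v with
    | nil => simp [genWeight] at hb
    | cons c v => exact ⟨((z, v), c), rfl⟩

theorem lintegral_genSum_succ (a : Site d → ℝ≥0∞) (n : ℕ) {f : ℝ → Site d → ℝ≥0∞}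
    (hf : Measurable f) :
    ∫⁻ ω, genSum a (n + 1) ω f ∂branchLaw Φ =
      ∫⁻ ω, genSum a n ω (meanOp Φ f) ∂branchLaw Φ := by
  simp_rw [genSum_succ]
  unfold genSum
  rw [lintegral_tsum fun b => ((measurable_childSum hf b).const_mul _).aemeasurable,
    lintegral_tsum fun b =>
      ((measurable_contribution (measurable_meanOp Φ hf) b).const_mul _).aemeasurable]
  exact tsum_congr fun b => lintegral_mul_childSum Φ hf b measurable_const fun _ _ => rfl

theorem lintegral_tsum_mul_tsum {Ω β : Type*} [Countable β] [MeasurableSpace Ω] (μ : Measure Ω)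
    (w w' : β → ℝ≥0∞) {F G : β → Ω → ℝ≥0∞} (hF : ∀ b, Measurable (F b))
    (hG : ∀ b, Measurable (G b)) :
    ∫⁻ ω, (∑' b, w b * F b ω) * (∑' b, w' b * G b ω) ∂μ =
      ∑' b, ∑' b', w b * w' b' * ∫⁻ ω, F b ω * G b' ω ∂μ := by
  simp_rw [← ENNReal.tsum_mul_right, ← ENNReal.tsum_mul_left]
  have h : ∀ b b', Measurable fun ω => w b * F b ω * (w' b' * G b' ω) := fun b b' => by
    have := hF b
    have := hG b'
    fun_prop
  rw [lintegral_tsum fun b => (Measurable.tsum (h b)).aemeasurable]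
  refine tsum_congr fun b => ?_
  rw [lintegral_tsum fun b' => (h b b').aemeasurable]
  refine tsum_congr fun b' => ?_
  refine Eq.trans ?_ (lintegral_const_mul _ ((hF b).mul (hG b')))
  exact lintegral_congr fun ω => by ring

theorem lintegral_genSum_succ_mul (a : Site d → ℝ≥0∞) {n m : ℕ} (hmn : m ≤ n)
    {f g : ℝ → Site d → ℝ≥0∞} (hf : Measurable f) (hg : Measurable g) :
    ∫⁻ ω, genSum a (n + 1) ω f * genSum a m ω g ∂branchLaw Φ =
      ∫⁻ ω, genSum a n ω (meanOp Φ f) * genSum a m ω g ∂branchLaw Φ := by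
  simp_rw [genSum_succ]
  unfold genSum
  rw [lintegral_tsum_mul_tsum _ _ _ (measurable_childSum hf) (measurable_contribution hg),
    lintegral_tsum_mul_tsum _ _ _ (measurable_contribution (measurable_meanOp Φ hf))
      (measurable_contribution hg)]
  refine tsum_congr fun b => tsum_congr fun b' => ?_
  unfold genWeight
  split_ifs with h1 h2
  · congr 1
    simp_rw [mul_comm _ (contribution _ g b')]
    exact lintegral_mul_childSum Φ hf b (measurable_contribution hg b')
      fun ω ω' => contribution_piecewise ω ω' g (by omega)
  all_goals simp

/-- Different balls of one generation have independent children, so that only siblings produce the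
term with `pairOp`; it carries the squared weights because siblings share their ancestor. -/
theorem lintegral_genSum_succ_mul_genSum_succ (a : Site d → ℝ≥0∞) (n : ℕ)
    {f g : ℝ → Site d → ℝ≥0∞} (hf : Measurable f) (hg : Measurable g) :
    ∫⁻ ω, genSum a (n + 1) ω f * genSum a (n + 1) ω g ∂branchLaw Φ =
      ∫⁻ ω, genSum a n ω (meanOp Φ f) * genSum a n ω (meanOp Φ g) ∂branchLaw Φ +
        ∫⁻ ω, genSum (fun z => a z * a z) n ω (pairOp Φ f g) ∂branchLaw Φ := by
  classical
  simp_rw [genSum_succ]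
  unfold genSum
  rw [lintegral_tsum_mul_tsum _ _ _ (measurable_childSum hf) (measurable_childSum hg),
    lintegral_tsum_mul_tsum _ _ _ (measurable_contribution (measurable_meanOp Φ hf))
      (measurable_contribution (measurable_meanOp Φ hg)),
    lintegral_tsum fun b =>
      ((measurable_contribution (measurable_pairOp Φ hf hg) b).const_mul _).aemeasurable,
    ← ENNReal.tsum_add]
  refine tsum_congr fun b => ?_
  have hdiag : ∫⁻ ω, genWeight (fun z => a z * a z) n b * contribution ω (pairOp Φ f g) b
      ∂branchLaw Φ = ∑' b', if b' = b then genWeight a n b * genWeight a n b' *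
        ∫⁻ ω, contribution ω (pairOp Φ f g) b' ∂branchLaw Φ else 0 := by
    rw [tsum_ite_eq, lintegral_const_mul _ (measurable_contribution (measurable_pairOp Φ hf hg) b)]
    congr 1
    unfold genWeight
    split_ifs <;> simp
  rw [hdiag, ← ENNReal.tsum_add]
  refine tsum_congr fun b' => ?_
  by_cases hbb : b' = b
  · subst hbb
    rw [if_pos rfl, lintegral_childSum_mul_childSum Φ hf hg, mul_add]
  · rw [if_neg hbb, add_zero]
    unfold genWeight
    split_ifs with h1 h2
    · congr 1
      simp_rw [mul_comm (childSum _ f b)]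
      rw [lintegral_mul_childSum Φ hf b (measurable_childSum hg b')
        fun ω ω' => childSum_piecewise_of_ne ω ω' g (by omega) hbb]
      simp_rw [mul_comm (childSum _ g b')]
      exact lintegral_mul_childSum Φ hg b'
        (measurable_contribution (measurable_meanOp Φ hf) b)
        fun ω ω' => contribution_piecewise ω ω' _ (by omega)
    all_goals simp

end Generations

/-! ### First and second moments of sums over all balls -/

section Moments

variable {d : ℕ} (Φ : Measure (Config d))

theorem pairOp_comm (f g : ℝ → Site d → ℝ≥0∞) : pairOp Φ f g = pairOp Φ g f := by
  ext t x
  simp_rw [pairOp, mul_comm (offspringSum f _ _ _)]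

theorem offspringSum_tsum (f : ℕ → ℝ → Site d → ℝ≥0∞) (x : Site d) (t : ℝ) (φ : Config d) :
    offspringSum (fun t x => ∑' p, f p t x) x t φ = ∑' p, offspringSum (f p) x t φ := by
  simp_rw [offspringSum, ← ENNReal.tsum_mul_left]
  exact ENNReal.tsum_comm

theorem pairOp_tsum {f g : ℕ → ℝ → Site d → ℝ≥0∞} (hf : ∀ p, Measurable (f p))
    (hg : ∀ p, Measurable (g p)) (t : ℝ) (x : Site d) :
    pairOp Φ (fun t x => ∑' p, f p t x) (fun t x => ∑' p, g p t x) t x =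
      ∑' p, ∑' q, pairOp Φ (f p) (g q) t x := by
  have hm : ∀ p q, Measurable (Function.uncurry fun s φ =>
      offspringSum (f p) x (t + s) φ * offspringSum (g q) x (t + s) φ) := fun p q =>
    (measurable_offspringSum_add (hf p) x t).mul (measurable_offspringSum_add (hg q) x t)
  simp_rw [pairOp, offspringSum_tsum, ← ENNReal.tsum_mul_right, ← ENNReal.tsum_mul_left]
  rw [← ENNReal.tsum_prod (f := fun p q => ∫⁻ s in Set.Ioi (0 : ℝ), ∫⁻ φ,
    offspringSum (f p) x (t + s) φ * offspringSum (g q) x (t + s) φ ∂Φ)]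
  refine Eq.trans ?_
    (lintegral_tsum fun r : ℕ × ℕ => (hm r.1 r.2).lintegral_prod_right'.aemeasurable)
  refine lintegral_congr fun s => ?_
  refine Eq.trans ?_
    (lintegral_tsum fun r : ℕ × ℕ => ((hm r.1 r.2).of_uncurry_left (x := s)).aemeasurable)
  refine lintegral_congr fun φ => ?_
  rw [ENNReal.tsum_prod (f := fun p q =>
    offspringSum (f p) x (t + s) φ * offspringSum (g q) x (t + s) φ)]

theorem contribution_tsum {α : Type*} (ω : BranchNoise d) (f : α → ℝ → Site d → ℝ≥0∞)
    (b : Ball d) :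
    contribution ω (fun t x => ∑' p, f p t x) b = ∑' p, contribution ω (f p) b := by
  unfold contribution
  by_cases hb : b ∈ {b : Ball d | IsBorn ω b.1 b.2}
  · simp_rw [Set.indicator_of_mem hb]
  · simp_rw [Set.indicator_of_notMem hb, tsum_zero]

theorem lintegral_genSum_tsum {α : Type*} [Countable α] (a : Site d → ℝ≥0∞) (n : ℕ)
    {f : α → ℝ → Site d → ℝ≥0∞} (hf : ∀ p, Measurable (f p)) :
    ∫⁻ ω, genSum a n ω (fun t x => ∑' p, f p t x) ∂branchLaw Φ =
      ∑' p, ∫⁻ ω, genSum a n ω (f p) ∂branchLaw Φ := by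
  rw [← lintegral_tsum fun p => (measurable_genSum a n (hf p)).aemeasurable]
  refine lintegral_congr fun ω => ?_
  simp_rw [genSum, contribution_tsum, ← ENNReal.tsum_mul_left]
  exact ENNReal.tsum_comm

variable [IsProbabilityMeasure Φ]

/-- The mean of the sum of `f` over a ball born at time `t` at site `x` and all its descendants. -/
noncomputable def familyMean (f : ℝ → Site d → ℝ≥0∞) (t : ℝ) (x : Site d) : ℝ≥0∞ :=
  ∑' n, (meanOp Φ)^[n] f t x

theorem measurable_iterate_meanOp {f : ℝ → Site d → ℝ≥0∞} (hf : Measurable f) (n : ℕ) :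
    Measurable ((meanOp Φ)^[n] f) := by
  induction n generalizing f with
  | zero => exact hf
  | succ n ih => exact ih (measurable_meanOp Φ hf)

theorem measurable_familyMean {f : ℝ → Site d → ℝ≥0∞} (hf : Measurable f) :
    Measurable (familyMean Φ f) :=
  measurable_pi_iff.2 fun x => Measurable.tsum fun n =>
    measurable_pi_iff.1 (measurable_iterate_meanOp Φ hf n) x

theorem genSum_zero (a : Site d → ℝ≥0∞) (ω : BranchNoise d) (f : ℝ → Site d → ℝ≥0∞) :
    genSum a 0 ω f = ∑' z, a z * f 0 z := by
  have hinj : Function.Injective fun z : Site d => ((z, []) : Ball d) := fun z z' h => by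
    simpa using h
  rw [genSum, ← hinj.tsum_eq (f := fun b => genWeight a 0 b * contribution ω f b)]
  · refine tsum_congr fun z => ?_
    have : contribution ω f (z, []) = f 0 z := by
      rw [contribution, Set.indicator_of_mem (by exact trivial)]
      rfl
    simp [genWeight, this]
  · rintro ⟨z, v⟩ hb
    cases v with
    | nil => exact ⟨z, rfl⟩
    | cons c v => simp [genWeight] at hb

theorem lintegral_genSum (a : Site d → ℝ≥0∞) (n : ℕ) {f : ℝ → Site d → ℝ≥0∞}
    (hf : Measurable f) :
    ∫⁻ ω, genSum a n ω f ∂branchLaw Φ = ∑' z, a z * (meanOp Φ)^[n] f 0 z := by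
  induction n generalizing f with
  | zero => simp [genSum_zero]
  | succ n ih => rw [lintegral_genSum_succ Φ a n hf, ih (measurable_meanOp Φ hf)]; rfl

/-- Beyond the product of the means there are the pairs of balls whose lines of descent pass through
the same ring of the same ball, where `j` is the generation of that ball. -/
theorem lintegral_genSum_mul_genSum (a : Site d → ℝ≥0∞) (n m : ℕ) {f g : ℝ → Site d → ℝ≥0∞}
    (hf : Measurable f) (hg : Measurable g) :
    ∫⁻ ω, genSum a n ω f * genSum a m ω g ∂branchLaw Φ =
      (∑' z, a z * (meanOp Φ)^[n] f 0 z) * (∑' z, a z * (meanOp Φ)^[m] g 0 z) +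
        ∑ j ∈ Finset.range (min n m), ∫⁻ ω, genSum (fun z => a z * a z) j ω
          (pairOp Φ ((meanOp Φ)^[n - 1 - j] f) ((meanOp Φ)^[m - 1 - j] g)) ∂branchLaw Φ := by
  have diag : ∀ (n : ℕ) {f g : ℝ → Site d → ℝ≥0∞}, Measurable f → Measurable g →
      ∫⁻ ω, genSum a n ω f * genSum a n ω g ∂branchLaw Φ =
      (∑' z, a z * (meanOp Φ)^[n] f 0 z) * (∑' z, a z * (meanOp Φ)^[n] g 0 z) +
        ∑ j ∈ Finset.range n, ∫⁻ ω, genSum (fun z => a z * a z) j ω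
          (pairOp Φ ((meanOp Φ)^[n - 1 - j] f) ((meanOp Φ)^[n - 1 - j] g)) ∂branchLaw Φ := by
    intro n
    induction n with
    | zero => intro f g _ _; simp [genSum_zero]
    | succ n ih =>
      intro f g hf hg
      rw [lintegral_genSum_succ_mul_genSum_succ Φ a n hf hg,
        ih (measurable_meanOp Φ hf) (measurable_meanOp Φ hg), Finset.sum_range_succ, add_assoc]
      congr 2
      · refine Finset.sum_congr rfl fun j hj => ?_
        have : n + 1 - 1 - j = (n - 1 - j) + 1 := by simp at hj; omega
        rw [this]
        rfl
      · simp
  have above : ∀ (m i : ℕ) {f g : ℝ → Site d → ℝ≥0∞}, Measurable f → Measurable g →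
      ∫⁻ ω, genSum a (m + i) ω f * genSum a m ω g ∂branchLaw Φ =
      (∑' z, a z * (meanOp Φ)^[m + i] f 0 z) * (∑' z, a z * (meanOp Φ)^[m] g 0 z) +
        ∑ j ∈ Finset.range m, ∫⁻ ω, genSum (fun z => a z * a z) j ω
          (pairOp Φ ((meanOp Φ)^[m + i - 1 - j] f) ((meanOp Φ)^[m - 1 - j] g))
          ∂branchLaw Φ := by
    intro m i
    induction i with
    | zero => exact diag m
    | succ i ih =>
      intro f g hf hg
      rw [← add_assoc, lintegral_genSum_succ_mul Φ a (Nat.le_add_right m i) hf hg,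
        ih (measurable_meanOp Φ hf) hg]
      congr 1
      refine Finset.sum_congr rfl fun j hj => ?_
      have : m + i + 1 - 1 - j = (m + i - 1 - j) + 1 := by simp at hj; omega
      rw [this]
      rfl
  rcases le_total m n with h | h
  · obtain ⟨i, rfl⟩ := Nat.exists_eq_add_of_le h
    rw [min_eq_right h]
    exact above m i hf hg
  · obtain ⟨i, rfl⟩ := Nat.exists_eq_add_of_le h
    rw [min_eq_left h]
    simp_rw [mul_comm (genSum a n _ f), pairOp_comm Φ ((meanOp Φ)^[_] f)]
    rw [above n i hg hf, mul_comm]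

theorem tsum_genSum (a : Site d → ℝ≥0∞) (ω : BranchNoise d) (f : ℝ → Site d → ℝ≥0∞) :
    ∑' n, genSum a n ω f = ∑' b : Ball d, a b.1 * contribution ω f b := by
  unfold genSum
  rw [ENNReal.tsum_comm]
  refine tsum_congr fun b => ?_
  rw [ENNReal.tsum_mul_right, tsum_eq_single b.2.length]
  · simp [genWeight]
  · intro n hn
    simp [genWeight, hn.symm]

theorem lintegral_tsum_contribution (a : Site d → ℝ≥0∞) {f : ℝ → Site d → ℝ≥0∞}
    (hf : Measurable f) :
    ∫⁻ ω, ∑' b : Ball d, a b.1 * contribution ω f b ∂branchLaw Φ =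
      ∑' z, a z * familyMean Φ f 0 z := by
  simp_rw [← tsum_genSum]
  rw [lintegral_tsum fun n => (measurable_genSum a n hf).aemeasurable]
  simp_rw [lintegral_genSum Φ a _ hf, familyMean, ← ENNReal.tsum_mul_left]
  exact ENNReal.tsum_comm

/-- The many-to-two formula: the last ball whose ring is shared by two lines of descent is itself
summed over the family of the ancestor. -/
theorem lintegral_tsum_contribution_sq (a : Site d → ℝ≥0∞) {f : ℝ → Site d → ℝ≥0∞}
    (hf : Measurable f) :
    ∫⁻ ω, (∑' b : Ball d, a b.1 * contribution ω f b) ^ 2 ∂branchLaw Φ =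
      (∑' z, a z * familyMean Φ f 0 z) ^ 2 +
        ∑' z, a z * a z * familyMean Φ (pairOp Φ (familyMean Φ f) (familyMean Φ f)) 0 z := by
  have hA := measurable_iterate_meanOp Φ hf
  simp_rw [← tsum_genSum, sq, ← ENNReal.tsum_mul_right, ← ENNReal.tsum_mul_left]
  have hm : ∀ n m, Measurable fun ω => genSum a n ω f * genSum a m ω f := fun n m =>
    (measurable_genSum a n hf).mul (measurable_genSum a m hf)
  rw [lintegral_tsum fun n => (Measurable.tsum fun m => hm n m).aemeasurable,
    tsum_congr fun n => lintegral_tsum fun m => (hm n m).aemeasurable]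
  rw [tsum_congr fun n => tsum_congr fun m => lintegral_genSum_mul_genSum Φ a n m hf hf]
  simp_rw [ENNReal.tsum_add]
  congr 1
  · simp_rw [familyMean, ENNReal.tsum_mul_left, ENNReal.tsum_mul_right]
    congr 1 <;>
    · simp_rw [← ENNReal.tsum_mul_left]
      rw [ENNReal.tsum_comm]
  · set L : ℕ → ℕ → ℕ → ℝ≥0∞ := fun j p q => ∫⁻ ω, genSum (fun z => a z * a z) j ω
      (pairOp Φ ((meanOp Φ)^[p] f) ((meanOp Φ)^[q] f)) ∂branchLaw Φ with hL
    have h1 : ∀ n m, ∑ j ∈ Finset.range (min n m), L j (n - 1 - j) (m - 1 - j) =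
        ∑' j, if j < n then (if j < m then L j (n - 1 - j) (m - 1 - j) else 0) else 0 := by
      intro n m
      rw [tsum_eq_sum (s := Finset.range (min n m))]
      · refine Finset.sum_congr rfl fun j hj => ?_
        simp at hj
        simp [hj]
      · intro j hj
        simp at hj
        split_ifs with h h'
        · exact absurd h' (not_lt.2 (hj h))
        · rfl
        · rfl
    calc ∑' n, ∑' m, ∑ j ∈ Finset.range (min n m), L j (n - 1 - j) (m - 1 - j)
        = ∑' j, ∑' n, if j < n then
            (∑' m, if j < m then L j (n - 1 - j) (m - 1 - j) else 0) else 0 := by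
          simp_rw [h1]
          rw [tsum_congr fun n => ENNReal.tsum_comm, ENNReal.tsum_comm]
          refine tsum_congr fun j => tsum_congr fun n => ?_
          split_ifs
          · rfl
          · exact tsum_zero
      _ = ∑' j, ∑' p, ∑' q, L j p q := by
          refine tsum_congr fun j => ?_
          rw [← tsum_add_succ_eq_tsum_ite
            (fun n => ∑' m, if j < m then L j (n - 1 - j) (m - 1 - j) else 0) j]
          refine tsum_congr fun p => ?_
          rw [← tsum_add_succ_eq_tsum_ite
            (fun m => L j (j + (p + 1) - 1 - j) (m - 1 - j)) j]
          refine tsum_congr fun q => ?_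
          congr 1 <;> omega
      _ = ∑' j, ∫⁻ ω, genSum (fun z => a z * a z) j ω
            (pairOp Φ (familyMean Φ f) (familyMean Φ f)) ∂branchLaw Φ := by
          refine tsum_congr fun j => ?_
          rw [← ENNReal.tsum_prod (f := L j), hL,
            ← lintegral_genSum_tsum Φ _ j
              (f := fun r : ℕ × ℕ => pairOp Φ ((meanOp Φ)^[r.1] f) ((meanOp Φ)^[r.2] f))
              (fun r => measurable_pairOp Φ (hA r.1) (hA r.2))]
          congr 1
          ext ω
          congr 1
          ext t x
          rw [ENNReal.tsum_prod (f := fun p q => pairOp Φ ((meanOp Φ)^[p] f) ((meanOp Φ)^[q] f) t x)]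
          exact (pairOp_tsum Φ hA hA t x).symm
      _ = _ := by
          have hG := measurable_familyMean Φ hf
          simp_rw [lintegral_genSum Φ _ _ (measurable_pairOp Φ hG hG), familyMean,
            ← ENNReal.tsum_mul_left]
          rw [ENNReal.tsum_comm]

end Moments

/-! ### The mean semigroup -/

section Semigroup

variable {d : ℕ} (Φ : Measure (Config d))

/-- The mean number of balls at `y` in a random configuration. -/
noncomputable def intensity (y : Site d) : ℝ≥0∞ := ∫⁻ φ, (φ y : ℝ≥0∞) ∂Φ

/-- The mean of the sum of `g` over a random configuration translated by `x`. -/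
noncomputable def stepOp (g : Site d → ℝ≥0∞) (x : Site d) : ℝ≥0∞ :=
  ∑' y, intensity Φ y * g (x + y)

/-- The mean of the sum of `g` over all balls at time `s`, starting from a single ball at `x`. -/
noncomputable def expStep (s : ℝ) (g : Site d → ℝ≥0∞) (x : Site d) : ℝ≥0∞ :=
  ∑' n : ℕ, ENNReal.ofReal (s ^ n / n.factorial) * (stepOp Φ)^[n] g x

/-- The space-time function that counts, with weight `g`, the balls born by time `t`. -/
noncomputable def untilTime (t : ℝ) (g : Site d → ℝ≥0∞) (b : ℝ) (x : Site d) : ℝ≥0∞ :=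
  (Set.Iic t).indicator (fun _ => g x) b

theorem measurable_untilTime (t : ℝ) (g : Site d → ℝ≥0∞) : Measurable (untilTime t g) :=
  measurable_pi_iff.2 fun _ => measurable_const.indicator measurableSet_Iic

theorem measurable_apply_config (y : Site d) : Measurable fun φ : Config d => (φ y : ℝ≥0∞) :=
  Measurable.of_discrete

theorem lintegral_offspringSum (f : ℝ → Site d → ℝ≥0∞) (x : Site d) (t : ℝ) :
    ∫⁻ φ, offspringSum f x t φ ∂Φ = stepOp Φ (f t) x := by
  unfold offspringSum stepOp intensity
  rw [lintegral_tsum fun y => ((measurable_apply_config y).mul_const _).aemeasurable]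
  exact tsum_congr fun y => lintegral_mul_const _ (measurable_apply_config y)

theorem meanOp_eq (f : ℝ → Site d → ℝ≥0∞) (t : ℝ) (x : Site d) :
    meanOp Φ f t x = ∫⁻ s in Set.Ioi (0 : ℝ), stepOp Φ (f (t + s)) x := by
  simp_rw [meanOp, lintegral_offspringSum]

theorem lintegral_Ioi_reflect (n : ℕ) (b t : ℝ) :
    ∫⁻ s in Set.Ioi (0 : ℝ), (Set.Iic t).indicator
        (fun u => ENNReal.ofReal ((t - u) ^ n / n.factorial)) (b + s) =
      (Set.Iic t).indicator
        (fun u => ENNReal.ofReal ((t - u) ^ (n + 1) / (n + 1).factorial)) b := by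
  set F : ℝ → ℝ≥0∞ := (Set.Ico 0 (t - b)).indicator
    (fun u => ENNReal.ofReal (u ^ n / n.factorial)) with hF
  have h1 : ∫⁻ s in Set.Ioi (0 : ℝ), (Set.Iic t).indicator
        (fun u => ENNReal.ofReal ((t - u) ^ n / n.factorial)) (b + s) =
      ∫⁻ s, F ((t - b) - s) := by
    rw [← lintegral_indicator measurableSet_Ioi]
    refine lintegral_congr fun s => ?_
    simp only [hF, Set.indicator, Set.mem_Ioi, Set.mem_Iic, Set.mem_Ico]
    have e : t - (b + s) = t - b - s := by ring
    by_cases hs : 0 < s <;> by_cases hb : b + s ≤ t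
    · rw [if_pos hs, if_pos hb, if_pos ⟨by linarith, by linarith⟩, e]
    · rw [if_pos hs, if_neg hb, if_neg fun h => hb (by linarith [h.1])]
    · rw [if_neg hs, if_neg fun h => hs (by linarith [h.2])]
    · rw [if_neg hs, if_neg fun h => hs (by linarith [h.2])]
  rw [h1, lintegral_sub_left_eq_self F (t - b), hF, lintegral_indicator measurableSet_Ico,
    setLIntegral_congr (Ioo_ae_eq_Ico (a := 0) (b := t - b)).symm]
  by_cases hb : b ≤ t
  · rw [lintegral_Ioo_pow_div_factorial n (by linarith), Set.indicator_of_mem (by exact hb)]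
  · rw [Set.indicator_of_notMem (by exact hb), Set.Ioo_eq_empty (by simpa using (not_le.1 hb).le)]
    simp

/-- A line of descent with `n` births before time `t` has the volume of a simplex as its weight in
time, and `n` steps of the random walk as its weight in space. -/
theorem iterate_meanOp_untilTime (t : ℝ) (g : Site d → ℝ≥0∞) (n : ℕ) (b : ℝ) (x : Site d) :
    (meanOp Φ)^[n] (untilTime t g) b x = (Set.Iic t).indicator
      (fun u => ENNReal.ofReal ((t - u) ^ n / n.factorial)) b * (stepOp Φ)^[n] g x := by
  induction n generalizing b x with
  | zero => by_cases hb : b ≤ t <;> simp [untilTime, hb]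
  | succ n ih =>
    rw [Function.iterate_succ_apply', Function.iterate_succ_apply', meanOp_eq,
      ← lintegral_Ioi_reflect, ← lintegral_mul_const]
    · refine lintegral_congr fun s => ?_
      simp_rw [stepOp, ih, ← ENNReal.tsum_mul_left]
      exact tsum_congr fun y => by ring
    · have : Measurable ((Set.Iic t).indicator
          (fun u : ℝ => ENNReal.ofReal ((t - u) ^ n / n.factorial))) :=
        Measurable.indicator (by fun_prop) measurableSet_Iic
      exact this.comp (measurable_const.add measurable_id)

theorem familyMean_untilTime (t : ℝ) (g : Site d → ℝ≥0∞) (b : ℝ) (x : Site d) :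
    familyMean Φ (untilTime t g) b x =
      (Set.Iic t).indicator (fun u => expStep Φ (t - u) g x) b := by
  simp_rw [familyMean, iterate_meanOp_untilTime]
  by_cases hb : b ∈ Set.Iic t
  · simp_rw [Set.indicator_of_mem hb, expStep]
  · simp_rw [Set.indicator_of_notMem hb]
    simp

theorem iterate_stepOp_translate (g : Site d → ℝ≥0∞) (z : Site d) (n : ℕ) (x : Site d) :
    (stepOp Φ)^[n] (fun x => g (x + z)) x = (stepOp Φ)^[n] g (x + z) := by
  induction n generalizing x with
  | zero => rfl
  | succ n ih =>
    simp_rw [Function.iterate_succ_apply', stepOp, ih, add_right_comm]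

theorem tsum_add_right_eq (g : Site d → ℝ≥0∞) (y : Site d) : ∑' x, g (x + y) = ∑' x, g x :=
  (Equiv.addRight y).tsum_eq g

theorem tsum_stepOp (g : Site d → ℝ≥0∞) :
    ∑' x, stepOp Φ g x = (∑' y, intensity Φ y) * ∑' x, g x := by
  unfold stepOp
  rw [ENNReal.tsum_comm]
  simp_rw [ENNReal.tsum_mul_left, tsum_add_right_eq, ENNReal.tsum_mul_right]

theorem tsum_iterate_stepOp (g : Site d → ℝ≥0∞) (n : ℕ) :
    ∑' x, (stepOp Φ)^[n] g x = (∑' y, intensity Φ y) ^ n * ∑' x, g x := by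
  induction n with
  | zero => simp
  | succ n ih => rw [Function.iterate_succ', Function.comp_def, tsum_stepOp, ih, pow_succ']; ring

theorem tsum_ofReal_exp_mul (l : ℝ) (hl : 0 ≤ l) {s : ℝ} (hs : 0 ≤ s) :
    ∑' n : ℕ, ENNReal.ofReal (s ^ n / n.factorial) * ENNReal.ofReal l ^ n =
      ENNReal.ofReal (Real.exp (l * s)) := by
  rw [← tsum_ofReal_pow_div_factorial (mul_nonneg hl hs)]
  refine tsum_congr fun n => ?_
  rw [← ENNReal.ofReal_pow hl, ← ENNReal.ofReal_mul (by positivity)]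
  congr 1
  ring

theorem size_nonneg (φ : Config d) : 0 ≤ size φ :=
  Finset.sum_nonneg fun _ _ => by positivity

theorem tsum_config (φ : Config d) : ∑' y, (φ y : ℝ≥0∞) = ENNReal.ofReal (size φ) := by
  rw [tsum_eq_sum (s := φ.support) (fun y hy => by simpa using hy), size, Finsupp.sum,
    ENNReal.ofReal_sum_of_nonneg fun _ _ => by positivity]
  simp

theorem meanOffspring_nonneg : 0 ≤ meanOffspring Φ := integral_nonneg size_nonneg

variable {Φ} in
theorem tsum_intensity (hΦ : Integrable size Φ) :
    ∑' y, intensity Φ y = ENNReal.ofReal (meanOffspring Φ) := by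
  unfold intensity
  rw [← lintegral_tsum fun y => (measurable_apply_config y).aemeasurable]
  simp_rw [tsum_config]
  rw [meanOffspring, ofReal_integral_eq_lintegral_ofReal hΦ (ae_of_all _ size_nonneg)]

variable {Φ} in
theorem tsum_expStep (hΦ : Integrable size Φ) {s : ℝ} (hs : 0 ≤ s) (g : Site d → ℝ≥0∞) :
    ∑' x, expStep Φ s g x = ENNReal.ofReal (Real.exp (meanOffspring Φ * s)) * ∑' x, g x := by
  unfold expStep
  rw [ENNReal.tsum_comm]
  simp_rw [ENNReal.tsum_mul_left, tsum_iterate_stepOp, tsum_intensity hΦ, ← mul_assoc,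
    ENNReal.tsum_mul_right, tsum_ofReal_exp_mul _ (meanOffspring_nonneg Φ) hs]

theorem expStep_translate (s : ℝ) (g : Site d → ℝ≥0∞) (z x : Site d) :
    expStep Φ s (fun x => g (x + z)) x = expStep Φ s g (x + z) := by
  simp_rw [expStep, iterate_stepOp_translate]

/-- The mean number of balls at the origin at time `s`, starting from a single ball at `x`. -/
noncomputable def meanCount (s : ℝ) (x : Site d) : ℝ≥0∞ := expStep Φ s (Pi.single 0 1) x

variable {Φ} in
theorem tsum_meanCount (hΦ : Integrable size Φ) {s : ℝ} (hs : 0 ≤ s) :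
    ∑' x, meanCount Φ s x = ENNReal.ofReal (Real.exp (meanOffspring Φ * s)) := by
  have : ∑' x, (Pi.single 0 1 : Site d → ℝ≥0∞) x = 1 := by
    rw [tsum_eq_single 0 fun x hx => by simp [hx]]
    simp
  unfold meanCount
  rw [tsum_expStep hΦ hs, this, mul_one]

theorem measurable_meanCount (x : Site d) : Measurable fun s => meanCount Φ s x := by
  unfold meanCount expStep
  exact Measurable.tsum fun n => by fun_prop

theorem familyMean_untilTime_zero {t : ℝ} (ht : 0 ≤ t) (z : Site d) :
    familyMean Φ (untilTime t (Pi.single 0 1)) 0 z = meanCount Φ t z := by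
  rw [familyMean_untilTime, Set.indicator_of_mem (by exact ht), sub_zero]
  rfl

/-- The mean, over a configuration `φ` of law `Φ`, of the sum over `x` of the square of the mean
number of balls at the origin at time `s` when starting from `φ` translated by `x`. -/
noncomputable def familySq (s : ℝ) : ℝ≥0∞ :=
  ∫⁻ φ, ∑' x, (∑' y, (φ y : ℝ≥0∞) * meanCount Φ s (x + y)) ^ 2 ∂Φ

theorem measurable_sum_meanCount (x : Site d) : Measurable
    (Function.uncurry fun (s : ℝ) (φ : Config d) =>
      ∑' y, (φ y : ℝ≥0∞) * meanCount Φ s (x + y)) :=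
  Measurable.tsum fun y => ((measurable_apply_config y).comp measurable_snd).mul
    ((measurable_meanCount Φ (x + y)).comp measurable_fst)

theorem measurable_familySq : Measurable (familySq Φ) := by
  have : Measurable (Function.uncurry fun (s : ℝ) (φ : Config d) =>
      ∑' x, (∑' y, (φ y : ℝ≥0∞) * meanCount Φ s (x + y)) ^ 2) :=
    Measurable.tsum fun x => (measurable_sum_meanCount Φ x).pow_const 2
  exact this.lintegral_prod_right'

theorem tsum_meanOp {k : ℝ → Site d → ℝ≥0∞} (hk : Measurable k) (b : ℝ) :
    ∑' x, meanOp Φ k b x =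
      ∫⁻ s in Set.Ioi (0 : ℝ), (∑' y, intensity Φ y) * ∑' x, k (b + s) x := by
  simp_rw [meanOp_eq]
  rw [← lintegral_tsum]
  · simp_rw [tsum_stepOp]
  · intro x
    refine Measurable.aemeasurable (Measurable.tsum fun y => ?_)
    have := (measurable_pi_iff.1 hk (x + y)).comp
      (measurable_const.add measurable_id : Measurable fun s : ℝ => b + s)
    exact this.const_mul _

variable [IsProbabilityMeasure Φ]

/-- Summing over all sites turns the space-time operator `meanOp` into integration over time. -/
theorem tsum_iterate_meanOp (n : ℕ) {k : ℝ → Site d → ℝ≥0∞} {w : ℝ → ℝ≥0∞}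
    (hk : Measurable k) (hw : Measurable w)
    (h : ∀ b, ∑' x, k b x = ∫⁻ s in Set.Ioi (0 : ℝ), w (b + s)) (b : ℝ) :
    ∑' x, (meanOp Φ)^[n] k b x = (∑' y, intensity Φ y) ^ n *
      ∫⁻ s in Set.Ioi (0 : ℝ), ENNReal.ofReal (s ^ n / n.factorial) * w (b + s) := by
  induction n generalizing k w b with
  | zero => simp [h]
  | succ n ih =>
    have hJ := measurable_lintegral_Ioi_add hw
    rw [Function.iterate_succ_apply, ih (measurable_meanOp Φ hk) (hJ.const_mul (∑' y, intensity Φ y))]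
    · have hwb : Measurable fun s => w (b + s) := hw.comp (measurable_const.add measurable_id)
      rw [← lintegral_pow_div_factorial_mul_shift n hwb, pow_succ, mul_assoc]
      congr 1
      rw [← lintegral_const_mul]
      · refine lintegral_congr fun s => ?_
        simp_rw [add_assoc]
        ring
      · have := measurable_lintegral_Ioi_add hwb
        fun_prop
    · intro b
      rw [tsum_meanOp Φ hk]
      simp_rw [h]

variable {Φ} in
/-- The variance of the branching, summed over all ancestors; `s` is the time of the ring at which
two lines of descent separate. -/
theorem tsum_familyMean_pairOp (hΦ : Integrable size Φ) (t : ℝ) :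
    ∑' z, familyMean Φ (pairOp Φ (familyMean Φ (untilTime t (Pi.single 0 1)))
        (familyMean Φ (untilTime t (Pi.single 0 1)))) 0 z =
      ∫⁻ s in Set.Ioc 0 t,
        ENNReal.ofReal (Real.exp (meanOffspring Φ * s)) * familySq Φ (t - s) := by
  set h := familyMean Φ (untilTime t (Pi.single 0 1)) with hh
  have hmh : Measurable h := measurable_familyMean Φ (measurable_untilTime t _)
  set w : ℝ → ℝ≥0∞ := (Set.Iic t).indicator (fun u => familySq Φ (t - u)) with hw
  have hmw : Measurable w := Measurable.indicator
    ((measurable_familySq Φ).comp (measurable_const.sub measurable_id)) measurableSet_Iic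
  have hk : ∀ b, ∑' x, pairOp Φ h h b x = ∫⁻ s in Set.Ioi (0 : ℝ), w (b + s) := by
    intro b
    have hm : ∀ x, Measurable (Function.uncurry fun s φ =>
        offspringSum h x (b + s) φ * offspringSum h x (b + s) φ) := fun x =>
      (measurable_offspringSum_add hmh x b).mul (measurable_offspringSum_add hmh x b)
    unfold pairOp
    refine (lintegral_tsum fun x => (hm x).lintegral_prod_right'.aemeasurable).symm.trans ?_
    refine lintegral_congr fun s => ?_
    refine (lintegral_tsum fun x =>
      ((hm x).of_uncurry_left (x := s)).aemeasurable).symm.trans ?_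
    simp_rw [offspringSum, hh, familyMean_untilTime, hw]
    by_cases hs : b + s ∈ Set.Iic t
    · simp_rw [Set.indicator_of_mem hs, familySq, sq]
      rfl
    · simp_rw [Set.indicator_of_notMem hs]
      simp
  unfold familyMean
  rw [ENNReal.tsum_comm]
  simp_rw [tsum_iterate_meanOp Φ _ (measurable_pairOp Φ hmh hmh) hmw hk,
    tsum_intensity hΦ, zero_add]
  have : ∀ n : ℕ, ENNReal.ofReal (meanOffspring Φ) ^ n *
      ∫⁻ s in Set.Ioi (0 : ℝ), ENNReal.ofReal (s ^ n / n.factorial) * w s =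
      ∫⁻ s in Set.Ioi (0 : ℝ), ENNReal.ofReal (s ^ n / n.factorial) *
        ENNReal.ofReal (meanOffspring Φ) ^ n * w s := by
    intro n
    rw [← lintegral_const_mul _ (by fun_prop)]
    exact lintegral_congr fun s => by ring
  simp_rw [this]
  rw [← lintegral_tsum fun n => by fun_prop, ← lintegral_indicator measurableSet_Ioi,
    ← lintegral_indicator measurableSet_Ioc]
  refine lintegral_congr fun s => ?_
  by_cases hs : s ∈ Set.Ioi (0 : ℝ)
  · rw [Set.indicator_of_mem hs, ENNReal.tsum_mul_right,
      tsum_ofReal_exp_mul _ (meanOffspring_nonneg Φ) (le_of_lt hs), hw]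
    by_cases hst : s ∈ Set.Iic t
    · rw [Set.indicator_of_mem hst, Set.indicator_of_mem (show s ∈ Set.Ioc 0 t from ⟨hs, hst⟩)]
    · rw [Set.indicator_of_notMem hst, Set.indicator_of_notMem (fun h => hst h.2), mul_zero]
  · rw [Set.indicator_of_notMem hs, Set.indicator_of_notMem (fun h => hs h.1)]

end Semigroup

/-! ### Moments of the number of balls at a site -/

section Counts

variable {d : ℕ} (Φ : Measure (Config d)) [IsProbabilityMeasure Φ]

theorem contribution_untilTime (ω : BranchNoise d) (x : Site d) (t : ℝ) (b : Ball d) :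
    contribution ω (untilTime t (Pi.single x 1)) b = (ballsAt ω x t).indicator 1 b := by
  by_cases hb : b ∈ ballsAt ω x t
  · rw [Set.indicator_of_mem hb, contribution,
      Set.indicator_of_mem (show b ∈ {b : Ball d | IsBorn ω b.1 b.2} from hb.1), untilTime,
      Set.indicator_of_mem (show birthTime ω b.1 b.2 ∈ Set.Iic t from hb.2.1), hb.2.2,
      Pi.single_eq_same, Pi.one_apply]
  · rw [Set.indicator_of_notMem hb]
    by_contra hne
    have h1 : b ∈ {b : Ball d | IsBorn ω b.1 b.2} := Set.mem_of_indicator_ne_zero hne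
    rw [contribution, Set.indicator_of_mem h1] at hne
    have h2 : birthTime ω b.1 b.2 ∈ Set.Iic t := Set.mem_of_indicator_ne_zero hne
    rw [untilTime, Set.indicator_of_mem h2] at hne
    refine hb ⟨h1, h2, ?_⟩
    by_contra h3
    exact hne (Pi.single_eq_of_ne h3 _)

theorem toENNReal_encard_ballsAt (P : Site d → Prop) [DecidablePred P] (ω : BranchNoise d)
    (x : Site d) (t : ℝ) :
    ((({b ∈ ballsAt ω x t | P b.1}.encard : ℕ∞)) : ℝ≥0∞) =
      ∑' b : Ball d, (if P b.1 then 1 else 0) *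
        contribution ω (untilTime t (Pi.single x 1)) b := by
  rw [← ENNReal.tsum_set_one, tsum_subtype _ (fun _ => (1 : ℝ≥0∞))]
  refine tsum_congr fun b => ?_
  rw [contribution_untilTime]
  by_cases hP : P b.1
  · rw [if_pos hP, one_mul]
    by_cases hb : b ∈ ballsAt ω x t
    · rw [Set.indicator_of_mem hb,
        Set.indicator_of_mem (show b ∈ {b ∈ ballsAt ω x t | P b.1} from ⟨hb, hP⟩)]
      rfl
    · rw [Set.indicator_of_notMem hb, Set.indicator_of_notMem (fun h => hb h.1)]
  · rw [if_neg hP, zero_mul, Set.indicator_of_notMem (fun h => hP h.2)]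

theorem single_neg_eq (z : Site d) : (Pi.single (-z) 1 : Site d → ℝ≥0∞) =
    fun x => (Pi.single 0 1 : Site d → ℝ≥0∞) (x + z) := by
  ext x
  by_cases h : x = -z
  · subst h; simp
  · rw [Pi.single_eq_of_ne h, Pi.single_eq_of_ne (fun h' => h (eq_neg_of_add_eq_zero_left h'))]

/-- By translation invariance, moving the target to `-z` amounts to moving the ancestor to `z`. -/
theorem lintegral_singleCount {t : ℝ} (ht : 0 ≤ t) (z : Site d) :
    ∫⁻ ω, (singleCount 0 (-z) t ω : ℝ≥0∞) ∂branchLaw Φ = meanCount Φ t z := by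
  simp_rw [singleCount, toENNReal_encard_ballsAt (fun z : Site d => z = 0)]
  rw [lintegral_tsum_contribution Φ (fun z => if z = 0 then 1 else 0) (measurable_untilTime t _),
    tsum_eq_single 0 (fun x hx => by simp [hx])]
  rw [if_pos rfl, one_mul, familyMean_untilTime, Set.indicator_of_mem (by exact ht), single_neg_eq,
    expStep_translate, sub_zero, zero_add]
  rfl

theorem measurable_singleCount (x : Site d) (t : ℝ) :
    Measurable fun ω : BranchNoise d => (singleCount 0 x t ω : ℝ≥0∞) := by
  simp_rw [singleCount, toENNReal_encard_ballsAt (fun z : Site d => z = 0)]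
  exact Measurable.tsum fun b => (measurable_contribution (measurable_untilTime t _) b).const_mul _

variable {Φ} in
theorem meanProportion_eq (hΦ : Integrable size Φ) {t : ℝ} (ht : 0 ≤ t) (z : Site d) :
    meanProportion Φ z t = Real.exp (-meanOffspring Φ * t) * (meanCount Φ t z).toReal := by
  rw [meanProportion, lintegral_singleCount Φ ht,
    lintegral_tsum fun x => (measurable_singleCount x t).aemeasurable,
    ← (Equiv.neg (Site d)).tsum_eq]
  simp_rw [Equiv.neg_apply, lintegral_singleCount Φ ht]
  rw [tsum_meanCount hΦ ht, ENNReal.toReal_div, ENNReal.toReal_ofReal (Real.exp_pos _).le,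
    neg_mul, Real.exp_neg]
  ring

/-- The weight of ancestors in the monochromatic process: `1` for the occupied sites. -/
noncomputable def occupied (η : Site d → ℕ) (z : Site d) : ℝ≥0∞ := if η z = 1 then 1 else 0

theorem occupied_mul_self (η : Site d → ℕ) (z : Site d) :
    occupied η z * occupied η z = occupied η z := by
  unfold occupied
  split_ifs <;> simp

theorem measurable_occupied (z : Site d) : Measurable fun η : Site d → ℕ => occupied η z :=
  (Measurable.of_discrete (f := fun n : ℕ => if n = 1 then (1 : ℝ≥0∞) else 0)).comp
    (measurable_pi_apply z)

theorem monoCount_eq (x : Site d) (t : ℝ) (s : Sample d) :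
    (monoCount x t s : ℝ≥0∞) =
      ∑' b : Ball d, occupied s.1 b.1 * contribution s.2 (untilTime t (Pi.single x 1)) b :=
  toENNReal_encard_ballsAt (fun z => s.1 z = 1) s.2 x t

theorem measurable_monoCount (x : Site d) (t : ℝ) :
    Measurable fun s : Sample d => (monoCount x t s : ℝ≥0∞) := by
  simp_rw [monoCount_eq]
  exact Measurable.tsum fun b => ((measurable_occupied b.1).comp measurable_fst).mul
    ((measurable_contribution (measurable_untilTime t _) b).comp measurable_snd)

theorem lintegral_occupied (p : unitInterval) (z : Site d) :
    ∫⁻ η, occupied η z ∂Measure.infinitePi (fun _ : Site d => bernoulliMeasure (1 : ℕ) 0 p) =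
      ENNReal.ofReal p := by
  have hm : Measurable fun n : ℕ => if n = 1 then (1 : ℝ≥0∞) else 0 := Measurable.of_discrete
  refine ((measurePreserving_eval_infinitePi
    (fun _ : Site d => bernoulliMeasure (1 : ℕ) 0 p) z).lintegral_comp hm).trans ?_
  rw [bernoulliMeasure_def, lintegral_add_measure, lintegral_smul_measure, lintegral_smul_measure,
    lintegral_dirac' _ hm, lintegral_dirac' _ hm]
  rw [if_pos rfl, if_neg (by norm_num), smul_zero, add_zero, ENNReal.smul_def, smul_eq_mul,
    mul_one, ENNReal.ofReal_eq_coe_nnreal p.2.1]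
  rfl

theorem lintegral_occupied_mul_occupied (p : unitInterval) (z z' : Site d) :
    ∫⁻ η, occupied η z * occupied η z'
        ∂Measure.infinitePi (fun _ : Site d => bernoulliMeasure (1 : ℕ) 0 p) =
      ENNReal.ofReal p * ENNReal.ofReal p +
        if z = z' then ENNReal.ofReal (p - p ^ 2) else 0 := by
  split_ifs with h
  · subst h
    have hp0 : (0 : ℝ) ≤ p := p.2.1
    have hp1 : (p : ℝ) ≤ 1 := p.2.2
    simp_rw [occupied_mul_self]
    rw [lintegral_occupied, ← ENNReal.ofReal_mul hp0, ← ENNReal.ofReal_add (by positivity)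
      (by nlinarith)]
    congr 1
    ring
  · classical
    rw [lintegral_infinitePi_piecewise _ {z'}
      (show Measurable fun η : Site d → ℕ => occupied η z * occupied η z' from
        (measurable_occupied z).mul (measurable_occupied z'))]
    have h1 : ∀ η η' : Site d → ℕ, occupied (({z'} : Set (Site d)).piecewise η' η) z *
        occupied (({z'} : Set (Site d)).piecewise η' η) z' = occupied η z * occupied η' z' := by
      intro η η'
      simp [occupied, Set.piecewise, h]
    simp_rw [h1]
    simp_rw [lintegral_const_mul _ (measurable_occupied z'), lintegral_occupied]
    rw [lintegral_mul_const _ (measurable_occupied z), lintegral_occupied, add_zero]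

variable {Φ} in
theorem lintegral_monoCount (hΦ : Integrable size Φ) (p : unitInterval) {t : ℝ} (ht : 0 ≤ t) :
    ∫⁻ s, (monoCount 0 t s : ℝ≥0∞) ∂monoLaw Φ p =
      ENNReal.ofReal p * ENNReal.ofReal (Real.exp (meanOffspring Φ * t)) := by
  rw [monoLaw, lintegral_prod _ (measurable_monoCount 0 t).aemeasurable]
  simp_rw [monoCount_eq, lintegral_tsum_contribution Φ _ (measurable_untilTime t _),
    familyMean_untilTime_zero Φ ht]
  rw [lintegral_tsum fun z => ((measurable_occupied z).mul_const _).aemeasurable]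
  simp_rw [lintegral_mul_const _ (measurable_occupied _), lintegral_occupied,
    ENNReal.tsum_mul_left, tsum_meanCount hΦ ht]

variable {Φ} in
/-- The second moment of the number of balls at the origin. Beyond the square of the mean there
are the variance of the initial occupation numbers and the variance of the branching. -/
theorem lintegral_monoCount_sq (hΦ : Integrable size Φ) (p : unitInterval) {t : ℝ} (ht : 0 ≤ t) :
    ∫⁻ s, (monoCount 0 t s : ℝ≥0∞) ^ 2 ∂monoLaw Φ p =
      (ENNReal.ofReal p * ENNReal.ofReal (Real.exp (meanOffspring Φ * t))) ^ 2 +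
        ENNReal.ofReal (p - p ^ 2) * ∑' z, meanCount Φ t z ^ 2 +
        ENNReal.ofReal p * ∫⁻ s in Set.Ioc 0 t,
          ENNReal.ofReal (Real.exp (meanOffspring Φ * s)) * familySq Φ (t - s) := by
  rw [monoLaw, lintegral_prod _ ((measurable_monoCount 0 t).pow_const 2).aemeasurable]
  simp_rw [monoCount_eq, lintegral_tsum_contribution_sq Φ _ (measurable_untilTime t _),
    familyMean_untilTime_zero Φ ht]
  rw [lintegral_add_left ((Measurable.tsum fun z =>
    (measurable_occupied z).mul_const _).pow_const 2)]
  congr 1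
  · simp_rw [sq (∑' _, _)]
    rw [lintegral_congr fun η => by
      rw [tsum_congr fun z => mul_comm (occupied η z) _],
      lintegral_tsum_mul_tsum _ _ _ measurable_occupied measurable_occupied]
    simp_rw [lintegral_occupied_mul_occupied, mul_add, ENNReal.tsum_add, mul_ite, mul_zero,
      tsum_ite_eq', ENNReal.tsum_mul_right, ENNReal.tsum_mul_left, ENNReal.tsum_mul_right,
      tsum_meanCount hΦ ht]
    congr 1
    · ring
    · rw [mul_comm]
      simp_rw [sq]
  · simp_rw [occupied_mul_self]
    rw [lintegral_tsum fun z => ((measurable_occupied z).mul_const _).aemeasurable,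
      ← tsum_familyMean_pairOp hΦ, ← ENNReal.tsum_mul_left]
    refine tsum_congr fun z => ?_
    rw [lintegral_mul_const _ (measurable_occupied z), lintegral_occupied]

end Counts

/-! ### Parseval's identity and the symbol of the random walk -/

section Fourier

open UnitAddTorus ComplexConjugate

variable {d : ℕ}

/-- The normalized Haar measure of the torus `(ℝ/ℤ)^d`. -/
noncomputable def torusMeasure (d : ℕ) : Measure (UnitAddTorus (Fin d)) :=
  Measure.pi fun _ => AddCircle.haarAddCircle

instance isProbabilityMeasure_torusMeasure (d : ℕ) : IsProbabilityMeasure (torusMeasure d) := by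
  unfold torusMeasure
  infer_instance

theorem norm_mFourier_apply (n : Site d) (θ : UnitAddTorus (Fin d)) : ‖mFourier n θ‖ = 1 := by
  simp only [mFourier, fourier_apply, ContinuousMap.coe_mk, norm_prod, Circle.norm_coe,
    Finset.prod_const_one]

/-- The torus carries its normalized Haar measure, as in the theory of Fourier series. -/
noncomputable local instance : MeasureSpace UnitAddCircle := ⟨AddCircle.haarAddCircle⟩

local instance : IsProbabilityMeasure (volume : Measure UnitAddCircle) :=
  inferInstanceAs (IsProbabilityMeasure AddCircle.haarAddCircle)

/-- Parseval's identity for absolutely convergent Fourier series. -/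
theorem hasSum_sq_of_summable {a : Site d → ℂ} (ha : Summable a) :
    HasSum (fun n => ‖a n‖ ^ 2) (∫ θ, ‖∑' n, a n * mFourier n θ‖ ^ 2 ∂torusMeasure d) := by
  set F : Site d → C(UnitAddTorus (Fin d), ℂ) := fun n => a n • mFourier n with hF
  have hFs : Summable F := by
    refine Summable.of_norm ?_
    simpa [hF, norm_smul, mFourier_norm] using ha.norm
  obtain ⟨f, hf⟩ := hFs
  have hval : ∀ θ, f θ = ∑' n, a n * mFourier n θ := fun θ => by
    have := (ContinuousMap.evalCLM ℂ θ).hasSum hf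
    simpa [hF] using this.tsum_eq.symm
  have hL := (ContinuousMap.toLp (E := ℂ) 2 (volume : Measure (UnitAddTorus (Fin d))) ℂ).hasSum hf
  have hcoeff : ∀ n, mFourierCoeff
      (ContinuousMap.toLp (E := ℂ) 2 (volume : Measure (UnitAddTorus (Fin d))) ℂ f) n = a n := by
    intro n
    rw [← mFourierBasis_repr, HilbertBasis.repr_apply_apply]
    have h1 := (innerSL ℂ (mFourierBasis (d := Fin d) n)).hasSum hL
    refine h1.unique ?_
    have h2 : ∀ m, innerSL ℂ (mFourierBasis (d := Fin d) n)
        (ContinuousMap.toLp (E := ℂ) 2 (volume : Measure (UnitAddTorus (Fin d))) ℂ (F m)) =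
        if m = n then a n else 0 := by
      intro m
      have := orthonormal_iff_ite.1 (orthonormal_mFourier (d := Fin d)) n m
      rw [hF, map_smul, map_smul, innerSL_apply_apply, coe_mFourierBasis, this]
      by_cases h : m = n
      · simp [h]
      · simp [h, Ne.symm h]
    exact (funext h2).symm ▸ hasSum_ite_eq n (a n)
  have h3 := hasSum_sq_mFourierCoeff
    (ContinuousMap.toLp (E := ℂ) 2 (volume : Measure (UnitAddTorus (Fin d))) ℂ f)
  simp_rw [hcoeff] at h3
  have h4 : ∫ θ, ‖ContinuousMap.toLp (E := ℂ) 2 (volume : Measure (UnitAddTorus (Fin d))) ℂ f θ‖ ^ 2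
      = ∫ θ, ‖∑' n, a n * mFourier n θ‖ ^ 2 ∂torusMeasure d := by
    refine integral_congr_ae ?_
    filter_upwards [ContinuousMap.coeFn_toLp (𝕜 := ℂ) (p := 2)
      (volume : Measure (UnitAddTorus (Fin d))) f] with θ hθ
    rw [hθ, hval]
  rwa [h4] at h3

/-- The Fourier series with the non-negative coefficients `g`. -/
noncomputable def series (g : Site d → ℝ≥0∞) (θ : UnitAddTorus (Fin d)) : ℂ :=
  ∑' x, ((g x).toReal : ℂ) * mFourier x θ

theorem summable_toReal_of_tsum_ne_top {α : Type*} {g : α → ℝ≥0∞} (h : ∑' x, g x ≠ ∞) :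
    Summable fun x => (((g x).toReal : ℝ) : ℂ) :=
  Complex.ofRealCLM.summable (ENNReal.summable_toReal h)

theorem tsum_sq_eq_integral_series {g : Site d → ℝ≥0∞} (h : ∑' x, g x ≠ ∞) :
    ∑' x, g x ^ 2 = ENNReal.ofReal (∫ θ, ‖series g θ‖ ^ 2 ∂torusMeasure d) := by
  have h1 := hasSum_sq_of_summable (summable_toReal_of_tsum_ne_top h)
  unfold series
  rw [← h1.tsum_eq, ENNReal.ofReal_tsum_of_nonneg (fun n => by positivity) h1.summable]
  refine tsum_congr fun x => ?_
  have hx : g x ≠ ∞ := ENNReal.ne_top_of_tsum_ne_top h x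
  rw [Complex.norm_real, Real.norm_eq_abs, sq_abs, ENNReal.ofReal_pow ENNReal.toReal_nonneg,
    ENNReal.ofReal_toReal hx]

theorem series_tsum {α : Type*} {g : α → Site d → ℝ≥0∞} (h : ∑' i, ∑' x, g i x ≠ ∞)
    (θ : UnitAddTorus (Fin d)) :
    series (fun x => ∑' i, g i x) θ = ∑' i, series (g i) θ := by
  have hx : ∀ i x, g i x ≠ ∞ := fun i x =>
    ENNReal.ne_top_of_tsum_ne_top (ENNReal.ne_top_of_tsum_ne_top h i) x
  have hs : Summable fun q : Site d × α => ((g q.2 q.1).toReal : ℂ) * mFourier q.1 θ := by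
    refine Summable.of_norm ?_
    simp_rw [norm_mul, norm_mFourier_apply, mul_one]
    refine (summable_toReal_of_tsum_ne_top (g := fun q : Site d × α => g q.2 q.1) ?_).norm
    rw [ENNReal.tsum_prod (f := fun x i => g i x), ENNReal.tsum_comm]
    exact h
  unfold series
  refine Eq.trans ?_
    (hs.tsum_comm' (f := fun x i => ((g i x).toReal : ℂ) * mFourier x θ) ?_ ?_).symm
  · refine tsum_congr fun x => ?_
    rw [ENNReal.tsum_toReal_eq fun i => hx i x, Complex.ofReal_tsum, tsum_mul_right]
  · intro x
    exact hs.prod_factor x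
  · intro i
    exact hs.prod_symm.prod_factor i

theorem series_const_mul (c : ℝ≥0∞) (g : Site d → ℝ≥0∞) (θ : UnitAddTorus (Fin d)) :
    series (fun x => c * g x) θ = (c.toReal : ℂ) * series g θ := by
  simp_rw [series, ENNReal.toReal_mul, ← tsum_mul_left]
  exact tsum_congr fun x => by push_cast; ring

theorem series_translate (g : Site d → ℝ≥0∞) (y : Site d) (θ : UnitAddTorus (Fin d)) :
    series (fun x => g (x + y)) θ = conj (mFourier y θ) * series g θ := by
  rw [series, series, ← tsum_mul_left,
    ← (Equiv.addRight y).tsum_eq fun x => conj (mFourier y θ) * (((g x).toReal : ℂ) * mFourier x θ)]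
  refine tsum_congr fun x => ?_
  have : conj (mFourier y θ) * mFourier y θ = 1 := by
    rw [← Complex.normSq_eq_conj_mul_self, Complex.normSq_eq_norm_sq, norm_mFourier_apply]
    simp
  rw [Equiv.coe_addRight, mFourier_add]
  linear_combination (-((g (x + y)).toReal : ℂ) * mFourier x θ) * this

/-- Sums of translates: `c` is the weight of the translations. -/
theorem series_tsum_translate {c g : Site d → ℝ≥0∞} (hc : ∑' y, c y ≠ ∞) (hg : ∑' x, g x ≠ ∞)
    (θ : UnitAddTorus (Fin d)) :
    series (fun x => ∑' y, c y * g (x + y)) θ = conj (series c θ) * series g θ := by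
  rw [series_tsum]
  · simp_rw [series_const_mul, series_translate, ← mul_assoc]
    rw [tsum_mul_right]
    congr 1
    rw [series, Complex.conj_tsum]
    refine tsum_congr fun y => ?_
    rw [map_mul, Complex.conj_ofReal]
  · simp_rw [ENNReal.tsum_mul_left, tsum_add_right_eq, ENNReal.tsum_mul_right]
    exact ENNReal.mul_ne_top hc hg

variable {Φ : Measure (Config d)}

theorem series_iterate_stepOp (hΦ : Integrable size Φ) {g : Site d → ℝ≥0∞} (hg : ∑' x, g x ≠ ∞)
    (n : ℕ) (θ : UnitAddTorus (Fin d)) :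
    series ((stepOp Φ)^[n] g) θ = conj (series (intensity Φ) θ) ^ n * series g θ := by
  have hI : ∑' y, intensity Φ y ≠ ∞ := by rw [tsum_intensity hΦ]; exact ENNReal.ofReal_ne_top
  induction n with
  | zero => simp
  | succ n ih =>
    rw [Function.iterate_succ_apply', pow_succ', mul_assoc, ← ih]
    refine series_tsum_translate hI ?_ θ
    rw [tsum_iterate_stepOp]
    exact ENNReal.mul_ne_top (ENNReal.pow_ne_top hI) hg

/-- The mean semigroup is a convolution semigroup, so that its Fourier series is an exponential. -/
theorem series_meanCount (hΦ : Integrable size Φ) {s : ℝ} (hs : 0 ≤ s)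
    (θ : UnitAddTorus (Fin d)) :
    series (meanCount Φ s) θ = Complex.exp (s * conj (series (intensity Φ) θ)) := by
  have h0 : ∑' x, (Pi.single 0 1 : Site d → ℝ≥0∞) x = 1 := by
    rw [tsum_eq_single 0 fun x hx => by simp [hx]]
    simp
  have h0' : series (Pi.single 0 1 : Site d → ℝ≥0∞) θ = 1 := by
    rw [series, tsum_eq_single 0 fun x hx => by simp [hx]]
    simp [mFourier_zero]
  have h1 : meanCount Φ s = fun x => ∑' n : ℕ, ENNReal.ofReal (s ^ n / n.factorial) *
      (stepOp Φ)^[n] (Pi.single 0 1) x := rfl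
  rw [h1, series_tsum]
  · simp_rw [series_const_mul, series_iterate_stepOp hΦ (h0.trans_ne ENNReal.one_ne_top), h0']
    rw [Complex.exp_eq_exp_ℂ, NormedSpace.exp_eq_tsum_div]
    refine tsum_congr fun n => ?_
    rw [ENNReal.toReal_ofReal (by positivity)]
    push_cast
    ring
  · rw [ENNReal.tsum_comm]
    have := tsum_meanCount hΦ hs
    rw [h1] at this
    rw [this]
    exact ENNReal.ofReal_ne_top

/-- The real part of `λ` minus the Fourier series of the intensity. Each of the two random walks
followed by a pair of lines of descent contributes the factor `exp (-s * symbol Φ θ)`. -/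
noncomputable def symbol (Φ : Measure (Config d)) (θ : UnitAddTorus (Fin d)) : ℝ :=
  ∑' y, (intensity Φ y).toReal * (‖1 - mFourier y θ‖ ^ 2 / 2)

theorem norm_one_sub_mFourier_sq (y : Site d) (θ : UnitAddTorus (Fin d)) :
    ‖1 - mFourier y θ‖ ^ 2 / 2 = 1 - (mFourier y θ).re := by
  have h := norm_mFourier_apply y θ
  rw [← Complex.normSq_eq_norm_sq, Complex.normSq_sub, Complex.normSq_eq_norm_sq,
    Complex.normSq_eq_norm_sq, h]
  simp
  ring

theorem re_series_intensity (hΦ : Integrable size Φ) (θ : UnitAddTorus (Fin d)) :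
    (series (intensity Φ) θ).re = meanOffspring Φ - symbol Φ θ := by
  have hI : ∑' y, intensity Φ y ≠ ∞ := by rw [tsum_intensity hΦ]; exact ENNReal.ofReal_ne_top
  have hs := ENNReal.summable_toReal hI
  have hs2 : Summable fun y => ((intensity Φ y).toReal : ℂ) * mFourier y θ := by
    refine Summable.of_norm ?_
    simpa [norm_mul, norm_mFourier_apply] using hs
  have hre : Summable fun y => (intensity Φ y).toReal * (mFourier y θ).re := by
    have := Complex.reCLM.summable hs2
    simpa using this
  have h1 : meanOffspring Φ = ∑' y, (intensity Φ y).toReal := by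
    rw [← ENNReal.tsum_toReal_eq fun y => ENNReal.ne_top_of_tsum_ne_top hI y, tsum_intensity hΦ,
      ENNReal.toReal_ofReal (meanOffspring_nonneg Φ)]
  rw [series, Complex.re_tsum hs2, h1, symbol]
  simp_rw [norm_one_sub_mFourier_sq, mul_sub, mul_one]
  rw [hs.tsum_sub hre]
  simp

theorem norm_series_meanCount (hΦ : Integrable size Φ) {s : ℝ} (hs : 0 ≤ s)
    (θ : UnitAddTorus (Fin d)) :
    ‖series (meanCount Φ s) θ‖ ^ 2 =
      Real.exp (2 * meanOffspring Φ * s) * Real.exp (-(2 * s * symbol Φ θ)) := by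
  rw [series_meanCount hΦ hs, Complex.norm_exp, ← Real.exp_nat_mul, ← Real.exp_add,
    Complex.re_ofReal_mul, Complex.conj_re, re_series_intensity hΦ]
  congr 1
  push_cast
  ring

/-- The probability that two independent copies of the random walk of a line of descent are at
the same site at time `s`. -/
noncomputable def returnProb (Φ : Measure (Config d)) (s : ℝ) : ℝ :=
  ∫ θ, Real.exp (-(2 * s * symbol Φ θ)) ∂torusMeasure d

theorem tsum_meanCount_sq (hΦ : Integrable size Φ) {s : ℝ} (hs : 0 ≤ s) :
    ∑' z, meanCount Φ s z ^ 2 =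
      ENNReal.ofReal (Real.exp (2 * meanOffspring Φ * s) * returnProb Φ s) := by
  rw [tsum_sq_eq_integral_series (by rw [tsum_meanCount hΦ hs]; exact ENNReal.ofReal_ne_top)]
  simp_rw [norm_series_meanCount hΦ hs, integral_const_mul]
  rfl

/-- The sum of the probabilities of meeting at time `s`, over all pairs of balls of `φ` that are
followed by independent random walks. -/
noncomputable def pairReturn (Φ : Measure (Config d)) (s : ℝ) (φ : Config d) : ℝ :=
  ∫ θ, ‖series (fun y => (φ y : ℝ≥0∞)) θ‖ ^ 2 * Real.exp (-(2 * s * symbol Φ θ)) ∂torusMeasure d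

theorem tsum_sum_meanCount_sq (hΦ : Integrable size Φ) {s : ℝ} (hs : 0 ≤ s) (φ : Config d) :
    ∑' x, (∑' y, (φ y : ℝ≥0∞) * meanCount Φ s (x + y)) ^ 2 =
      ENNReal.ofReal (Real.exp (2 * meanOffspring Φ * s) * pairReturn Φ s φ) := by
  have h1 : ∑' y, (φ y : ℝ≥0∞) ≠ ∞ := by rw [tsum_config]; exact ENNReal.ofReal_ne_top
  have h2 : ∑' x, meanCount Φ s x ≠ ∞ := by
    rw [tsum_meanCount hΦ hs]; exact ENNReal.ofReal_ne_top
  rw [tsum_sq_eq_integral_series]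
  · simp_rw [series_tsum_translate h1 h2, norm_mul, RCLike.norm_conj, mul_pow,
      norm_series_meanCount hΦ hs, mul_left_comm, integral_const_mul]
    rfl
  · rw [ENNReal.tsum_comm]
    simp_rw [ENNReal.tsum_mul_left, tsum_add_right_eq, ENNReal.tsum_mul_right]
    exact ENNReal.mul_ne_top h1 h2

end Fourier

/-! ### Gaussian integrals on the torus -/

section Gaussian

open UnitAddTorus

/-- The squared chord length on the circle. -/
noncomputable def chordSq (x : UnitAddCircle) : ℝ := ‖1 - (fourier 1 x : ℂ)‖ ^ 2

theorem continuous_chordSq : Continuous chordSq := by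
  unfold chordSq
  fun_prop

theorem chordSq_coe (u : ℝ) : chordSq (u : UnitAddCircle) = 2 * (1 - Real.cos (2 * Real.pi * u)) := by
  have h1 : (fourier 1 (u : UnitAddCircle) : ℂ) = Complex.exp ((2 * Real.pi * u : ℝ) * Complex.I) := by
    rw [fourier_coe_apply]
    congr 1
    push_cast
    ring
  rw [chordSq, h1, ← Complex.normSq_eq_norm_sq, Complex.normSq_sub, Complex.normSq_eq_norm_sq,
    Complex.normSq_eq_norm_sq, Complex.norm_exp_ofReal_mul_I, one_mul, Complex.conj_re,
    Complex.exp_ofReal_mul_I_re]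
  simp
  ring

theorem chordSq_le (u : ℝ) : chordSq (u : UnitAddCircle) ≤ 4 * Real.pi ^ 2 * u ^ 2 := by
  rw [chordSq_coe]
  nlinarith [Real.one_sub_sq_div_two_le_cos (x := 2 * Real.pi * u)]

theorem le_chordSq {u : ℝ} (hu : |u| ≤ 1 / 2) : 16 * u ^ 2 ≤ chordSq (u : UnitAddCircle) := by
  have hpi := Real.pi_pos
  have h := Real.cos_le_one_sub_mul_cos_sq (x := 2 * Real.pi * u) (by
    rw [abs_mul, abs_of_pos (by positivity)]
    nlinarith)
  have h2 : 2 / Real.pi ^ 2 * (2 * Real.pi * u) ^ 2 = 8 * u ^ 2 := by field_simp; ring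
  rw [chordSq_coe]
  linarith

theorem integral_haarAddCircle (f : UnitAddCircle → ℝ) :
    ∫ x, f x ∂(AddCircle.haarAddCircle : Measure UnitAddCircle) =
      ∫ u in Set.Ioc (-(1 / 2) : ℝ) (1 / 2), f u := by
  have h := UnitAddCircle.integral_preimage (-(1 / 2)) f
  rw [show (-(1 / 2) : ℝ) + 1 = 1 / 2 by norm_num] at h
  rw [h, AddCircle.volume_eq_smul_haarAddCircle]
  simp

/-- The factor `Real.exp 4` allows `s` to be replaced by `1 + s` in the Gaussian bound, which is
then valid down to `s = 0`. -/
theorem integral_exp_chordSq_le {s : ℝ} (hs : 0 ≤ s) :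
    ∫ x, Real.exp (-(s * chordSq x)) ∂(AddCircle.haarAddCircle : Measure UnitAddCircle) ≤
      Real.exp 4 * √Real.pi * (1 + s) ^ (-(1 / 2) : ℝ) := by
  rw [integral_haarAddCircle]
  have hb : 0 < 16 * (1 + s) := by positivity
  have hcont : Continuous fun u : ℝ => Real.exp (-(s * chordSq (u : UnitAddCircle))) := by
    have := continuous_chordSq
    have h2 : Continuous fun u : ℝ => (u : UnitAddCircle) := AddCircle.continuous_mk' 1
    fun_prop
  have hint : Integrable (fun u : ℝ => Real.exp 4 * Real.exp (-(16 * (1 + s)) * u ^ 2)) :=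
    (integrable_exp_neg_mul_sq hb).const_mul _
  calc ∫ u in Set.Ioc (-(1 / 2) : ℝ) (1 / 2), Real.exp (-(s * chordSq (u : UnitAddCircle)))
      ≤ ∫ u in Set.Ioc (-(1 / 2) : ℝ) (1 / 2),
          Real.exp 4 * Real.exp (-(16 * (1 + s)) * u ^ 2) := by
        refine setIntegral_mono_on (hcont.integrableOn_Ioc) hint.integrableOn measurableSet_Ioc
          fun u hu => ?_
        rw [← Real.exp_add]
        refine Real.exp_le_exp.2 ?_
        have hu' : |u| ≤ 1 / 2 := abs_le.2 ⟨hu.1.le, hu.2⟩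
        have h1 := mul_le_mul_of_nonneg_left (le_chordSq hu') hs
        have h2 : u ^ 2 ≤ 1 / 4 := by
          rw [← sq_abs]; nlinarith [abs_nonneg u]
        nlinarith
    _ ≤ ∫ u : ℝ, Real.exp 4 * Real.exp (-(16 * (1 + s)) * u ^ 2) :=
        setIntegral_le_integral hint (ae_of_all _ fun u => by positivity)
    _ = Real.exp 4 * √(Real.pi / (16 * (1 + s))) := by
        rw [integral_const_mul, integral_gaussian]
    _ ≤ Real.exp 4 * √Real.pi * (1 + s) ^ (-(1 / 2) : ℝ) := by
        rw [mul_assoc]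
        refine mul_le_mul_of_nonneg_left ?_ (Real.exp_pos _).le
        rw [Real.rpow_neg (by positivity), ← Real.sqrt_eq_rpow, ← div_eq_mul_inv,
          ← Real.sqrt_div Real.pi_pos.le]
        refine Real.sqrt_le_sqrt ?_
        refine div_le_div_of_nonneg_left Real.pi_pos.le (by positivity) (by linarith)

/-- On the interval of length `(1 + s) ^ (-1 / 2)` around the origin the exponent is bounded. -/
theorem le_integral_exp_chordSq {s : ℝ} (hs : 0 ≤ s) :
    Real.exp (-Real.pi ^ 2) * (1 + s) ^ (-(1 / 2) : ℝ) ≤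
      ∫ x, Real.exp (-(s * chordSq x)) ∂(AddCircle.haarAddCircle : Measure UnitAddCircle) := by
  rw [integral_haarAddCircle]
  set r : ℝ := (1 + s) ^ (-(1 / 2) : ℝ) with hr
  have hr0 : 0 < r := by positivity
  have hr1 : r ≤ 1 := Real.rpow_le_one_of_one_le_of_nonpos (by linarith) (by norm_num)
  have hr2 : r ^ 2 * (1 + s) = 1 := by
    rw [hr, ← Real.rpow_natCast, ← Real.rpow_mul (by positivity)]
    norm_num
    rw [Real.rpow_neg_one, inv_mul_cancel₀ (by positivity)]
  have hcont : Continuous fun u : ℝ => Real.exp (-(s * chordSq (u : UnitAddCircle))) := by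
    have := continuous_chordSq
    have h2 : Continuous fun u : ℝ => (u : UnitAddCircle) := AddCircle.continuous_mk' 1
    fun_prop
  calc Real.exp (-Real.pi ^ 2) * r
      = ∫ _u in Set.Ioc (-(r / 2)) (r / 2), Real.exp (-Real.pi ^ 2) := by
        rw [setIntegral_const, measureReal_def, Real.volume_Ioc, smul_eq_mul,
          ENNReal.toReal_ofReal (by linarith)]
        ring
    _ ≤ ∫ u in Set.Ioc (-(r / 2)) (r / 2), Real.exp (-(s * chordSq (u : UnitAddCircle))) := by
        refine setIntegral_mono_on (by simp) hcont.integrableOn_Ioc measurableSet_Ioc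
          fun u hu => Real.exp_le_exp.2 ?_
        have h1 := mul_le_mul_of_nonneg_left (chordSq_le u) hs
        have h2 : u ^ 2 ≤ r ^ 2 / 4 := by
          have := abs_le.2 ⟨hu.1.le, hu.2⟩
          rw [← sq_abs]; nlinarith [abs_nonneg u]
        have h3 : s * u ^ 2 ≤ 1 / 4 := by nlinarith [sq_nonneg r]
        nlinarith [sq_nonneg Real.pi]
    _ ≤ ∫ u in Set.Ioc (-(1 / 2) : ℝ) (1 / 2), Real.exp (-(s * chordSq (u : UnitAddCircle))) := by
        refine setIntegral_mono_set hcont.integrableOn_Ioc (ae_of_all _ fun u => (Real.exp_pos _).le)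
          (LE.le.eventuallyLE (Set.Ioc_subset_Ioc (by linarith) (by linarith)))

variable {d : ℕ}

/-- The sum of the squared chord lengths of the coordinates: the squared distance to the origin of
the torus, up to constants. -/
noncomputable def torusSq (θ : UnitAddTorus (Fin d)) : ℝ := ∑ i, chordSq (θ i)

theorem continuous_torusSq : Continuous (torusSq (d := d)) := by
  have := continuous_chordSq
  unfold torusSq
  fun_prop

theorem chordSq_nonneg (x : UnitAddCircle) : 0 ≤ chordSq x := by unfold chordSq; positivity

theorem torusSq_nonneg (θ : UnitAddTorus (Fin d)) : 0 ≤ torusSq θ :=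
  Finset.sum_nonneg fun _ _ => chordSq_nonneg _

theorem norm_fourier_apply (n : ℤ) (x : UnitAddCircle) : ‖(fourier n x : ℂ)‖ = 1 := by
  simp only [fourier_apply, Circle.norm_coe]

theorem chordSq_le_four (x : UnitAddCircle) : chordSq x ≤ 4 := by
  have h2 : ‖1 - (fourier 1 x : ℂ)‖ ≤ 2 := by
    refine (norm_sub_le _ _).trans ?_
    rw [norm_fourier_apply, norm_one]; norm_num
  unfold chordSq
  nlinarith [norm_nonneg (1 - (fourier 1 x : ℂ))]

theorem torusSq_le (θ : UnitAddTorus (Fin d)) : torusSq θ ≤ 4 * d := by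
  refine (Finset.sum_le_sum fun i _ => chordSq_le_four (θ i)).trans ?_
  simp [mul_comm]

theorem integrable_torus_of_continuous {E : Type*} [NormedAddCommGroup E]
    {f : UnitAddTorus (Fin d) → E} (hf : Continuous f) : Integrable f (torusMeasure d) :=
  hf.integrable_of_hasCompactSupport (HasCompactSupport.of_compactSpace f)

theorem integral_exp_torusSq (s : ℝ) :
    ∫ θ, Real.exp (-(s * torusSq θ)) ∂torusMeasure d =
      (∫ x, Real.exp (-(s * chordSq x)) ∂(AddCircle.haarAddCircle : Measure UnitAddCircle)) ^ d := by
  have := integral_fintype_prod_eq_pow (ι := Fin d) (μ := (AddCircle.haarAddCircle :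
    Measure UnitAddCircle)) fun x => Real.exp (-(s * chordSq x))
  rw [Fintype.card_fin] at this
  rw [← this]
  refine integral_congr_ae (ae_of_all _ fun θ => ?_)
  simp only [torusSq, Finset.mul_sum, ← Finset.sum_neg_distrib, Real.exp_sum]

theorem exists_integral_exp_torusSq_le (d : ℕ) {c : ℝ} (hc : 0 < c) :
    ∃ K : ℝ, 0 < K ∧ ∀ s : ℝ, 0 ≤ s →
      ∫ θ, Real.exp (-(c * s * torusSq θ)) ∂torusMeasure d ≤ K * (1 + s) ^ (-(d : ℝ) / 2) := by
  set A := Real.exp 4 * √Real.pi * (min 1 c) ^ (-(1 / 2) : ℝ) with hA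
  have hm : 0 < min 1 c := lt_min one_pos hc
  have hA0 : 0 < A := by have := Real.pi_pos; positivity
  refine ⟨A ^ d, by positivity, fun s hs => ?_⟩
  rw [integral_exp_torusSq]
  have h1 : ∫ x, Real.exp (-(c * s * chordSq x)) ∂(AddCircle.haarAddCircle : Measure UnitAddCircle)
      ≤ A * (1 + s) ^ (-(1 / 2) : ℝ) := by
    refine (integral_exp_chordSq_le (by positivity)).trans ?_
    rw [hA, mul_assoc _ (min 1 c ^ _)]
    refine mul_le_mul_of_nonneg_left ?_ (by positivity)
    rw [← Real.mul_rpow hm.le (by positivity)]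
    refine Real.rpow_le_rpow_of_nonpos (by positivity) ?_ (by norm_num)
    have h2 := min_le_left 1 c
    have h3 := mul_le_mul_of_nonneg_right (min_le_right 1 c) hs
    nlinarith
  calc _ ≤ (A * (1 + s) ^ (-(1 / 2) : ℝ)) ^ d :=
        pow_le_pow_left₀ (integral_nonneg fun x => (Real.exp_pos _).le) h1 d
    _ = A ^ d * (1 + s) ^ (-(d : ℝ) / 2) := by
        rw [mul_pow, ← Real.rpow_natCast ((1 + s) ^ (-(1 / 2) : ℝ)), ← Real.rpow_mul (by positivity)]
        congr 2
        ring

theorem exists_le_integral_exp_torusSq (d : ℕ) {c : ℝ} (hc : 0 < c) :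
    ∃ K : ℝ, 0 < K ∧ ∀ s : ℝ, 0 ≤ s →
      K * (1 + s) ^ (-(d : ℝ) / 2) ≤ ∫ θ, Real.exp (-(c * s * torusSq θ)) ∂torusMeasure d := by
  set A := Real.exp (-Real.pi ^ 2) * (max 1 c) ^ (-(1 / 2) : ℝ) with hA
  have hm : 0 < max 1 c := lt_max_of_lt_left one_pos
  have hA0 : 0 < A := by positivity
  refine ⟨A ^ d, by positivity, fun s hs => ?_⟩
  rw [integral_exp_torusSq]
  have h1 : A * (1 + s) ^ (-(1 / 2) : ℝ) ≤
      ∫ x, Real.exp (-(c * s * chordSq x)) ∂(AddCircle.haarAddCircle : Measure UnitAddCircle) := by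
    refine le_trans ?_ (le_integral_exp_chordSq (by positivity))
    rw [hA, mul_assoc]
    refine mul_le_mul_of_nonneg_left ?_ (by positivity)
    rw [← Real.mul_rpow hm.le (by positivity)]
    refine Real.rpow_le_rpow_of_nonpos (by positivity) ?_ (by norm_num)
    have h2 := le_max_left 1 c
    have h3 := mul_le_mul_of_nonneg_right (le_max_right 1 c) hs
    nlinarith
  calc A ^ d * (1 + s) ^ (-(d : ℝ) / 2) = (A * (1 + s) ^ (-(1 / 2) : ℝ)) ^ d := by
        rw [mul_pow A, ← Real.rpow_natCast ((1 + s) ^ (-(1 / 2) : ℝ)),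
          ← Real.rpow_mul (by positivity)]
        congr 2
        ring
    _ ≤ _ := pow_le_pow_left₀ (by positivity) h1 d

theorem norm_one_sub_zpow_le {z : ℂ} (hz : ‖z‖ = 1) (n : ℤ) : ‖1 - z ^ n‖ ≤ |(n : ℝ)| * ‖1 - z‖ := by
  have hz0 : z ≠ 0 := by rintro rfl; simp at hz
  have hnat : ∀ m : ℕ, ‖1 - z ^ m‖ ≤ m * ‖1 - z‖ := by
    intro m
    induction m with
    | zero => simp
    | succ m ih =>
      have : 1 - z ^ (m + 1) = (1 - z ^ m) + z ^ m * (1 - z) := by ring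
      rw [this]
      refine (norm_add_le _ _).trans ?_
      rw [norm_mul, norm_pow, hz, one_pow]
      push_cast
      linarith
  obtain ⟨m, rfl | rfl⟩ := n.eq_nat_or_neg
  · simpa using hnat m
  · have : 1 - z ^ (-(m : ℤ)) = -(z ^ (-(m : ℤ)) * (1 - z ^ m)) := by
      have h : z ^ (-(m : ℤ)) * z ^ m = 1 := by
        rw [zpow_neg, zpow_natCast]
        exact inv_mul_cancel₀ (pow_ne_zero _ hz0)
      linear_combination -h
    rw [this, norm_neg, norm_mul, norm_zpow, hz, one_zpow, one_mul]
    simpa using hnat m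

theorem norm_one_sub_mFourier_le (y : Site d) (θ : UnitAddTorus (Fin d)) :
    ‖1 - mFourier y θ‖ ≤ siteNorm y * √(torusSq θ) := by
  have hprod : ∀ S : Finset (Fin d), ‖1 - ∏ i ∈ S, (fourier (y i) (θ i) : ℂ)‖ ≤
      ∑ i ∈ S, |(y i : ℝ)| * ‖1 - (fourier 1 (θ i) : ℂ)‖ := by
    intro S
    induction S using Finset.induction_on with
    | empty => simp
    | insert i S hi ih =>
      rw [Finset.prod_insert hi, Finset.sum_insert hi]
      have : 1 - (fourier (y i) (θ i) : ℂ) * ∏ i ∈ S, (fourier (y i) (θ i) : ℂ) =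
          (1 - (fourier (y i) (θ i) : ℂ)) +
            (fourier (y i) (θ i) : ℂ) * (1 - ∏ i ∈ S, (fourier (y i) (θ i) : ℂ)) := by ring
      rw [this]
      refine (norm_add_le _ _).trans (add_le_add ?_ ?_)
      · have h := norm_one_sub_zpow_le (norm_fourier_apply 1 (θ i)) (y i)
        have h2 : (fourier 1 (θ i) : ℂ) ^ (y i) = fourier (y i) (θ i) := by
          simp [fourier_apply, AddCircle.toCircle_zsmul]
        rwa [h2] at h
      · rw [norm_mul, norm_fourier_apply, one_mul]
        exact ih
  refine (hprod Finset.univ).trans ?_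
  refine (Real.sum_mul_le_sqrt_mul_sqrt _ _ _).trans ?_
  simp only [sq_abs]
  rfl

end Gaussian

/-! ### The symbol of the random walk is comparable to the squared distance -/

section Symbol

open UnitAddTorus

variable {d : ℕ} {Φ : Measure (Config d)}

theorem tsum_intensity_ne_top (hΦ : Integrable size Φ) : ∑' y, intensity Φ y ≠ ∞ := by
  rw [tsum_intensity hΦ]; exact ENNReal.ofReal_ne_top

theorem norm_one_sub_mFourier_le_two (y : Site d) (θ : UnitAddTorus (Fin d)) :
    ‖1 - mFourier y θ‖ ≤ 2 := by
  refine (norm_sub_le _ _).trans ?_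
  rw [norm_mFourier_apply, norm_one]; norm_num

theorem symbol_term_le (y : Site d) (θ : UnitAddTorus (Fin d)) :
    (intensity Φ y).toReal * (‖1 - mFourier y θ‖ ^ 2 / 2) ≤ (intensity Φ y).toReal * 2 := by
  refine mul_le_mul_of_nonneg_left ?_ ENNReal.toReal_nonneg
  nlinarith [norm_one_sub_mFourier_le_two y θ, norm_nonneg (1 - mFourier y θ)]

theorem summable_symbol (hΦ : Integrable size Φ) (θ : UnitAddTorus (Fin d)) :
    Summable fun y => (intensity Φ y).toReal * (‖1 - mFourier y θ‖ ^ 2 / 2) :=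
  Summable.of_nonneg_of_le (fun y => by positivity) (fun y => symbol_term_le y θ)
    ((ENNReal.summable_toReal (tsum_intensity_ne_top hΦ)).mul_right 2)

theorem continuous_symbol (hΦ : Integrable size Φ) : Continuous (symbol Φ) := by
  refine continuous_tsum (fun y => by fun_prop)
    ((ENNReal.summable_toReal (tsum_intensity_ne_top hΦ)).mul_right 2) fun y θ => ?_
  rw [Real.norm_of_nonneg (by positivity)]
  exact symbol_term_le y θ

theorem symbol_nonneg (θ : UnitAddTorus (Fin d)) : 0 ≤ symbol Φ θ :=
  tsum_nonneg fun y => by positivity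

theorem ae_apply_eq_zero_of_intensity_eq_zero {y : Site d} (h : intensity Φ y = 0) :
    ∀ᵐ φ ∂Φ, φ y = 0 := by
  rw [intensity, lintegral_eq_zero_iff (measurable_apply_config y)] at h
  filter_upwards [h] with φ hφ
  simpa using hφ

/-- The sites `y` for which the symbol controls the squared modulus of `1 - mFourier y`. They form
a subgroup; this is how irreducibility enters. -/
def controlledSites (Φ : Measure (Config d)) : AddSubgroup (Site d) where
  carrier := {y | ∃ K : ℝ, 0 ≤ K ∧ ∀ θ, ‖1 - mFourier y θ‖ ^ 2 ≤ K * symbol Φ θ}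
  zero_mem' := ⟨0, le_rfl, fun θ => by simp [mFourier_zero]⟩
  add_mem' := by
    rintro y y' ⟨K, hK, h⟩ ⟨K', hK', h'⟩
    refine ⟨2 * K + 2 * K', by positivity, fun θ => ?_⟩
    have h1 : 1 - mFourier (y + y') θ =
        (1 - mFourier y θ) + mFourier y θ * (1 - mFourier y' θ) := by
      rw [mFourier_add]; ring
    have h2 : ‖1 - mFourier (y + y') θ‖ ≤ ‖1 - mFourier y θ‖ + ‖1 - mFourier y' θ‖ := by
      rw [h1]
      refine (norm_add_le _ _).trans_eq ?_
      rw [norm_mul, norm_mFourier_apply, one_mul]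
    nlinarith [h θ, h' θ, norm_nonneg (1 - mFourier (y + y') θ),
      sq_nonneg (‖1 - mFourier y θ‖ - ‖1 - mFourier y' θ‖)]
  neg_mem' := by
    rintro y ⟨K, hK, h⟩
    refine ⟨K, hK, fun θ => ?_⟩
    have : 1 - mFourier (-y) θ = (starRingEnd ℂ) (1 - mFourier y θ) := by
      rw [mFourier_neg, map_sub, map_one]
    rw [this, RCLike.norm_conj]
    exact h θ

/-- Irreducibility: a site that is occupied with positive probability has positive intensity, and
the corresponding term of the symbol controls it. -/
theorem controlledSites_eq_top (hΦ : Integrable size Φ) (hirr : IsIrreducible Φ) :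
    controlledSites Φ = ⊤ := by
  refine hirr _ (ae_all_iff.2 fun y => ?_)
  by_cases hy : intensity Φ y = 0
  · filter_upwards [ae_apply_eq_zero_of_intensity_eq_zero hy] with φ hφ h
    exact absurd hφ h
  · refine ae_of_all _ fun φ _ => ?_
    have hpos : 0 < (intensity Φ y).toReal :=
      ENNReal.toReal_pos hy (ENNReal.ne_top_of_tsum_ne_top (tsum_intensity_ne_top hΦ) y)
    refine ⟨2 / (intensity Φ y).toReal, by positivity, fun θ => ?_⟩
    have h := (summable_symbol hΦ θ).le_tsum y fun j _ => by positivity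
    rw [div_mul_eq_mul_div, le_div_iff₀ hpos]
    change _ ≤ symbol Φ θ at h
    linarith

/-- The unit vectors are controlled sites, which bounds each squared chord by the symbol. -/
theorem exists_torusSq_le_symbol (hΦ : Integrable size Φ) (hirr : IsIrreducible Φ) :
    ∃ c : ℝ, 0 < c ∧ ∀ θ, c * torusSq θ ≤ symbol Φ θ := by
  have h : ∀ i : Fin d, (Pi.single i 1 : Site d) ∈ controlledSites Φ := fun i => by
    rw [controlledSites_eq_top hΦ hirr]; trivial
  choose K hK hKle using h
  have hS : 0 ≤ ∑ i, K i := Finset.sum_nonneg fun i _ => hK i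
  refine ⟨(∑ i, K i + 1)⁻¹, by positivity, fun θ => ?_⟩
  rw [inv_mul_le_iff₀ (by positivity)]
  have h1 : torusSq θ ≤ ∑ i, K i * symbol Φ θ := by
    refine Finset.sum_le_sum fun i _ => ?_
    have := hKle i θ
    rwa [mFourier_single] at this
  rw [← Finset.sum_mul] at h1
  nlinarith [symbol_nonneg (Φ := Φ) θ]

theorem siteNorm_nonneg (y : Site d) : 0 ≤ siteNorm y := Real.sqrt_nonneg _

theorem displacement_nonneg (r : ℕ) (φ : Config d) : 0 ≤ displacement r φ :=
  Finset.sum_nonneg fun y _ => by have := siteNorm_nonneg y; positivity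

theorem summable_intensity_mul_siteNorm_sq (hD : Integrable (displacement 2) Φ) :
    Summable fun y => (intensity Φ y).toReal * siteNorm y ^ 2 := by
  have h1 : ∑' y, intensity Φ y * ENNReal.ofReal (siteNorm y ^ 2) ≠ ∞ := by
    have h2 : ∑' y, intensity Φ y * ENNReal.ofReal (siteNorm y ^ 2) =
        ∫⁻ φ, ENNReal.ofReal (displacement 2 φ) ∂Φ := by
      unfold intensity
      simp_rw [← lintegral_mul_const _ (measurable_apply_config _)]
      rw [← lintegral_tsum fun y => ((measurable_apply_config y).mul_const _).aemeasurable]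
      refine lintegral_congr fun φ => ?_
      rw [tsum_eq_sum (s := φ.support) (fun y hy => by simp_all), displacement, Finsupp.sum,
        ENNReal.ofReal_sum_of_nonneg fun y _ => by positivity]
      refine Finset.sum_congr rfl fun y _ => ?_
      rw [ENNReal.ofReal_mul (by positivity), ENNReal.ofReal_natCast, mul_comm]
    rw [h2]
    exact (hD.lintegral_lt_top).ne
  refine (ENNReal.summable_toReal h1).congr fun y => ?_
  rw [ENNReal.toReal_mul, ENNReal.toReal_ofReal (by positivity)]

theorem exists_symbol_le_torusSq (hΦ : Integrable size Φ) (hD : Integrable (displacement 2) Φ) :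
    ∃ K : ℝ, 0 < K ∧ ∀ θ, symbol Φ θ ≤ K * torusSq θ := by
  have hs := summable_intensity_mul_siteNorm_sq hD
  refine ⟨(∑' y, (intensity Φ y).toReal * siteNorm y ^ 2) + 1, by positivity, fun θ => ?_⟩
  have h1 : symbol Φ θ ≤ ∑' y, (intensity Φ y).toReal * siteNorm y ^ 2 * torusSq θ := by
    refine (summable_symbol hΦ θ).tsum_le_tsum (fun y => ?_) (hs.mul_right _)
    rw [mul_assoc]
    refine mul_le_mul_of_nonneg_left ?_ ENNReal.toReal_nonneg
    have h2 := pow_le_pow_left₀ (norm_nonneg _) (norm_one_sub_mFourier_le y θ) 2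
    rw [mul_pow, Real.sq_sqrt (torusSq_nonneg θ)] at h2
    linarith [sq_nonneg ‖1 - mFourier y θ‖]
  rw [tsum_mul_right] at h1
  linarith [torusSq_nonneg θ]

theorem ae_size_eq_zero_imp (h : ∀ᵐ φ ∂Φ, size φ = 0) : ∀ᵐ φ ∂Φ, ∀ z, φ z = 0 := by
  filter_upwards [h] with φ hφ z
  have := tsum_config φ
  rw [hφ, ENNReal.ofReal_zero, ENNReal.tsum_eq_zero] at this
  simpa using this z

theorem meanOffspring_pos (hd : 1 ≤ d) (hΦ : Integrable size Φ) (hirr : IsIrreducible Φ) :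
    0 < meanOffspring Φ := by
  refine lt_of_le_of_ne (meanOffspring_nonneg Φ) fun h0 => ?_
  have h1 : ∀ᵐ φ ∂Φ, size φ = 0 :=
    (integral_eq_zero_iff_of_nonneg size_nonneg hΦ).1 h0.symm
  have h2 : (⊥ : AddSubgroup (Site d)) = ⊤ := hirr ⊥ (by
    filter_upwards [ae_size_eq_zero_imp h1] with φ hφ z hz
    exact absurd (hφ z) hz)
  have h3 : (Pi.single ⟨0, hd⟩ 1 : Site d) ∈ (⊥ : AddSubgroup (Site d)) := by
    rw [h2]; trivial
  have h4 := congrFun (AddSubgroup.mem_bot.1 h3) ⟨0, hd⟩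
  simp at h4

/-! ### Decay of the return probability -/

/-- The integral that bounds the smoothness of the return probability, in space and in time. -/
noncomputable def smoothness (Φ : Measure (Config d)) (s : ℝ) : ℝ :=
  ∫ θ, √(torusSq θ) * Real.exp (-(2 * s * symbol Φ θ)) ∂torusMeasure d

theorem continuous_exp_symbol (hΦ : Integrable size Φ) (s : ℝ) :
    Continuous fun θ => Real.exp (-(2 * s * symbol Φ θ)) := by
  have := continuous_symbol hΦ
  fun_prop

theorem integrable_exp_symbol (hΦ : Integrable size Φ) (s : ℝ) :
    Integrable (fun θ => Real.exp (-(2 * s * symbol Φ θ))) (torusMeasure d) :=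
  integrable_torus_of_continuous (continuous_exp_symbol hΦ s)

theorem integrable_smoothness (hΦ : Integrable size Φ) (s : ℝ) :
    Integrable (fun θ => √(torusSq θ) * Real.exp (-(2 * s * symbol Φ θ))) (torusMeasure d) := by
  have h1 := continuous_exp_symbol hΦ s
  have h2 := continuous_torusSq (d := d)
  exact integrable_torus_of_continuous (by fun_prop)

theorem returnProb_nonneg (s : ℝ) : 0 ≤ returnProb Φ s :=
  integral_nonneg fun _ => (Real.exp_pos _).le

theorem returnProb_antitone (hΦ : Integrable size Φ) : Antitone (returnProb Φ) := fun s t hst =>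
  integral_mono (integrable_exp_symbol hΦ t) (integrable_exp_symbol hΦ s) fun θ =>
    Real.exp_le_exp.2 (by nlinarith [symbol_nonneg (Φ := Φ) θ])

theorem exists_returnProb_le (hΦ : Integrable size Φ) (hirr : IsIrreducible Φ) :
    ∃ K : ℝ, 0 < K ∧ ∀ s : ℝ, 0 ≤ s → returnProb Φ s ≤ K * (1 + s) ^ (-(d : ℝ) / 2) := by
  obtain ⟨c, hc, hle⟩ := exists_torusSq_le_symbol hΦ hirr
  obtain ⟨K, hK, h⟩ := exists_integral_exp_torusSq_le d (c := 2 * c) (by positivity)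
  refine ⟨K, hK, fun s hs => le_trans ?_ (h s hs)⟩
  have hcont := continuous_torusSq (d := d)
  refine integral_mono (integrable_exp_symbol hΦ s)
    (integrable_torus_of_continuous (by fun_prop)) fun θ => Real.exp_le_exp.2 ?_
  nlinarith [hle θ]

theorem exists_le_returnProb (hΦ : Integrable size Φ) (hD : Integrable (displacement 2) Φ) :
    ∃ K : ℝ, 0 < K ∧ ∀ s : ℝ, 0 ≤ s → K * (1 + s) ^ (-(d : ℝ) / 2) ≤ returnProb Φ s := by
  obtain ⟨c, hc, hle⟩ := exists_symbol_le_torusSq hΦ hD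
  obtain ⟨K, hK, h⟩ := exists_le_integral_exp_torusSq d (c := 2 * c) (by positivity)
  refine ⟨K, hK, fun s hs => (h s hs).trans ?_⟩
  have hcont := continuous_torusSq (d := d)
  refine integral_mono (integrable_torus_of_continuous (by fun_prop))
    (integrable_exp_symbol hΦ s) fun θ => Real.exp_le_exp.2 ?_
  nlinarith [hle θ]

theorem sqrt_mul_exp_le {c q s Q : ℝ} (hc : 0 < c) (hq : 0 ≤ q) (hqQ : q ≤ Q) (hs : 0 ≤ s) :
    √q * Real.exp (-(2 * c * s * q)) ≤
      √(Q + (2 * c)⁻¹) * (1 + s) ^ (-(1 / 2) : ℝ) * Real.exp (-(c * s * q)) := by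
  have h1 : q * (1 + s) * Real.exp (-(2 * c * s * q)) ≤ Q + (2 * c)⁻¹ := by
    have h2 : 2 * c * s * q * Real.exp (-(2 * c * s * q)) ≤ 1 := by
      rw [Real.exp_neg, ← div_eq_mul_inv, div_le_one (Real.exp_pos _)]
      linarith [Real.add_one_le_exp (2 * c * s * q)]
    have h3 : s * q * Real.exp (-(2 * c * s * q)) ≤ (2 * c)⁻¹ := by
      rw [← mul_one (2 * c)⁻¹, le_inv_mul_iff₀ (by positivity)]
      linarith
    have h4 : Real.exp (-(2 * c * s * q)) ≤ 1 := Real.exp_le_one_iff.2 (by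
      have : 0 ≤ 2 * c * s * q := by positivity
      linarith)
    have h5 := mul_le_mul_of_nonneg_left h4 hq
    linarith
  have h6 : √q * Real.exp (-(c * s * q)) ≤ √(Q + (2 * c)⁻¹) * (1 + s) ^ (-(1 / 2) : ℝ) := by
    rw [Real.rpow_neg (by positivity), ← Real.sqrt_eq_rpow, ← div_eq_mul_inv,
      le_div_iff₀ (by positivity)]
    refine Real.le_sqrt_of_sq_le ?_
    rw [mul_pow, mul_pow, Real.sq_sqrt hq, Real.sq_sqrt (by positivity), ← Real.exp_nat_mul]
    refine le_trans (le_of_eq ?_) h1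
    push_cast
    rw [show (2 : ℝ) * -(c * s * q) = -(2 * c * s * q) by ring]
    ring
  calc √q * Real.exp (-(2 * c * s * q))
      = √q * Real.exp (-(c * s * q)) * Real.exp (-(c * s * q)) := by
        rw [mul_assoc √q, ← Real.exp_add]; congr 2; ring
    _ ≤ _ := mul_le_mul_of_nonneg_right h6 (Real.exp_pos _).le

/-- The factor `√(torusSq θ)` gains half a power of `s` over the return probability. -/
theorem exists_smoothness_le (hΦ : Integrable size Φ) (hirr : IsIrreducible Φ) :
    ∃ K : ℝ, 0 < K ∧ ∀ s : ℝ, 0 ≤ s → smoothness Φ s ≤ K * (1 + s) ^ (-((d : ℝ) + 1) / 2) := by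
  obtain ⟨c, hc, hle⟩ := exists_torusSq_le_symbol hΦ hirr
  obtain ⟨K, hK, h⟩ := exists_integral_exp_torusSq_le d hc
  refine ⟨√(4 * d + (2 * c)⁻¹) * K, by positivity, fun s hs => ?_⟩
  have hcont := continuous_torusSq (d := d)
  calc smoothness Φ s
      ≤ ∫ θ, √(4 * d + (2 * c)⁻¹) * (1 + s) ^ (-(1 / 2) : ℝ) *
          Real.exp (-(c * s * torusSq θ)) ∂torusMeasure d := by
        refine integral_mono (integrable_smoothness hΦ s)
          (integrable_torus_of_continuous (by fun_prop)) fun θ => ?_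
        refine le_trans ?_ (sqrt_mul_exp_le hc (torusSq_nonneg θ) (torusSq_le θ) hs)
        refine mul_le_mul_of_nonneg_left (Real.exp_le_exp.2 ?_) (Real.sqrt_nonneg _)
        nlinarith [hle θ]
    _ ≤ √(4 * d + (2 * c)⁻¹) * (1 + s) ^ (-(1 / 2) : ℝ) * (K * (1 + s) ^ (-(d : ℝ) / 2)) := by
        rw [integral_const_mul]
        exact mul_le_mul_of_nonneg_left (h s hs) (by positivity)
    _ = _ := by
        rw [show -((d : ℝ) + 1) / 2 = -(1 / 2) + -(d : ℝ) / 2 by ring,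
          Real.rpow_add (by positivity)]
        ring

theorem exists_returnProb_sub_le (hΦ : Integrable size Φ) (hD : Integrable (displacement 2) Φ) :
    ∃ K : ℝ, 0 ≤ K ∧ ∀ s t : ℝ, 0 ≤ s →
      returnProb Φ (t - s) - returnProb Φ t ≤ K * s * smoothness Φ (t - s) := by
  obtain ⟨K, hK, hle⟩ := exists_symbol_le_torusSq hΦ hD
  refine ⟨2 * K * √(4 * d), by positivity, fun s t hs => ?_⟩
  rw [returnProb, returnProb, ← integral_sub (integrable_exp_symbol hΦ _)
    (integrable_exp_symbol hΦ _), smoothness, ← integral_const_mul]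
  refine integral_mono ((integrable_exp_symbol hΦ _).sub (integrable_exp_symbol hΦ _))
    ((integrable_smoothness hΦ _).const_mul _) fun θ => ?_
  set E := Real.exp (-(2 * (t - s) * symbol Φ θ)) with hE
  have h1 : Real.exp (-(2 * t * symbol Φ θ)) = E * Real.exp (-(2 * s * symbol Φ θ)) := by
    rw [hE, ← Real.exp_add]; congr 1; ring
  have h2 : 1 - Real.exp (-(2 * s * symbol Φ θ)) ≤ 2 * s * symbol Φ θ := by
    linarith [Real.add_one_le_exp (-(2 * s * symbol Φ θ))]
  have h3 : torusSq θ ≤ √(4 * d) * √(torusSq θ) := by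
    conv_lhs => rw [← Real.mul_self_sqrt (torusSq_nonneg θ)]
    exact mul_le_mul_of_nonneg_right (Real.sqrt_le_sqrt (torusSq_le θ)) (Real.sqrt_nonneg _)
  have h4 : 2 * s * symbol Φ θ ≤ 2 * K * √(4 * d) * s * √(torusSq θ) := by
    have h5 := mul_le_mul_of_nonneg_left h3 hK.le
    have h6 := mul_le_mul_of_nonneg_left ((hle θ).trans h5) (by positivity : 0 ≤ 2 * s)
    linarith
  calc E - Real.exp (-(2 * t * symbol Φ θ)) = E * (1 - Real.exp (-(2 * s * symbol Φ θ))) := by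
        rw [h1]; ring
    _ ≤ E * (2 * K * √(4 * d) * s * √(torusSq θ)) :=
        mul_le_mul_of_nonneg_left (h2.trans h4) (Real.exp_pos _).le
    _ = _ := by ring

/-! ### Pairs of balls of one configuration -/

theorem series_config (φ : Config d) (θ : UnitAddTorus (Fin d)) :
    series (fun y => (φ y : ℝ≥0∞)) θ = ∑ y ∈ φ.support, (φ y : ℂ) * mFourier y θ := by
  rw [series, tsum_eq_sum (s := φ.support) (fun y hy => by simp_all)]
  simp

theorem norm_series_config_le (φ : Config d) (θ : UnitAddTorus (Fin d)) :
    ‖series (fun y => (φ y : ℝ≥0∞)) θ‖ ≤ size φ := by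
  rw [series_config]
  refine (norm_sum_le _ _).trans_eq ?_
  simp [norm_mFourier_apply, size, Finsupp.sum]

/-- Balls of a configuration with a small displacement are nearly at the same site. -/
theorem size_sub_norm_series_config_le (φ : Config d) (θ : UnitAddTorus (Fin d)) :
    size φ - ‖series (fun y => (φ y : ℝ≥0∞)) θ‖ ≤ displacement 1 φ * √(torusSq θ) := by
  have h1 : size φ = ‖((size φ : ℝ) : ℂ)‖ := by
    rw [Complex.norm_real, Real.norm_of_nonneg (size_nonneg φ)]
  have h2 : ((size φ : ℝ) : ℂ) - series (fun y => (φ y : ℝ≥0∞)) θ =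
      ∑ y ∈ φ.support, (φ y : ℂ) * (1 - mFourier y θ) := by
    rw [series_config, size, Finsupp.sum]
    push_cast
    rw [← Finset.sum_sub_distrib]
    exact Finset.sum_congr rfl fun y _ => by ring
  conv_lhs => rw [h1]
  refine (norm_sub_norm_le _ _).trans ?_
  rw [h2, displacement, Finsupp.sum, Finset.sum_mul]
  refine (norm_sum_le _ _).trans (Finset.sum_le_sum fun y _ => ?_)
  rw [norm_mul, Complex.norm_natCast, pow_one, mul_comm (siteNorm y), mul_assoc]
  exact mul_le_mul_of_nonneg_left (norm_one_sub_mFourier_le y θ) (by positivity)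

theorem integrable_pairReturn (hΦ : Integrable size Φ) (s : ℝ) (φ : Config d) :
    Integrable (fun θ => ‖series (fun y => (φ y : ℝ≥0∞)) θ‖ ^ 2 *
      Real.exp (-(2 * s * symbol Φ θ))) (torusMeasure d) := by
  have h1 := continuous_exp_symbol hΦ s
  simp_rw [series_config]
  exact integrable_torus_of_continuous (by fun_prop)

theorem pairReturn_nonneg (s : ℝ) (φ : Config d) : 0 ≤ pairReturn Φ s φ :=
  integral_nonneg fun _ => by positivity

theorem pairReturn_le (hΦ : Integrable size Φ) (s : ℝ) (φ : Config d) :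
    pairReturn Φ s φ ≤ size φ ^ 2 * returnProb Φ s := by
  rw [pairReturn, returnProb, ← integral_const_mul]
  refine integral_mono (integrable_pairReturn hΦ s φ)
    ((integrable_exp_symbol hΦ s).const_mul _) fun θ => ?_
  exact mul_le_mul_of_nonneg_right
    (pow_le_pow_left₀ (norm_nonneg _) (norm_series_config_le φ θ) 2) (Real.exp_pos _).le

theorem le_pairReturn_add (hΦ : Integrable size Φ) (s : ℝ) (φ : Config d) :
    size φ ^ 2 * returnProb Φ s ≤
      pairReturn Φ s φ + 2 * (size φ * displacement 1 φ) * smoothness Φ s := by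
  rw [pairReturn, returnProb, smoothness, ← integral_const_mul, ← integral_const_mul,
    ← integral_add (integrable_pairReturn hΦ s φ) ((integrable_smoothness hΦ s).const_mul _)]
  refine integral_mono ((integrable_exp_symbol hΦ s).const_mul _)
    ((integrable_pairReturn hΦ s φ).add ((integrable_smoothness hΦ s).const_mul _)) fun θ => ?_
  have h1 := size_sub_norm_series_config_le φ θ
  have h2 := norm_series_config_le φ θ
  have h3 := norm_nonneg (series (fun y => (φ y : ℝ≥0∞)) θ)
  have h4 : size φ ^ 2 ≤ ‖series (fun y => (φ y : ℝ≥0∞)) θ‖ ^ 2 +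
      2 * (size φ * displacement 1 φ) * √(torusSq θ) := by
    have h5 := mul_le_mul_of_nonneg_left h1 (size_nonneg φ)
    nlinarith
  have h6 := mul_le_mul_of_nonneg_right h4 (Real.exp_pos (-(2 * s * symbol Φ θ))).le
  dsimp only
  linarith

/-- Only the pairs of a ball with itself are kept, and `φ y ≤ φ y ^ 2` for natural numbers. -/
theorem sq_sum_le_sq_sum_of_natCast (φ : Config d) (g : Site d → ℝ≥0∞) :
    ∑' y, (φ y : ℝ≥0∞) * g y ^ 2 ≤ (∑' y, (φ y : ℝ≥0∞) * g y) ^ 2 := by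
  rw [sq (∑' y, _), ← ENNReal.tsum_mul_right]
  refine ENNReal.tsum_le_tsum fun y => ?_
  have h1 : (φ y : ℝ≥0∞) ≤ (φ y : ℝ≥0∞) * (φ y : ℝ≥0∞) := by
    exact_mod_cast Nat.le_mul_self (φ y)
  calc (φ y : ℝ≥0∞) * g y ^ 2 ≤ (φ y : ℝ≥0∞) * (φ y : ℝ≥0∞) * g y ^ 2 := by gcongr
    _ = (φ y : ℝ≥0∞) * g y * ((φ y : ℝ≥0∞) * g y) := by ring
    _ ≤ _ := by gcongr; exact ENNReal.le_tsum y

/-- A lower bound that needs no moment of the displacement: each ball of `φ` meets itself. -/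
theorem size_mul_returnProb_le (hΦ : Integrable size Φ) {s : ℝ} (hs : 0 ≤ s) (φ : Config d) :
    size φ * returnProb Φ s ≤ pairReturn Φ s φ := by
  have h1 : ∑' x, ∑' y, (φ y : ℝ≥0∞) * meanCount Φ s (x + y) ^ 2 ≤
      ∑' x, (∑' y, (φ y : ℝ≥0∞) * meanCount Φ s (x + y)) ^ 2 :=
    ENNReal.tsum_le_tsum fun x => sq_sum_le_sq_sum_of_natCast φ fun y => meanCount Φ s (x + y)
  rw [ENNReal.tsum_comm] at h1
  have h2 : ∀ y, ∑' x, meanCount Φ s (x + y) ^ 2 = ∑' x, meanCount Φ s x ^ 2 := fun y =>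
    tsum_add_right_eq (fun x => meanCount Φ s x ^ 2) y
  simp_rw [ENNReal.tsum_mul_left, h2, ENNReal.tsum_mul_right] at h1
  rw [tsum_sum_meanCount_sq hΦ hs, tsum_meanCount_sq hΦ hs, tsum_config,
    ← ENNReal.ofReal_mul (size_nonneg φ),
    ENNReal.ofReal_le_ofReal_iff (mul_nonneg (Real.exp_pos _).le (pairReturn_nonneg s φ))] at h1
  have h3 := Real.exp_pos (2 * meanOffspring Φ * s)
  nlinarith

end Symbol

/-! ### The variance of the normalized count -/

section Variance

variable {d : ℕ} {Φ : Measure (Config d)}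

/-- The mean over `Φ` of `pairReturn`. -/
noncomputable def meanPairReturn (Φ : Measure (Config d)) (s : ℝ) : ℝ :=
  ∫ φ, pairReturn Φ s φ ∂Φ

theorem meanPairReturn_nonneg (s : ℝ) : 0 ≤ meanPairReturn Φ s :=
  integral_nonneg fun φ => pairReturn_nonneg s φ

theorem toReal_toENNReal_eq_toNat (n : ℕ∞) : ((n : ℝ≥0∞)).toReal = (n.toNat : ℝ) := by
  cases n <;> simp

theorem normalizedCount_eq (x : Site d) (t : ℝ) (s : Sample d) :
    normalizedCount Φ x t s =
      Real.exp (-meanOffspring Φ * t) * ((monoCount x t s : ℝ≥0∞)).toReal := by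
  rw [normalizedCount, toReal_toENNReal_eq_toNat]

theorem summable_toReal_meanCount_sq (hΦ : Integrable size Φ) {t : ℝ} (ht : 0 ≤ t) :
    Summable fun z => (meanCount Φ t z).toReal ^ 2 := by
  have h1 : ∑' z, meanCount Φ t z ^ 2 ≠ ∞ := by
    rw [tsum_meanCount_sq hΦ ht]; exact ENNReal.ofReal_ne_top
  exact (ENNReal.summable_toReal h1).congr fun z => ENNReal.toReal_pow _ _

theorem returnProb_le_one {t : ℝ} (ht : 0 ≤ t) (hΦ : Integrable size Φ) : returnProb Φ t ≤ 1 := by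
  refine (returnProb_antitone hΦ ht).trans_eq ?_
  simp [returnProb]

/-- The variance of the normalized count when every site is initially occupied, so that all the
randomness comes from the branching. Here `s` is the time at which two lines of descent separate. -/
noncomputable def branchingVariance (Φ : Measure (Config d)) (t : ℝ) : ℝ :=
  ∫ s in Set.Ioc 0 t, Real.exp (-(meanOffspring Φ * s)) * meanPairReturn Φ (t - s)

theorem branchingVariance_nonneg (t : ℝ) : 0 ≤ branchingVariance Φ t :=
  setIntegral_nonneg measurableSet_Ioc fun _ _ =>
    mul_nonneg (Real.exp_pos _).le (meanPairReturn_nonneg _)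

variable [IsProbabilityMeasure Φ]

theorem integrable_size_of_sq (h2 : Integrable (fun φ => size φ ^ 2) Φ) : Integrable size Φ :=
  ((memLp_two_iff_integrable_sq Measurable.of_discrete.aestronglyMeasurable).2 h2).integrable
    one_le_two

theorem integrable_pairReturn_config (h2 : Integrable (fun φ => size φ ^ 2) Φ) (s : ℝ) :
    Integrable (pairReturn Φ s) Φ := by
  refine Integrable.mono' (h2.mul_const (returnProb Φ s))
    Measurable.of_discrete.aestronglyMeasurable (ae_of_all _ fun φ => ?_)
  rw [Real.norm_of_nonneg (pairReturn_nonneg s φ)]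
  exact pairReturn_le (integrable_size_of_sq h2) s φ

theorem meanPairReturn_antitone (h2 : Integrable (fun φ => size φ ^ 2) Φ) :
    Antitone (meanPairReturn Φ) := fun s t hst =>
  integral_mono (integrable_pairReturn_config h2 t) (integrable_pairReturn_config h2 s) fun φ =>
    integral_mono (integrable_pairReturn (integrable_size_of_sq h2) t φ)
      (integrable_pairReturn (integrable_size_of_sq h2) s φ) fun θ =>
      mul_le_mul_of_nonneg_left
        (Real.exp_le_exp.2 (by nlinarith [symbol_nonneg (Φ := Φ) θ])) (by positivity)

theorem meanPairReturn_le (h2 : Integrable (fun φ => size φ ^ 2) Φ) (s : ℝ) :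
    meanPairReturn Φ s ≤ (∫ φ, size φ ^ 2 ∂Φ) * returnProb Φ s := by
  rw [← integral_mul_const]
  exact integral_mono (integrable_pairReturn_config h2 s) (h2.mul_const _) fun φ =>
    pairReturn_le (integrable_size_of_sq h2) s φ

theorem le_meanPairReturn_add (h2 : Integrable (fun φ => size φ ^ 2) Φ)
    (h11 : Integrable (fun φ => size φ * displacement 1 φ) Φ) (s : ℝ) :
    (∫ φ, size φ ^ 2 ∂Φ) * returnProb Φ s ≤
      meanPairReturn Φ s + 2 * (∫ φ, size φ * displacement 1 φ ∂Φ) * smoothness Φ s := by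
  have hi := integrable_pairReturn_config h2 s
  have hj : Integrable (fun φ => 2 * (size φ * displacement 1 φ) * smoothness Φ s) Φ :=
    (h11.const_mul 2).mul_const _
  rw [← integral_mul_const, ← integral_const_mul, ← integral_mul_const, meanPairReturn,
    ← integral_add hi hj]
  exact integral_mono (h2.mul_const _) (hi.add hj) fun φ =>
    le_pairReturn_add (integrable_size_of_sq h2) s φ

theorem meanOffspring_mul_returnProb_le (h2 : Integrable (fun φ => size φ ^ 2) Φ) {s : ℝ}
    (hs : 0 ≤ s) : meanOffspring Φ * returnProb Φ s ≤ meanPairReturn Φ s := by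
  have hΦ := integrable_size_of_sq h2
  rw [meanOffspring, ← integral_mul_const]
  exact integral_mono (hΦ.mul_const _) (integrable_pairReturn_config h2 s) fun φ =>
    size_mul_returnProb_le hΦ hs φ

theorem familySq_eq (h2 : Integrable (fun φ => size φ ^ 2) Φ) {s : ℝ} (hs : 0 ≤ s) :
    familySq Φ s =
      ENNReal.ofReal (Real.exp (2 * meanOffspring Φ * s) * meanPairReturn Φ s) := by
  have hΦ := integrable_size_of_sq h2
  unfold familySq
  simp_rw [tsum_sum_meanCount_sq hΦ hs]
  rw [meanPairReturn, ← integral_const_mul, ofReal_integral_eq_lintegral_ofReal]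
  · exact (integrable_pairReturn_config h2 s).const_mul _
  · exact ae_of_all _ fun φ => mul_nonneg (Real.exp_pos _).le (pairReturn_nonneg s φ)

theorem integrableOn_branchingVariance (h2 : Integrable (fun φ => size φ ^ 2) Φ) (t : ℝ) :
    IntegrableOn (fun s => Real.exp (-(meanOffspring Φ * s)) * meanPairReturn Φ (t - s))
      (Set.Ioc 0 t) := by
  have hm : Measurable fun s => meanPairReturn Φ (t - s) :=
    (meanPairReturn_antitone h2).measurable.comp (measurable_const.sub measurable_id)
  refine Measure.integrableOn_of_bounded (M := meanPairReturn Φ 0) (by simp)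
    (by fun_prop) ?_
  filter_upwards [ae_restrict_mem measurableSet_Ioc] with s hs
  have h1 := meanPairReturn_nonneg (Φ := Φ) (t - s)
  rw [Real.norm_of_nonneg (mul_nonneg (Real.exp_pos _).le h1)]
  have h3 : Real.exp (-(meanOffspring Φ * s)) ≤ 1 := Real.exp_le_one_iff.2 (by
    have := mul_nonneg (meanOffspring_nonneg Φ) hs.1.le
    linarith)
  have h4 : meanPairReturn Φ (t - s) ≤ meanPairReturn Φ 0 :=
    meanPairReturn_antitone h2 (by linarith [hs.2])
  nlinarith

theorem lintegral_familySq (h2 : Integrable (fun φ => size φ ^ 2) Φ) (t : ℝ) :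
    ∫⁻ s in Set.Ioc 0 t, ENNReal.ofReal (Real.exp (meanOffspring Φ * s)) * familySq Φ (t - s) =
      ENNReal.ofReal (Real.exp (2 * meanOffspring Φ * t) * branchingVariance Φ t) := by
  rw [branchingVariance, ← integral_const_mul, ofReal_integral_eq_lintegral_ofReal]
  · refine setLIntegral_congr_fun measurableSet_Ioc fun s hs => ?_
    rw [familySq_eq h2 (by linarith [hs.2]), ← ENNReal.ofReal_mul (Real.exp_pos _).le,
      ← mul_assoc, ← mul_assoc, ← Real.exp_add, ← Real.exp_add]
    congr 3
    ring
  · exact (integrableOn_branchingVariance h2 t).const_mul _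
  · exact ae_of_all _ fun _ => mul_nonneg (Real.exp_pos _).le
      (mul_nonneg (Real.exp_pos _).le (meanPairReturn_nonneg _))

theorem lintegral_monoCount_ne_top (hΦ : Integrable size Φ) (p : unitInterval) {t : ℝ}
    (ht : 0 ≤ t) : ∫⁻ s, (monoCount 0 t s : ℝ≥0∞) ∂monoLaw Φ p ≠ ∞ := by
  rw [lintegral_monoCount hΦ p ht]
  exact ENNReal.mul_ne_top ENNReal.ofReal_ne_top ENNReal.ofReal_ne_top

theorem ae_monoCount_lt_top (hΦ : Integrable size Φ) (p : unitInterval) {t : ℝ} (ht : 0 ≤ t) :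
    ∀ᵐ s ∂monoLaw Φ p, (monoCount 0 t s : ℝ≥0∞) < ∞ :=
  ae_lt_top (measurable_monoCount 0 t) (lintegral_monoCount_ne_top hΦ p ht)

theorem integrable_normalizedCount (hΦ : Integrable size Φ) (p : unitInterval) {t : ℝ}
    (ht : 0 ≤ t) : Integrable (normalizedCount Φ 0 t) (monoLaw Φ p) := by
  simp_rw [funext fun s => normalizedCount_eq (Φ := Φ) 0 t s]
  exact (integrable_toReal_of_lintegral_ne_top (measurable_monoCount 0 t).aemeasurable
    (lintegral_monoCount_ne_top hΦ p ht)).const_mul _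

theorem integral_normalizedCount (hΦ : Integrable size Φ) (p : unitInterval) {t : ℝ}
    (ht : 0 ≤ t) : ∫ s, normalizedCount Φ 0 t s ∂monoLaw Φ p = p := by
  simp_rw [normalizedCount_eq]
  rw [integral_const_mul, integral_toReal (measurable_monoCount 0 t).aemeasurable
    (ae_monoCount_lt_top hΦ p ht), lintegral_monoCount hΦ p ht, ENNReal.toReal_mul,
    ENNReal.toReal_ofReal p.2.1, ENNReal.toReal_ofReal (Real.exp_pos _).le, mul_left_comm,
    ← Real.exp_add]
  simp

theorem lintegral_monoCount_sq_eq (h2 : Integrable (fun φ => size φ ^ 2) Φ) (p : unitInterval)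
    {t : ℝ} (ht : 0 ≤ t) :
    ∫⁻ s, (monoCount 0 t s : ℝ≥0∞) ^ 2 ∂monoLaw Φ p =
      ENNReal.ofReal (Real.exp (2 * meanOffspring Φ * t) *
        ((p : ℝ) ^ 2 + (p - (p : ℝ) ^ 2) * returnProb Φ t + p * branchingVariance Φ t)) := by
  have hΦ := integrable_size_of_sq h2
  have hp0 : (0 : ℝ) ≤ p := p.2.1
  have hp1 : (0 : ℝ) ≤ p - (p : ℝ) ^ 2 := by nlinarith [p.2.2]
  have hR := returnProb_nonneg (Φ := Φ) t
  have hB := branchingVariance_nonneg (Φ := Φ) t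
  rw [lintegral_monoCount_sq hΦ p ht, tsum_meanCount_sq hΦ ht, lintegral_familySq h2,
    ← ENNReal.ofReal_mul hp0, ← ENNReal.ofReal_pow (by positivity), ← ENNReal.ofReal_mul hp1,
    ← ENNReal.ofReal_mul hp0, ← ENNReal.ofReal_add (by positivity) (by positivity),
    ← ENNReal.ofReal_add (by positivity) (by positivity), mul_pow, ← Real.exp_nat_mul]
  congr 1
  push_cast
  rw [← mul_assoc (2 : ℝ)]
  ring

theorem integrable_normalizedCount_sq (h2 : Integrable (fun φ => size φ ^ 2) Φ) (p : unitInterval)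
    {t : ℝ} (ht : 0 ≤ t) :
    Integrable (fun s => normalizedCount Φ 0 t s ^ 2) (monoLaw Φ p) := by
  simp_rw [normalizedCount_eq, mul_pow, ← ENNReal.toReal_pow]
  refine (integrable_toReal_of_lintegral_ne_top
    ((measurable_monoCount 0 t).pow_const 2).aemeasurable ?_).const_mul _
  rw [lintegral_monoCount_sq_eq h2 p ht]
  exact ENNReal.ofReal_ne_top

theorem memLp_normalizedCount (h2 : Integrable (fun φ => size φ ^ 2) Φ) (p : unitInterval)
    {t : ℝ} (ht : 0 ≤ t) : MemLp (normalizedCount Φ 0 t) 2 (monoLaw Φ p) :=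
  (memLp_two_iff_integrable_sq
    (integrable_normalizedCount (integrable_size_of_sq h2) p ht).aestronglyMeasurable).2
    (integrable_normalizedCount_sq h2 p ht)

/-- The variance is the sum of that of the initial configuration and that of the branching. -/
theorem variance_normalizedCount (h2 : Integrable (fun φ => size φ ^ 2) Φ) (p : unitInterval)
    {t : ℝ} (ht : 0 ≤ t) :
    Var[normalizedCount Φ 0 t; monoLaw Φ p] =
      (p - (p : ℝ) ^ 2) * returnProb Φ t + p * branchingVariance Φ t := by
  have hΦ := integrable_size_of_sq h2
  have hp1 : (0 : ℝ) ≤ p - (p : ℝ) ^ 2 := by nlinarith [p.2.1, p.2.2]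
  have hp0 : (0 : ℝ) ≤ p := p.2.1
  have hR := returnProb_nonneg (Φ := Φ) t
  have hB := branchingVariance_nonneg (Φ := Φ) t
  rw [variance_eq_sub (memLp_normalizedCount h2 p ht), integral_normalizedCount hΦ p ht]
  have h3 : ∫ s, (normalizedCount Φ 0 t ^ 2) s ∂monoLaw Φ p =
      Real.exp (-meanOffspring Φ * t) ^ 2 * (Real.exp (2 * meanOffspring Φ * t) *
        ((p : ℝ) ^ 2 + (p - (p : ℝ) ^ 2) * returnProb Φ t + p * branchingVariance Φ t)) := by
    simp_rw [Pi.pow_apply, normalizedCount_eq, mul_pow, ← ENNReal.toReal_pow]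
    rw [integral_const_mul, integral_toReal
      ((measurable_monoCount 0 t).pow_const 2).aemeasurable, lintegral_monoCount_sq_eq h2 p ht,
      ENNReal.toReal_ofReal (by positivity)]
    filter_upwards [ae_monoCount_lt_top hΦ p ht] with s hs
    exact ENNReal.pow_lt_top hs
  rw [h3, ← mul_assoc, ← Real.exp_nat_mul, ← Real.exp_add]
  have h4 : ((2 : ℕ) : ℝ) * (-meanOffspring Φ * t) + 2 * meanOffspring Φ * t = 0 := by
    push_cast; ring
  rw [h4, Real.exp_zero]
  ring

theorem summable_meanProportion_sq (hΦ : Integrable size Φ) {t : ℝ} (ht : 0 ≤ t) :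
    Summable fun z => meanProportion Φ z t ^ 2 := by
  simp_rw [meanProportion_eq hΦ ht, mul_pow]
  exact (summable_toReal_meanCount_sq hΦ ht).mul_left _

theorem tsum_meanProportion_sq (hΦ : Integrable size Φ) {t : ℝ} (ht : 0 ≤ t) :
    ∑' z, meanProportion Φ z t ^ 2 = returnProb Φ t := by
  have h1 : ∑' z, meanCount Φ t z ^ 2 ≠ ∞ := by
    rw [tsum_meanCount_sq hΦ ht]; exact ENNReal.ofReal_ne_top
  simp_rw [meanProportion_eq hΦ ht, mul_pow, ← ENNReal.toReal_pow]
  rw [tsum_mul_left, ← ENNReal.tsum_toReal_eq fun z => ENNReal.ne_top_of_tsum_ne_top h1 z,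
    tsum_meanCount_sq hΦ ht, ENNReal.toReal_ofReal
      (mul_nonneg (Real.exp_pos _).le (returnProb_nonneg t)), ← mul_assoc, ← Real.exp_nat_mul,
    ← Real.exp_add]
  have h4 : ((2 : ℕ) : ℝ) * (-meanOffspring Φ * t) + 2 * meanOffspring Φ * t = 0 := by
    push_cast; ring
  rw [h4, Real.exp_zero, one_mul]

/-! ### Asymptotics of the branching variance -/

theorem integral_Ioc_exp_neg {c : ℝ} (hc : c ≠ 0) {t : ℝ} (ht : 0 ≤ t) :
    ∫ s in Set.Ioc 0 t, Real.exp (-(c * s)) = (1 - Real.exp (-(c * t))) / c := by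
  rw [← intervalIntegral.integral_of_le ht]
  have h : ∀ s ∈ Set.uIcc 0 t,
      HasDerivAt (fun s => -(Real.exp (-(c * s)) / c)) (Real.exp (-(c * s))) s := by
    intro s _
    have h1 : HasDerivAt (fun s => -(c * s)) (-(c * 1)) s := ((hasDerivAt_id s).const_mul c).neg
    have h2 := (h1.exp.div_const c).neg
    exact h2.congr_deriv (by rw [mul_one, mul_neg, neg_div, neg_neg, mul_div_assoc, div_self hc, mul_one])
  rw [intervalIntegral.integral_eq_sub_of_hasDerivAt h
    ((by fun_prop : Continuous fun s : ℝ => Real.exp (-(c * s))).intervalIntegrable _ _)]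
  rw [mul_zero, neg_zero, Real.exp_zero]
  ring

theorem exists_rpow_le_exp (a : ℝ) {c : ℝ} (hc : 0 < c) :
    ∃ K : ℝ, 0 < K ∧ ∀ s : ℝ, 0 ≤ s → (1 + s) ^ a ≤ K * Real.exp (c * s) := by
  obtain ⟨n, hn⟩ := exists_nat_ge a
  refine ⟨n.factorial / c ^ n * Real.exp c, by positivity, fun s hs => ?_⟩
  have h1 : (1 + s) ^ a ≤ (1 + s) ^ n := by
    rw [← Real.rpow_natCast]
    exact Real.rpow_le_rpow_of_exponent_le (by linarith) hn
  have h2 := Real.pow_div_factorial_le_exp (c * (1 + s)) (by positivity) n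
  rw [div_le_iff₀ (by positivity), mul_pow] at h2
  refine h1.trans ?_
  rw [mul_assoc, ← Real.exp_add, show c + c * s = c * (1 + s) by ring, div_mul_eq_mul_div,
    le_div_iff₀ (by positivity)]
  linarith

/-- A negative power of `t - s` may be replaced by that of `t`, at the cost of a power of `s`. -/
theorem rpow_neg_sub_le {a s t : ℝ} (ha : 0 ≤ a) (hs : 0 ≤ s) (hst : s ≤ t) :
    (1 + (t - s)) ^ (-a) ≤ (1 + s) ^ a * (1 + t) ^ (-a) := by
  have h1 : 0 < 1 + (t - s) := by linarith
  have h2 : 0 < 1 + s := by linarith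
  have h3 : 0 < 1 + t := by linarith
  rw [Real.rpow_neg h1.le, Real.rpow_neg h3.le, ← div_eq_mul_inv, inv_eq_one_div,
    div_le_div_iff₀ (by positivity) (by positivity), one_mul, ← Real.mul_rpow h2.le h1.le]
  exact Real.rpow_le_rpow h3.le (by nlinarith) ha

theorem meanOffspring_le_sq (h2 : Integrable (fun φ => size φ ^ 2) Φ) :
    meanOffspring Φ ≤ ∫ φ, size φ ^ 2 ∂Φ := by
  have h1 := (meanOffspring_mul_returnProb_le h2 le_rfl).trans (meanPairReturn_le h2 0)
  simpa [returnProb] using h1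

/-- At the separation time `s`, replacing `t - s` by `t` and all the balls of a configuration by
balls at the origin costs a power of `t` better by one half than the return probability; the loss
for large `s` is absorbed by `Real.exp (c * s)`. -/
theorem exists_abs_meanPairReturn_sub_le (hirr : IsIrreducible Φ)
    (h2 : Integrable (fun φ => size φ ^ 2) Φ)
    (h11 : Integrable (fun φ => size φ * displacement 1 φ) Φ)
    (hD : Integrable (displacement 2) Φ) {c : ℝ} (hc : 0 < c) :
    ∃ K : ℝ, 0 < K ∧ ∀ s t : ℝ, 0 ≤ s → s ≤ t →
      |meanPairReturn Φ (t - s) - (∫ φ, size φ ^ 2 ∂Φ) * returnProb Φ t| ≤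
        K * Real.exp (c * s) * (1 + t) ^ (-((d : ℝ) + 1) / 2) := by
  have hΦ := integrable_size_of_sq h2
  obtain ⟨K₁, hK₁, h1⟩ := exists_smoothness_le hΦ hirr
  obtain ⟨K₂, hK₂, h3⟩ := exists_returnProb_sub_le hΦ hD
  set a : ℝ := ((d : ℝ) + 1) / 2 with ha
  have ha0 : 0 ≤ a := by positivity
  have haneg : -((d : ℝ) + 1) / 2 = -a := by rw [ha]; ring
  obtain ⟨K₃, hK₃, h4⟩ := exists_rpow_le_exp (a + 1) hc
  set M := ∫ φ, size φ ^ 2 ∂Φ with hM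
  set N := ∫ φ, size φ * displacement 1 φ ∂Φ with hN
  have hM0 : 0 ≤ M := integral_nonneg fun φ => by positivity
  have hN0 : 0 ≤ N := integral_nonneg fun φ =>
    mul_nonneg (size_nonneg φ) (displacement_nonneg 1 φ)
  refine ⟨(M * K₂ + 2 * N + 1) * K₁ * K₃, by positivity, fun s t hs hst => ?_⟩
  have hts : 0 ≤ t - s := by linarith
  have ht : 0 ≤ t := hs.trans hst
  rw [haneg] at h1 ⊢
  have hT : 0 ≤ (1 + t) ^ (-a) := by positivity
  -- `(1 + s) * smoothness Φ (t - s)` bounds all the errors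
  have h5 : (1 + s) * smoothness Φ (t - s) ≤ K₁ * K₃ * Real.exp (c * s) * (1 + t) ^ (-a) := by
    have h6 := (h1 (t - s) hts).trans
      (mul_le_mul_of_nonneg_left (rpow_neg_sub_le ha0 hs hst) hK₁.le)
    have h7 : (1 + s) * (1 + s) ^ a = (1 + s) ^ (a + 1) := by
      rw [Real.rpow_add_one (by positivity)]; ring
    calc (1 + s) * smoothness Φ (t - s)
        ≤ (1 + s) * (K₁ * ((1 + s) ^ a * (1 + t) ^ (-a))) :=
          mul_le_mul_of_nonneg_left h6 (by positivity)
      _ = K₁ * (1 + s) ^ (a + 1) * (1 + t) ^ (-a) := by rw [← h7]; ring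
      _ ≤ K₁ * (K₃ * Real.exp (c * s)) * (1 + t) ^ (-a) := by
          have := h4 s hs
          gcongr
      _ = _ := by ring
  have hS0 : 0 ≤ smoothness Φ (t - s) :=
    integral_nonneg fun θ => mul_nonneg (Real.sqrt_nonneg _) (Real.exp_pos _).le
  have h8 := h3 s t hs
  have h9 := meanPairReturn_le h2 (t - s)
  have h10 := le_meanPairReturn_add h2 h11 (t - s)
  have h12 := returnProb_antitone hΦ (show t - s ≤ t by linarith)
  have h13 : M * returnProb Φ t ≤ M * returnProb Φ (t - s) := mul_le_mul_of_nonneg_left h12 hM0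
  have h14 : M * (returnProb Φ (t - s) - returnProb Φ t) ≤
      M * K₂ * ((1 + s) * smoothness Φ (t - s)) := by
    have := mul_le_mul_of_nonneg_left h8 hM0
    have h15 : 0 ≤ M * K₂ * smoothness Φ (t - s) := by positivity
    nlinarith
  have h16 : 2 * N * smoothness Φ (t - s) ≤ 2 * N * ((1 + s) * smoothness Φ (t - s)) := by
    have : 0 ≤ s * smoothness Φ (t - s) := by positivity
    exact mul_le_mul_of_nonneg_left (by linarith) (by positivity)
  have h17 : 0 ≤ (1 + s) * smoothness Φ (t - s) := by positivity
  have h18 : 0 ≤ M * K₂ * ((1 + s) * smoothness Φ (t - s)) := by positivity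
  have h19 : 0 ≤ 2 * N * ((1 + s) * smoothness Φ (t - s)) := by positivity
  have h20 := mul_le_mul_of_nonneg_left h5 (by positivity : 0 ≤ M * K₂ + 2 * N + 1)
  rw [abs_le]
  constructor <;> linarith

theorem exists_abs_branchingVariance_sub_le (hd : 1 ≤ d) (hirr : IsIrreducible Φ)
    (h2 : Integrable (fun φ => size φ ^ 2) Φ)
    (h11 : Integrable (fun φ => size φ * displacement 1 φ) Φ)
    (hD : Integrable (displacement 2) Φ) :
    ∃ K : ℝ, 0 < K ∧ ∀ t : ℝ, 0 ≤ t →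
      |branchingVariance Φ t - (∫ φ, size φ ^ 2 ∂Φ) / meanOffspring Φ * returnProb Φ t| ≤
        K * (1 + t) ^ (-((d : ℝ) + 1) / 2) := by
  have hΦ := integrable_size_of_sq h2
  have hl := meanOffspring_pos hd hΦ hirr
  set l := meanOffspring Φ with hldef
  obtain ⟨K₁, hK₁, h1⟩ := exists_abs_meanPairReturn_sub_le hirr h2 h11 hD (half_pos hl)
  obtain ⟨K₂, hK₂, h3⟩ := exists_rpow_le_exp (((d : ℝ) + 1) / 2) hl
  set M := ∫ φ, size φ ^ 2 ∂Φ with hM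
  have hM0 : 0 ≤ M := integral_nonneg fun φ => by positivity
  refine ⟨K₁ * (2 / l) + M / l * K₂, by positivity, fun t ht => ?_⟩
  set T := (1 + t) ^ (-((d : ℝ) + 1) / 2) with hT
  have hT0 : 0 < T := by positivity
  have hR0 := returnProb_nonneg (Φ := Φ) t
  have hR1 := returnProb_le_one ht hΦ
  have hexp : ∀ c : ℝ, IntegrableOn (fun s => Real.exp (-(c * s))) (Set.Ioc 0 t) := fun c =>
    (by fun_prop : Continuous fun s : ℝ => Real.exp (-(c * s))).integrableOn_Ioc
  have h4 : branchingVariance Φ t - M * returnProb Φ t * ((1 - Real.exp (-(l * t))) / l) =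
      ∫ s in Set.Ioc 0 t, Real.exp (-(l * s)) *
        (meanPairReturn Φ (t - s) - M * returnProb Φ t) := by
    rw [← integral_Ioc_exp_neg hl.ne' ht, ← integral_const_mul, branchingVariance,
      ← integral_sub (integrableOn_branchingVariance h2 t) ((hexp l).const_mul _)]
    exact integral_congr_ae (ae_of_all _ fun s => by dsimp only; ring)
  have h5 : |branchingVariance Φ t - M * returnProb Φ t * ((1 - Real.exp (-(l * t))) / l)| ≤
      K₁ * T * (2 / l) := by
    rw [h4, ← Real.norm_eq_abs]
    calc ‖∫ s in Set.Ioc 0 t, Real.exp (-(l * s)) *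
          (meanPairReturn Φ (t - s) - M * returnProb Φ t)‖
        ≤ ∫ s in Set.Ioc 0 t, K₁ * T * Real.exp (-(l / 2 * s)) := by
          refine norm_integral_le_of_norm_le ((hexp (l / 2)).const_mul _) ?_
          filter_upwards [ae_restrict_mem measurableSet_Ioc] with s hs
          rw [norm_mul, Real.norm_of_nonneg (Real.exp_pos _).le, Real.norm_eq_abs]
          refine (mul_le_mul_of_nonneg_left (h1 s t hs.1.le hs.2) (Real.exp_pos _).le).trans_eq ?_
          rw [show -(l / 2 * s) = -(l * s) + l / 2 * s by ring, Real.exp_add]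
          ring
      _ = K₁ * T * ((1 - Real.exp (-(l / 2 * t))) / (l / 2)) := by
          rw [integral_const_mul, integral_Ioc_exp_neg (half_pos hl).ne' ht]
      _ ≤ K₁ * T * (2 / l) := by
          refine mul_le_mul_of_nonneg_left ?_ (by positivity)
          rw [div_le_div_iff₀ (half_pos hl) hl]
          nlinarith [Real.exp_pos (-(l / 2 * t))]
  have h6 : Real.exp (-(l * t)) ≤ K₂ * T := by
    have h7 := h3 t ht
    rw [hT, show -((d : ℝ) + 1) / 2 = -(((d : ℝ) + 1) / 2) by ring, Real.rpow_neg (by positivity),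
      Real.exp_neg, ← div_eq_mul_inv, inv_eq_one_div,
      div_le_div_iff₀ (Real.exp_pos _) (by positivity), one_mul]
    exact h7
  have h7 : M / l * returnProb Φ t * Real.exp (-(l * t)) ≤ M / l * K₂ * T := by
    calc M / l * returnProb Φ t * Real.exp (-(l * t)) ≤ M / l * 1 * (K₂ * T) := by gcongr
      _ = _ := by ring
  have h8 : 0 ≤ M / l * returnProb Φ t * Real.exp (-(l * t)) := by positivity
  have h9 : M * returnProb Φ t * ((1 - Real.exp (-(l * t))) / l) =
      M / l * returnProb Φ t - M / l * returnProb Φ t * Real.exp (-(l * t)) := by ring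
  rw [h9] at h5
  rw [abs_le] at h5 ⊢
  constructor <;> linarith [h5.1, h5.2]

theorem le_branchingVariance (hd : 1 ≤ d) (hirr : IsIrreducible Φ)
    (h2 : Integrable (fun φ => size φ ^ 2) Φ) {t : ℝ} (ht : 1 ≤ t) :
    (1 - Real.exp (-meanOffspring Φ)) * returnProb Φ t ≤ branchingVariance Φ t := by
  have hΦ := integrable_size_of_sq h2
  have hl := meanOffspring_pos hd hΦ hirr
  have ht0 : 0 ≤ t := by linarith
  have hR0 := returnProb_nonneg (Φ := Φ) t
  calc (1 - Real.exp (-meanOffspring Φ)) * returnProb Φ t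
      ≤ (1 - Real.exp (-(meanOffspring Φ * t))) * returnProb Φ t := by
        refine mul_le_mul_of_nonneg_right ?_ hR0
        have : Real.exp (-(meanOffspring Φ * t)) ≤ Real.exp (-meanOffspring Φ) :=
          Real.exp_le_exp.2 (by nlinarith)
        linarith
    _ = ∫ s in Set.Ioc 0 t, meanOffspring Φ * returnProb Φ t *
          Real.exp (-(meanOffspring Φ * s)) := by
        rw [integral_const_mul, integral_Ioc_exp_neg hl.ne' ht0]
        field_simp
    _ ≤ branchingVariance Φ t := by
        refine setIntegral_mono_on ((by fun_prop : Continuous fun s : ℝ =>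
          meanOffspring Φ * returnProb Φ t * Real.exp (-(meanOffspring Φ * s))).integrableOn_Ioc)
          (integrableOn_branchingVariance h2 t) measurableSet_Ioc fun s hs => ?_
        rw [mul_comm]
        refine mul_le_mul_of_nonneg_left ?_ (Real.exp_pos _).le
        refine le_trans ?_ (meanOffspring_mul_returnProb_le h2 (by linarith [hs.2]))
        exact mul_le_mul_of_nonneg_left (returnProb_antitone hΦ (by linarith [hs.1])) hl.le

end Variance

end BranchingWalk

theorem proposition3p1 {d : ℕ} (hd : 1 ≤ d)
    (Φ : Measure (BranchingWalk.Config d)) [IsProbabilityMeasure Φ]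
    (hΦ : BranchingWalk.IsIrreducible Φ) (p : unitInterval) (hp : 0 < p) :
    (Integrable BranchingWalk.size Φ → ∀ t : ℝ, 0 ≤ t →
      (∀ᵐ s ∂BranchingWalk.monoLaw Φ p, BranchingWalk.monoCount 0 t s < ⊤) ∧
      Integrable (BranchingWalk.normalizedCount Φ 0 t) (BranchingWalk.monoLaw Φ p) ∧
      ∫ s, BranchingWalk.normalizedCount Φ 0 t s ∂BranchingWalk.monoLaw Φ p = (p : ℝ)) ∧
    (Integrable (fun φ => BranchingWalk.size φ ^ 2) Φ →
      Integrable (fun φ => BranchingWalk.displacement 1 φ ^ 2) Φ →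
      Integrable (BranchingWalk.displacement 2) Φ →
      ∃ C : ℝ, 0 < C ∧
        (∀ t : ℝ, 1 ≤ t →
          MemLp (BranchingWalk.normalizedCount Φ 0 t) 2 (BranchingWalk.monoLaw Φ p) ∧
          Summable fun z => BranchingWalk.meanProportion Φ z t ^ 2) ∧
        (∃ K : ℝ, ∀ t : ℝ, 1 ≤ t →
          |Var[BranchingWalk.normalizedCount Φ 0 t; BranchingWalk.monoLaw Φ p]
              - C * ∑' z, BranchingWalk.meanProportion Φ z t ^ 2|
            ≤ K * t ^ (-((d : ℝ) + 1) / 2)) ∧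
        ∃ c₁ c₂ : ℝ, 0 < c₁ ∧ ∀ t : ℝ, 1 ≤ t →
          c₁ * t ^ (-(d : ℝ) / 2)
              ≤ Var[BranchingWalk.normalizedCount Φ 0 t; BranchingWalk.monoLaw Φ p] ∧
          Var[BranchingWalk.normalizedCount Φ 0 t; BranchingWalk.monoLaw Φ p]
              ≤ c₂ * t ^ (-(d : ℝ) / 2)) := by
  refine ⟨fun h t ht => ⟨?_, BranchingWalk.integrable_normalizedCount h p ht,
    BranchingWalk.integral_normalizedCount h p ht⟩, fun h2 hD1 hD => ?_⟩
  · filter_upwards [BranchingWalk.ae_monoCount_lt_top h p ht] with s hs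
    simpa using hs
  have hΦ' := BranchingWalk.integrable_size_of_sq h2
  have h11 : Integrable (fun φ => BranchingWalk.size φ * BranchingWalk.displacement 1 φ) Φ :=
    ((memLp_two_iff_integrable_sq Measurable.of_discrete.aestronglyMeasurable).2 h2).integrable_mul
      ((memLp_two_iff_integrable_sq Measurable.of_discrete.aestronglyMeasurable).2 hD1)
  have hl := BranchingWalk.meanOffspring_pos hd hΦ' hΦ
  have hp0 : (0 : ℝ) < p := hp
  have hp1 : (0 : ℝ) ≤ p - (p : ℝ) ^ 2 := by nlinarith [p.2.2]
  have hM : 0 < ∫ φ, BranchingWalk.size φ ^ 2 ∂Φ :=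
    hl.trans_le (BranchingWalk.meanOffspring_le_sq h2)
  obtain ⟨K, hK, hKle⟩ := BranchingWalk.exists_abs_branchingVariance_sub_le hd hΦ h2 h11 hD
  obtain ⟨K₁, hK₁, hle⟩ := BranchingWalk.exists_returnProb_le hΦ' hΦ
  obtain ⟨K₂, hK₂, hge⟩ := BranchingWalk.exists_le_returnProb hΦ' hD
  set C : ℝ := (p - (p : ℝ) ^ 2) +
    p * ((∫ φ, BranchingWalk.size φ ^ 2 ∂Φ) / BranchingWalk.meanOffspring Φ) with hC
  have hC0 : 0 < C := by positivity
  have hpow : ∀ t : ℝ, 1 ≤ t → ∀ b : ℝ, 0 ≤ b → (1 + t) ^ (-b) ≤ t ^ (-b) := fun t ht b hb =>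
    Real.rpow_le_rpow_of_nonpos (by linarith) (by linarith) (by linarith)
  have herr : ∀ t : ℝ, 1 ≤ t →
      |Var[BranchingWalk.normalizedCount Φ 0 t; BranchingWalk.monoLaw Φ p]
        - C * BranchingWalk.returnProb Φ t| ≤ K * t ^ (-((d : ℝ) + 1) / 2) := by
    intro t ht
    have ht0 : 0 ≤ t := by linarith
    rw [BranchingWalk.variance_normalizedCount h2 p ht0]
    have h1 := hKle t ht0
    have h3 : (1 + t) ^ (-((d : ℝ) + 1) / 2) ≤ t ^ (-((d : ℝ) + 1) / 2) := by
      have := hpow t ht (((d : ℝ) + 1) / 2) (by positivity)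
      rwa [← neg_div] at this
    have h4 : (p - (p : ℝ) ^ 2) * BranchingWalk.returnProb Φ t +
        p * BranchingWalk.branchingVariance Φ t - C * BranchingWalk.returnProb Φ t =
        p * (BranchingWalk.branchingVariance Φ t - (∫ φ, BranchingWalk.size φ ^ 2 ∂Φ) /
          BranchingWalk.meanOffspring Φ * BranchingWalk.returnProb Φ t) := by
      rw [hC]; ring
    rw [h4, abs_mul, abs_of_pos hp0]
    calc _ ≤ 1 * (K * (1 + t) ^ (-((d : ℝ) + 1) / 2)) :=
          mul_le_mul p.2.2 h1 (abs_nonneg _) zero_le_one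
      _ ≤ K * t ^ (-((d : ℝ) + 1) / 2) := by
          rw [one_mul]
          exact mul_le_mul_of_nonneg_left h3 hK.le
  refine ⟨C, hC0, fun t ht => ⟨BranchingWalk.memLp_normalizedCount h2 p (by linarith),
    BranchingWalk.summable_meanProportion_sq hΦ' (by linarith)⟩, ⟨K, fun t ht => ?_⟩,
    p * (1 - Real.exp (-BranchingWalk.meanOffspring Φ)) * (K₂ * 2 ^ (-(d : ℝ) / 2)),
    C * K₁ + K, ?_, fun t ht => ⟨?_, ?_⟩⟩
  · rw [BranchingWalk.tsum_meanProportion_sq hΦ' (by linarith)]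
    exact herr t ht
  · have : Real.exp (-BranchingWalk.meanOffspring Φ) < 1 := Real.exp_lt_one_iff.2 (by linarith)
    have h1 : 0 < 1 - Real.exp (-BranchingWalk.meanOffspring Φ) := by linarith
    positivity
  · have ht0 : 0 ≤ t := by linarith
    have hlt : Real.exp (-BranchingWalk.meanOffspring Φ) < 1 := Real.exp_lt_one_iff.2 (by linarith)
    have h1 : 0 < 1 - Real.exp (-BranchingWalk.meanOffspring Φ) := by linarith
    rw [BranchingWalk.variance_normalizedCount h2 p ht0]
    have h3 := BranchingWalk.le_branchingVariance hd hΦ h2 ht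
    have h4 := BranchingWalk.returnProb_nonneg (Φ := Φ) t
    -- `1 + t ≤ 2 * t`
    have h5 : 2 ^ (-(d : ℝ) / 2) * t ^ (-(d : ℝ) / 2) ≤ (1 + t) ^ (-(d : ℝ) / 2) := by
      rw [← Real.mul_rpow (by norm_num) ht0]
      refine Real.rpow_le_rpow_of_nonpos (by linarith) (by linarith) ?_
      rw [neg_div]
      have : (0 : ℝ) ≤ (d : ℝ) / 2 := by positivity
      linarith
    have h6 := (mul_le_mul_of_nonneg_left h5 hK₂.le).trans (hge t ht0)
    have h7 := mul_le_mul_of_nonneg_left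
      ((mul_le_mul_of_nonneg_left h6 h1.le).trans h3) hp0.le
    have h8 := mul_nonneg hp1 h4
    linarith
  · have ht0 : 0 ≤ t := by linarith
    have h1 := (abs_le.1 (herr t ht)).2
    have h3 : (1 + t) ^ (-(d : ℝ) / 2) ≤ t ^ (-(d : ℝ) / 2) := by
      have := hpow t ht ((d : ℝ) / 2) (by positivity)
      rwa [← neg_div] at this
    have h4 : t ^ (-((d : ℝ) + 1) / 2) ≤ t ^ (-(d : ℝ) / 2) :=
      Real.rpow_le_rpow_of_exponent_le ht (by linarith)
    have h5 := mul_le_mul_of_nonneg_left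
      ((hle t ht0).trans (mul_le_mul_of_nonneg_left h3 hK₁.le)) hC0.le
    have h6 := mul_le_mul_of_nonneg_left h4 hK.le
    linarith
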